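/- **Setting.** Let $M$ be an $n$-dimensional generalized Frobenius manifold with non-flat unity, of charge $d$ (a smooth real or complex manifold whose tangent spaces are Frobenius algebras $(\cdot,\langle\ ,\ \rangle,e)$ depending smoothly on the point, with: $\langle\ ,\ \rangle$ flat with Levi-Civita connection $\nabla$, and $\nabla e\not\equiv0$; $\nabla c$ a symmetric 4-tensor for $c(u,v,w)=\langle u\cdot v,w\rangle$; an Euler vector field $E$ such that $\nabla\nabla E=0$, $\nabla E$ is diagonalizable, $\mathcal L_E(a\cdot b)=\mathcal L_Ea\cdot b+a\cdot\mathcal L_Eb+a\cdot b$ and $\mathcal L_E\langle a,b\rangle=\langle\mathcal L_Ea,b\rangle+\langle a,\mathcal L_Eb\rangle+(2-d)\langle a,b\rangle$). Greek indices run over $1,\dots,n$ and are summed when repeated. Fix, near a point of $M$, the following. Flat coordinates $v^1,\dots,v^n$, with $\eta_{\alpha\beta}=\langle\partial_\alpha,\partial_\beta\rangle$ and $\partial_\alpha\cdot\partial_\beta=c_{\alpha\beta}^\gamma\partial_\gamma$, such that $E=\sum_\alpha[(1-\frac d2-\mu_\alpha)v^\alpha+r_1^\alpha]\partial_\alpha$;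 put $\mu=\mathrm{diag}(\mu_1,\dots,\mu_n)$. Matrices $R_s$ ($s\ge1$) and vector fields $\xi_{\alpha,p}$ ($p\ge0$) with $(R_s)^\alpha_\beta=0$ unless $\mu_\alpha-\mu_\beta=s$, $R_s^{T}\eta=(-1)^{s+1}\eta R_s$, $\xi_{\alpha,0}=\partial_\alpha$, $\partial_\alpha\xi^\gamma_{\beta,p+1}=c^\gamma_{\alpha\sigma}\xi^\sigma_{\beta,p}$, $\partial_E\xi_{\alpha,p}=(p+\mu_\alpha-\mu)\xi_{\alpha,p}+\sum_{s=1}^p(R_s)^\gamma_\alpha\xi_{\gamma,p-s}$ and $\langle\xi_\alpha(-z),\xi_\beta(z)\rangle=\eta_{\alpha\beta}$, where $\xi_\alpha(z)=\sum_p\xi_{\alpha,p}z^p$. Vector fields $\xi_{0,p}$ ($p\in\mathbb Z$) and constants $r_p^\alpha$ ($p\ge1$) with $r_p^\alpha=0$ unless $\mu_\alpha+\frac d2=p$, $\xi_{0,0}=e$, $\xi_{0,1}=v^\alpha\partial_\alpha$, $\partial_\alpha\xi_{0,p}^\gamma=c^\gamma_{\alpha\beta}\xi^\beta_{0,p-1}$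 for $p\ge1$, $\partial_E\xi_{0,p}=(p-\frac d2-\mu)\xi_{0,p}+\sum_{s=1}^pr_s^\lambda\xi_{\lambda,p-s}$ for $p\ge0$, and $\xi_{0,-p}=\partial_e\xi_{0,-p+1}$ for $p\ge1$. Functions $\theta_{0,p}$ ($p\in\mathbb Z$) and constants $c_p$ with $\nabla\theta_{0,p}=\xi_{0,p}$, $\partial_E\theta_{0,p}=(p-d+1)\theta_{0,p}+\sum_{s=1}^pr_s^\varepsilon\theta_{\varepsilon,p-s}+c_p$, where $\theta_{\varepsilon,l}=\sum_{k=0}^l(-1)^k\langle\xi_{0,k+1},\xi_{\varepsilon,l-k}\rangle$, and $c_p\ne0$ only if $p=d-1$ and $p$ is even. **The $(n+2)$-dimensional monodromy data.** With indices $0,1,\dots,n+1$, let $$\tilde\eta=\begin{pmatrix}&&1\\&\eta&\\1&&\end{pmatrix},\quad \tilde\mu=\mathrm{diag}\left(-\tfrac d2,\mu_1,\dots,\mu_n,\tfrac d2\right),\quad \tilde R=\sum_{s\ge1}\tilde R_s,\quad \tilde R_s=\begin{pmatrix}0&0&0\\ \mathbf r_s&R_s&0\\ c_{s-1}&\mathbf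 r_s^\dagger&0\end{pmatrix},$$ with $\mathbf r_s=(r_s^1,\dots,r_s^n)^{T}$ and $(\mathbf r_s^\dagger)_\alpha=(-1)^{s+1}r_s^\beta\eta_{\alpha\beta}$. Let $$\widetilde G(\nu)=-\frac1{2\pi}\left(e^{\pi i\tilde R}e^{\pi i(\tilde\mu+\nu)}+e^{-\pi i\tilde R}e^{-\pi i(\tilde\mu+\nu)}\right)\tilde\eta^{-1},\qquad \tilde\phi^{(\nu)}(\mathbf a;\lambda)=\int_0^\infty\frac{dz}{\sqrt z}e^{-\lambda z}\sum_{p\in\mathbb Z}\mathbf a_p^{T}\tilde\eta\,z^{p+\tilde\mu+\nu}z^{\tilde R},$$ where $\mathbf a_p=(a_p^0,\dots,a_p^{n+1})^{T}$ and the integral is understood as a formal series in $\lambda$ by $$\int_0^\infty e^{-\lambda z}z^{p+\tilde\mu+\nu-\frac12}z^{\tilde R}dz=\sum_{s\ge0}\left[e^{\tilde R\partial_\nu}\right]_s\Gamma\left(p+\tilde\mu+\nu+s+\tfrac12\right)\lambda^{-(p+\tilde\mu+\nu+s+\frac12)}\lambda^{-\tilde R},$$ $\partial_\nu$ acting on the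 Gamma function only; $[P]_s=\sum_{\kappa}\pi_{\kappa+s}P\pi_\kappa$, summed over the eigenvalues $\kappa$ of $\tilde\mu$, where $\pi_\kappa$ is the projection to the eigenspace of $\kappa$. **The operators.** Let $\mathcal I=(\{1,\dots,n\}\times\mathbb Z_{\ge0})\cup(\{0\}\times\mathbb Z)$. On formal power series over $\mathbb C$ in the variables $t^{i,p}$, $(i,p)\in\mathcal I$, put $$a_p^0=(-1)^{p+1}t^{0,-p-1},\quad a_p^{n+1}=\frac{\partial}{\partial t^{0,p}}\quad(p\in\mathbb Z),\qquad a_p^\alpha=\begin{cases}\eta^{\alpha\beta}\frac{\partial}{\partial t^{\beta,p}},&p\ge0,\\(-1)^{p+1}t^{\alpha,-p-1},&p<0,\end{cases}$$ and let $:\ :$ put the differentiations on the right. If $d$ is a negative odd integer and $p,q,m$ are integers with $p+q+m=d-1$ and $m\ge0$, let $$C_{m;p,q}=\frac{(-1)^pc_{d-1}}2\sum_{k=0}^{m}(-1)^k\left(p-\tfrac d2+\tfrac12\right)^{[k]}\left(q-\tfrac d2+\tfrac12\right)^{[m-k]},\qquad x^{[k]}=x(x+1)\cdots(x+k-1),$$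 and let $C_{m;p,q}=0$ in all other cases. The Virasoro operators $L_m$, $m\ge-1$, of $M$ are defined by $$\sum_{m\ge-1}\frac{L_m}{\lambda^{m+2}}=-\frac12\lim_{\nu\to0}:\left[\frac{\partial\tilde\phi_i^{(\nu)}}{\partial\lambda}\widetilde G^{ij}(\nu)\frac{\partial\tilde\phi_j^{(-\nu)}}{\partial\lambda}\right]_-:+\sum_{m\ge-1}\sum_{p,q\in\mathbb Z}\frac{C_{m;p,q}}{\lambda^{m+2}}t^{0,p}t^{0,q}+\frac1{4\lambda^2}\mathrm{tr}\left(\tfrac14-\mu^2\right),$$ where $i,j$ are summed over $0,\dots,n+1$, $[\ ]_-$ keeps the terms in $\lambda^{-m-2}$ with $m\ge-1$, and the limit is taken in each coefficient. **Proposition 8.2.** The limits exist, each coefficient of $L_mf$ is given by finite sums for every formal power series $f$, the $L_m$ are linear operators, and $$[L_m,L_k]=(m-k)L_{m+k},\qquad m,k\ge-1,$$ where for $m=k=-1$ the right-hand side is $0$. -/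

import Mathlib

open scoped Manifold ContDiff Topology

noncomputable section

/-! ## Generalized Frobenius manifolds with non-flat unity -/

namespace GFM

/-- The tensors of a Frobenius manifold structure on `M` (`𝕜` is `ℝ` or `ℂ`): on each tangent space
a bilinear form, a product and a unit vector `e`; moreover the Euler vector field `E` and the
charge `d`. -/
structure PreFrobenius (𝕜 : Type*) [RCLike 𝕜] (n : ℕ) (M : Type*) [TopologicalSpace M]
    [ChartedSpace (Fin n → 𝕜) M] where
  metric : ∀ x : M, TangentSpace 𝓘(𝕜, Fin n → 𝕜) x →ₗ[𝕜] TangentSpace 𝓘(𝕜, Fin n → 𝕜) x →ₗ[𝕜] 𝕜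
  mul : ∀ x : M, TangentSpace 𝓘(𝕜, Fin n → 𝕜) x →ₗ[𝕜] TangentSpace 𝓘(𝕜, Fin n → 𝕜) x →ₗ[𝕜]
    TangentSpace 𝓘(𝕜, Fin n → 𝕜) x
  e : ∀ x : M, TangentSpace 𝓘(𝕜, Fin n → 𝕜) x
  E : ∀ x : M, TangentSpace 𝓘(𝕜, Fin n → 𝕜) x
  d : 𝕜

/-- The partial derivative `∂_α g` at the point `v` of a function of the coordinates. -/
def pd {𝕜 : Type*} [RCLike 𝕜] {n : ℕ} (α : Fin n) (g : (Fin n → 𝕜) → 𝕜) (v : Fin n → 𝕜) : 𝕜 :=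
  fderiv 𝕜 g v (Pi.single α 1)

section Components

variable {𝕜 : Type*} [RCLike 𝕜] {n : ℕ} {M : Type*} [TopologicalSpace M]
  [ChartedSpace (Fin n → 𝕜) M]

/-- The coordinate vector field `∂_α` of the chart `φ`, at the point with coordinates `v`. -/
def frame (φ : OpenPartialHomeomorph M (Fin n → 𝕜)) (α : Fin n) (v : Fin n → 𝕜) :
    TangentSpace 𝓘(𝕜, Fin n → 𝕜) (φ.symm v) :=
  mfderiv 𝓘(𝕜, Fin n → 𝕜) 𝓘(𝕜, Fin n → 𝕜) φ.symm v
    (Pi.single α 1 : Fin n → 𝕜)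

/-- The `γ`-th component, in the chart `φ`, of a tangent vector at the point with coordinates
`v`. -/
def comp (φ : OpenPartialHomeomorph M (Fin n → 𝕜)) (v : Fin n → 𝕜)
    (w : TangentSpace 𝓘(𝕜, Fin n → 𝕜) (φ.symm v)) (γ : Fin n) : 𝕜 :=
  (mfderiv 𝓘(𝕜, Fin n → 𝕜) 𝓘(𝕜, Fin n → 𝕜) φ (φ.symm v) w : Fin n → 𝕜) γ

namespace PreFrobenius

variable (F : PreFrobenius 𝕜 n M) (φ : OpenPartialHomeomorph M (Fin n → 𝕜))

/-- `η_{αβ} = ⟨∂_α, ∂_β⟩` as a function of the coordinates. -/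
def eta (α β : Fin n) (v : Fin n → 𝕜) : 𝕜 := F.metric (φ.symm v) (frame φ α v) (frame φ β v)

/-- The structure constants `c^γ_{αβ}`: `∂_α · ∂_β = c^γ_{αβ} ∂_γ`. -/
def cUp (γ α β : Fin n) (v : Fin n → 𝕜) : 𝕜 :=
  comp φ v (F.mul (φ.symm v) (frame φ α v) (frame φ β v)) γ

/-- The 3-tensor `c_{αβγ} = ⟨∂_α · ∂_β, ∂_γ⟩`. -/
def cDown (α β γ : Fin n) (v : Fin n → 𝕜) : 𝕜 :=
  F.metric (φ.symm v) (F.mul (φ.symm v) (frame φ α v) (frame φ β v)) (frame φ γ v)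

/-- The components of the unit vector field. -/
def eComp (α : Fin n) (v : Fin n → 𝕜) : 𝕜 := comp φ v (F.e (φ.symm v)) α

/-- The components of the Euler vector field. -/
def EComp (α : Fin n) (v : Fin n → 𝕜) : 𝕜 := comp φ v (F.E (φ.symm v)) α

/-- The derivative `∂_E g` of a function of the coordinates along the Euler vector field. -/
def dE (g : (Fin n → 𝕜) → 𝕜) (v : Fin n → 𝕜) : 𝕜 := ∑ α, F.EComp φ α v * pd α g v

/-- The derivative `∂_e g` of a function of the coordinates along the unit vector field. -/
def de (g : (Fin n → 𝕜) → 𝕜) (v : Fin n → 𝕜) : 𝕜 := ∑ α, F.eComp φ α v * pd α g v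

/-- `φ` is a (compatible) chart whose coordinates are flat for the metric: the components
`η_{αβ}` are constant, i.e. the Levi-Civita connection is `∂_α` in this chart. -/
def IsFlatChart : Prop :=
  φ ∈ IsManifold.maximalAtlas 𝓘(𝕜, Fin n → 𝕜) ∞ M ∧
    ∀ α β, ∀ v ∈ φ.target, ∀ w ∈ φ.target, F.eta φ α β v = F.eta φ α β w

end PreFrobenius

end Components

/-- A generalized Frobenius manifold with non-flat unity, of dimension `n`. The conditions that
involve the Levi-Civita connection or Lie derivatives are written in flat coordinates. -/
structure GeneralizedFrobenius (𝕜 : Type*) [RCLike 𝕜] (n : ℕ) (M : Type*) [TopologicalSpace M]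
    [ChartedSpace (Fin n → 𝕜) M] [IsManifold 𝓘(𝕜, Fin n → 𝕜) ∞ M]
    extends PreFrobenius 𝕜 n M where
  mul_comm : ∀ x u v, mul x u v = mul x v u
  mul_assoc : ∀ x u v w, mul x (mul x u v) w = mul x u (mul x v w)
  e_mul : ∀ x u, mul x (e x) u = u
  metric_symm : ∀ x u v, metric x u v = metric x v u
  metric_nondeg : ∀ x u, (∀ v, metric x u v = 0) → u = 0
  metric_invariant : ∀ x u v w, metric x (mul x u v) w = metric x u (mul x v w)
  /-- the metric is flat: every point has a neighbourhood with flat coordinates -/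
  flat : ∀ x : M, ∃ φ, toPreFrobenius.IsFlatChart φ ∧ x ∈ φ.source
  smooth_mul : ∀ φ, toPreFrobenius.IsFlatChart φ → ∀ γ α β,
    ContDiffOn 𝕜 ∞ (toPreFrobenius.cUp φ γ α β) φ.target
  smooth_e : ∀ φ, toPreFrobenius.IsFlatChart φ → ∀ α,
    ContDiffOn 𝕜 ∞ (toPreFrobenius.eComp φ α) φ.target
  smooth_E : ∀ φ, toPreFrobenius.IsFlatChart φ → ∀ α,
    ContDiffOn 𝕜 ∞ (toPreFrobenius.EComp φ α) φ.target
  /-- `∇e` does not vanish identically on `M` -/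
  nonflat_unit : ∃ φ, toPreFrobenius.IsFlatChart φ ∧ ∃ v ∈ φ.target, ∃ α β,
    pd α (toPreFrobenius.eComp φ β) v ≠ 0
  /-- the 4-tensor `∇c` is symmetric -/
  symm_nabla_c : ∀ φ, toPreFrobenius.IsFlatChart φ → ∀ v ∈ φ.target, ∀ δ α β γ,
    pd δ (toPreFrobenius.cDown φ α β γ) v = pd α (toPreFrobenius.cDown φ δ β γ) v
  /-- `∇∇E = 0` -/
  nabla_nabla_E : ∀ φ, toPreFrobenius.IsFlatChart φ → ∀ v ∈ φ.target, ∀ α β γ,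
    pd α (pd β (toPreFrobenius.EComp φ γ)) v = 0
  /-- `∇E` is diagonalizable -/
  diag_E : ∀ φ, toPreFrobenius.IsFlatChart φ → ∀ v ∈ φ.target,
    ∃ (P : Matrix (Fin n) (Fin n) 𝕜) (δ : Fin n → 𝕜), IsUnit P.det ∧
      Matrix.of (fun γ α => pd α (toPreFrobenius.EComp φ γ) v) * P = P * Matrix.diagonal δ
  /-- `L_E (a · b) = L_E a · b + a · L_E b + a · b` -/
  lie_mul : ∀ φ, toPreFrobenius.IsFlatChart φ → ∀ v ∈ φ.target, ∀ α β γ,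
    toPreFrobenius.dE φ (toPreFrobenius.cUp φ γ α β) v
      - ∑ ε, toPreFrobenius.cUp φ ε α β v * pd ε (toPreFrobenius.EComp φ γ) v
      + ∑ ε, pd α (toPreFrobenius.EComp φ ε) v * toPreFrobenius.cUp φ γ ε β v
      + ∑ ε, pd β (toPreFrobenius.EComp φ ε) v * toPreFrobenius.cUp φ γ α ε v
      = toPreFrobenius.cUp φ γ α β v
  /-- `L_E ⟨a, b⟩ = ⟨L_E a, b⟩ + ⟨a, L_E b⟩ + (2 - d) ⟨a, b⟩` -/
  lie_metric : ∀ φ, toPreFrobenius.IsFlatChart φ → ∀ v ∈ φ.target, ∀ α β,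
    ∑ ε, pd α (toPreFrobenius.EComp φ ε) v * toPreFrobenius.eta φ ε β v
      + ∑ ε, pd β (toPreFrobenius.EComp φ ε) v * toPreFrobenius.eta φ α ε v
      = (2 - d) * toPreFrobenius.eta φ α β v

/-- The choices that are fixed on a generalized Frobenius manifold near a point `v₀`: flat
coordinates that diagonalize `∇E`, the monodromy data `μ, R` at `z = 0` with a system of deformed
flat coordinates (through the gradients `ξ_{α,p}`), the vector fields `ξ_{0,p}` with the constants
`r_p^α`, and the functions `θ_{0,p}` with the constants `c_p`. -/
structure Calibration {𝕜 : Type*} [RCLike 𝕜] {n : ℕ} {M : Type*} [TopologicalSpace M]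
    [ChartedSpace (Fin n → 𝕜) M] [IsManifold 𝓘(𝕜, Fin n → 𝕜) ∞ M]
    (F : GeneralizedFrobenius 𝕜 n M) where
  v₀ : M
  φ : OpenPartialHomeomorph M (Fin n → 𝕜)
  flat : F.IsFlatChart φ
  mem_source : v₀ ∈ φ.source
  /-- the diagonal entries of `μ = (2 - d)/2 - ∇E` -/
  μ : Fin n → 𝕜
  /-- `R s` is the component `R_s` (`s ≥ 1`) of `R = R_1 + R_2 + ⋯` -/
  R : ℕ → Matrix (Fin n) (Fin n) 𝕜
  /-- `r s α = r_s^α` (`s ≥ 1`) -/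
  r : ℕ → Fin n → 𝕜
  c : ℤ → 𝕜
  /-- `ξ α p γ` is the component `ξ_{α,p}^γ` -/
  ξ : Fin n → ℕ → Fin n → (Fin n → 𝕜) → 𝕜
  /-- `ξ₀ p γ` is the component `ξ_{0,p}^γ` -/
  ξ₀ : ℤ → Fin n → (Fin n → 𝕜) → 𝕜
  θ₀ : ℤ → (Fin n → 𝕜) → 𝕜
  smooth_ξ : ∀ α p γ, ContDiffOn 𝕜 ∞ (ξ α p γ) φ.target
  smooth_ξ₀ : ∀ p γ, ContDiffOn 𝕜 ∞ (ξ₀ p γ) φ.target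
  smooth_θ₀ : ∀ p, ContDiffOn 𝕜 ∞ (θ₀ p) φ.target
  /-- `E = ∑_α [(1 - d/2 - μ_α) v^α + r^α] ∂_α`, with `r^α = r_1^α` -/
  euler : ∀ v ∈ φ.target, ∀ α, F.EComp φ α v = (1 - F.d / 2 - μ α) * v α + r 1 α
  /-- `(R_s)^α_β = 0` if `μ_α - μ_β ≠ s` -/
  R_grading : ∀ s : ℕ, 1 ≤ s → ∀ α β, μ α - μ β ≠ s → R s α β = 0
  /-- `R_sᵀ η = (-1)^{s+1} η R_s` -/
  R_symm : ∀ s : ℕ, 1 ≤ s → ∀ v ∈ φ.target,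
    (R s).transpose * Matrix.of (fun α β => F.eta φ α β v)
      = (-1 : 𝕜) ^ (s + 1) • (Matrix.of (fun α β => F.eta φ α β v) * R s)
  /-- `ξ_{α,0} = ∂_α` -/
  ξ_zero : ∀ v ∈ φ.target, ∀ α γ, ξ α 0 γ v = if γ = α then 1 else 0
  /-- `∂_α ξ_{β,p+1}^γ = c^γ_{ασ} ξ_{β,p}^σ` -/
  ξ_rec : ∀ v ∈ φ.target, ∀ α β γ p,
    pd α (ξ β (p + 1) γ) v = ∑ σ, F.cUp φ γ α σ v * ξ β p σ v
  /-- `∂_E ξ_{α,p} = (p + μ_α - μ) ξ_{α,p} + ∑_{s=1}^p (R_s)^γ_α ξ_{γ,p-s}` -/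
  ξ_euler : ∀ v ∈ φ.target, ∀ α p γ,
    F.dE φ (ξ α p γ) v = (p + μ α - μ γ) * ξ α p γ v
      + ∑ s ∈ Finset.Icc 1 p, ∑ ε, R s ε α * ξ ε (p - s) γ v
  /-- `⟨ξ_α(v; -z), ξ_β(v; z)⟩ = η_{αβ}` -/
  ξ_ortho : ∀ v ∈ φ.target, ∀ α β N,
    ∑ k ∈ Finset.range (N + 1), ∑ γ, ∑ δ,
        (-1 : 𝕜) ^ k * F.eta φ γ δ v * ξ α k γ v * ξ β (N - k) δ v
      = if N = 0 then F.eta φ α β v else 0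
  /-- `r_p^α ≠ 0` only if `μ_α + d/2 = p` -/
  r_grading : ∀ p : ℕ, 1 ≤ p → ∀ α, μ α + F.d / 2 ≠ p → r p α = 0
  /-- `ξ_{0,0} = e` -/
  ξ₀_zero : ∀ v ∈ φ.target, ∀ γ, ξ₀ 0 γ v = F.eComp φ γ v
  /-- `ξ_{0,1} = v^α ∂_α` -/
  ξ₀_one : ∀ v ∈ φ.target, ∀ γ, ξ₀ 1 γ v = v γ
  /-- `∂_α ξ_{0,p}^γ = c^γ_{αβ} ξ_{0,p-1}^β` for `p ≥ 1` -/
  ξ₀_rec : ∀ v ∈ φ.target, ∀ p : ℤ, 1 ≤ p → ∀ α γ,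
    pd α (ξ₀ p γ) v = ∑ β, F.cUp φ γ α β v * ξ₀ (p - 1) β v
  /-- `∂_E ξ_{0,p} = (p - d/2 - μ) ξ_{0,p} + ∑_{s=1}^p r_s^λ ξ_{λ,p-s}` for `p ≥ 0` -/
  ξ₀_euler : ∀ v ∈ φ.target, ∀ (p : ℕ) γ,
    F.dE φ (ξ₀ p γ) v = (p - F.d / 2 - μ γ) * ξ₀ p γ v
      + ∑ s ∈ Finset.Icc 1 p, ∑ ε, r s ε * ξ ε (p - s) γ v
  /-- `ξ_{0,-p} = ∂_e ξ_{0,-p+1}` for `p ≥ 1` -/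
  ξ₀_neg : ∀ v ∈ φ.target, ∀ p : ℤ, 1 ≤ p → ∀ γ, ξ₀ (-p) γ v = F.de φ (ξ₀ (-p + 1) γ) v
  /-- `∇θ_{0,p} = ξ_{0,p}` -/
  θ₀_grad : ∀ v ∈ φ.target, ∀ p α, pd α (θ₀ p) v = ∑ γ, F.eta φ α γ v * ξ₀ p γ v
  /-- `∂_E θ_{0,p} = (p - d + 1) θ_{0,p} + ∑_{s=1}^p r_s^ε θ_{ε,p-s} + c_p`, where
  `θ_{ε,l} = ∑_{k=0}^l (-1)^k ⟨ξ_{0,k+1}, ξ_{ε,l-k}⟩` -/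
  θ₀_euler : ∀ v ∈ φ.target, ∀ p : ℤ,
    F.dE φ (θ₀ p) v = (p - F.d + 1) * θ₀ p v
      + ∑ s ∈ Finset.Icc 1 p.toNat, ∑ ε, r s ε *
          (∑ k ∈ Finset.range (p.toNat - s + 1), ∑ γ, ∑ δ, (-1 : 𝕜) ^ k * F.eta φ γ δ v
            * ξ₀ (k + 1) γ v * ξ ε (p.toNat - s - k) δ v)
      + c p
  /-- `c_p` is possibly non-zero only if `p = d - 1` and `p` is even -/
  c_grading : ∀ p : ℤ, c p ≠ 0 → (p : 𝕜) = F.d - 1 ∧ Even p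

/-! ## The `(n+2)`-dimensional monodromy data -/

/-- The constants from which the Virasoro operators are built. -/
structure SpectralData (n : ℕ) where
  d : ℂ
  η : Matrix (Fin n) (Fin n) ℂ
  μ : Fin n → ℂ
  R : ℕ → Matrix (Fin n) (Fin n) ℂ
  r : ℕ → Fin n → ℂ
  c : ℤ → ℂ

/-- The constants `d, η, μ, R, r_s, c_p` of a calibrated generalized Frobenius manifold, as complex
numbers. -/
def Calibration.data {𝕜 : Type*} [RCLike 𝕜] {n : ℕ} {M : Type*} [TopologicalSpace M]
    [ChartedSpace (Fin n → 𝕜) M] [IsManifold 𝓘(𝕜, Fin n → 𝕜) ∞ M]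
    {F : GeneralizedFrobenius 𝕜 n M} (K : Calibration F) : SpectralData n where
  d := RCLike.map 𝕜 ℂ F.d
  η := Matrix.of fun α β => RCLike.map 𝕜 ℂ (F.eta K.φ α β (K.φ K.v₀))
  μ := fun α => RCLike.map 𝕜 ℂ (K.μ α)
  R := fun s => (K.R s).map (RCLike.map 𝕜 ℂ)
  r := fun s α => RCLike.map 𝕜 ℂ (K.r s α)
  c := fun p => RCLike.map 𝕜 ℂ (K.c p)

/-- The index set `{0, 1, …, n, n+1}`. -/
abbrev ExtIdx (n : ℕ) := Unit ⊕ (Fin n ⊕ Unit)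

/-- The index `0`. -/
abbrev ExtIdx.zero {n : ℕ} : ExtIdx n := Sum.inl ()

/-- The indices `1, …, n`. -/
abbrev ExtIdx.mid {n : ℕ} (α : Fin n) : ExtIdx n := Sum.inr (Sum.inl α)

/-- The index `n+1`. -/
abbrev ExtIdx.last {n : ℕ} : ExtIdx n := Sum.inr (Sum.inr ())

/-- The ring of formal sums of terms `λ^x (log λ)^k`, `x ∈ ℂ`, `k ∈ ℕ`: the monomial with exponent
`x` has as its coefficient a polynomial in `log λ`. -/
abbrev LogPow := AddMonoidAlgebra (Polynomial ℂ) ℂ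

namespace LogPow

/-- The monomial `λ^x`. -/
def pow (x : ℂ) : LogPow := AddMonoidAlgebra.single x 1

/-- `log λ`. -/
def log : LogPow := AddMonoidAlgebra.single 0 Polynomial.X

/-- The derivation `∂/∂λ`: `λ^x P(log λ) ↦ λ^(x-1) (x P + P')(log λ)`. -/
def deriv (f : LogPow) : LogPow :=
  f.coeff.sum fun x P =>
    AddMonoidAlgebra.single (x - 1) (Polynomial.C x * P + Polynomial.derivative P)

/-- The coefficient of `λ^x` (without logarithms). -/
def coeffAt (f : LogPow) (x : ℂ) : ℂ := (f.coeff x).coeff 0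

end LogPow

namespace SpectralData

variable {n : ℕ} (D : SpectralData n)

/-- The matrix `η̃`. -/
def etaT : Matrix (ExtIdx n) (ExtIdx n) ℂ := Matrix.of fun i j => match i, j with
  | Sum.inl _, Sum.inr (Sum.inr _) => 1
  | Sum.inr (Sum.inr _), Sum.inl _ => 1
  | Sum.inr (Sum.inl α), Sum.inr (Sum.inl β) => D.η α β
  | _, _ => 0

/-- The diagonal entries `μ_0 = -d/2, μ_1, …, μ_n, μ_{n+1} = d/2` of `μ̃`. -/
def muT : ExtIdx n → ℂ
  | Sum.inl _ => -D.d / 2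
  | Sum.inr (Sum.inl α) => D.μ α
  | Sum.inr (Sum.inr _) => D.d / 2

/-- `R̃_s` for `s ≥ 1`, with columns `(0, 𝐫_s, c_{s-1})`, `(0, R_s, 𝐫_s†)`, `0`, where
`r_{s,α} = (-1)^{s+1} r_s^β η_{αβ}`. -/
def RTs (s : ℕ) : Matrix (ExtIdx n) (ExtIdx n) ℂ := Matrix.of fun i j => match i, j with
  | Sum.inr (Sum.inl α), Sum.inl _ => D.r s α
  | Sum.inr (Sum.inl α), Sum.inr (Sum.inl β) => D.R s α β
  | Sum.inr (Sum.inr _), Sum.inl _ => D.c ((s : ℤ) - 1)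
  | Sum.inr (Sum.inr _), Sum.inr (Sum.inl α) => (-1) ^ (s + 1) * ∑ β, D.r s β * D.η α β
  | _, _ => 0

/-- `R̃ = R̃_1 + R̃_2 + ⋯` (in each entry at most one summand is non-zero). -/
def RT : Matrix (ExtIdx n) (ExtIdx n) ℂ := Matrix.of fun i j => ∑ᶠ s : ℕ, D.RTs (s + 1) i j

/-- The component `[P]_s = ∑_{λ ∈ Spec μ̃} π_{λ+s} P π_λ` of a matrix; `μ̃` is diagonal. -/
def gr (s : ℕ) (P : Matrix (ExtIdx n) (ExtIdx n) ℂ) : Matrix (ExtIdx n) (ExtIdx n) ℂ :=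
  Matrix.of fun i j => if D.muT i = D.muT j + s then P i j else 0

/-- `λ^{-R̃} = exp(- log λ · R̃)` for the nilpotent matrix `R̃`. -/
def powNegR : Matrix (ExtIdx n) (ExtIdx n) LogPow :=
  IsNilpotent.exp (-(LogPow.log • D.RT.map (algebraMap ℂ LogPow)))

/-- The formal Laplace integral `∫_0^∞ e^{-λz} z^{p+μ̃+ν-1/2} z^{R̃} dz`, that is
`∑_{s ≥ 0} [e^{R̃ ∂_ν}]_s Γ(p+μ̃+ν+s+1/2) λ^{-(p+μ̃+ν+s+1/2)} λ^{-R̃}`, where `∂_ν` acts on the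
Gamma function only, and `e^{R̃ ∂_ν} = ∑_k R̃^k ∂_ν^k / k!` is a finite sum as `R̃` is nilpotent. -/
def laplace (ν : ℂ) (p : ℤ) : Matrix (ExtIdx n) (ExtIdx n) LogPow :=
  (Matrix.of fun i j => ∑ᶠ s : ℕ, ∑ k ∈ Finset.range (nilpotencyClass D.RT),
      ((k.factorial : ℂ)⁻¹ * D.gr s (D.RT ^ k) i j
        * iteratedDeriv k Complex.Gamma (p + D.muT j + ν + s + 1 / 2))
      • LogPow.pow (-(p + D.muT j + ν + s + 1 / 2)))
    * D.powNegR

/-- The matrix whose rows give `φ̃^{(ν)}(𝐚; λ) = ∑_p 𝐚_pᵀ · phi ν p`. -/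
def phi (ν : ℂ) (p : ℤ) : Matrix (ExtIdx n) (ExtIdx n) LogPow :=
  D.etaT.map (algebraMap ℂ LogPow) * D.laplace ν p

/-- The matrix `G̃(ν) = -(1/2π) (e^{πi R̃} e^{πi(μ̃+ν)} + e^{-πi R̃} e^{-πi(μ̃+ν)}) η̃⁻¹`. -/
def gram (ν : ℂ) : Matrix (ExtIdx n) (ExtIdx n) ℂ :=
  (-(1 / (2 * Real.pi)) : ℂ) •
    ((IsNilpotent.exp ((Real.pi * Complex.I : ℂ) • D.RT)
        * Matrix.diagonal (fun i => Complex.exp (Real.pi * Complex.I * (D.muT i + ν)))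
      + IsNilpotent.exp (-(Real.pi * Complex.I : ℂ) • D.RT)
        * Matrix.diagonal (fun i => Complex.exp (-(Real.pi * Complex.I * (D.muT i + ν)))))
      * D.etaT⁻¹)

/-- The matrices `B_{p,q}(ν)` with
`-(1/2) ∂_λ φ̃_i^{(ν)} G̃^{ij}(ν) ∂_λ φ̃_j^{(-ν)} = ∑_{p,q} 𝐚_pᵀ B_{p,q}(ν) 𝐚_q`. -/
def bilin (ν : ℂ) (p q : ℤ) : Matrix (ExtIdx n) (ExtIdx n) LogPow :=
  algebraMap ℂ LogPow (-(1 / 2)) •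
    ((D.phi ν p).map LogPow.deriv * (D.gram ν).map (algebraMap ℂ LogPow)
      * ((D.phi (-ν) q).map LogPow.deriv).transpose)

/-- The coefficient of `a^i_p a^j_q λ^{-(m+2)}` in
`-(1/2) ∂_λ φ̃_i^{(ν)} G̃^{ij}(ν) ∂_λ φ̃_j^{(-ν)}`, before the limit `ν → 0`. -/
def regCoeff (ν : ℂ) (m p q : ℤ) (i j : ExtIdx n) : ℂ :=
  LogPow.coeffAt (D.bilin ν p q i j) (-(m + 2))

/-- The limit as `ν → 0` of the coefficient of `a^i_p a^j_q λ^{-(m+2)}`; the negative part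
consists of the terms with `m ≥ -1`. -/
def limCoeff (m p q : ℤ) (i j : ExtIdx n) : ℂ :=
  Filter.limUnder (𝓝[≠] (0 : ℂ)) fun ν => D.regCoeff ν m p q i j

open Classical in
/-- `C_{m;p,q}`, the coefficient of `λ^{-(m+2)}` in `C_{p,q}(λ)`. It is zero unless the charge is a
negative odd integer, `m ≥ 0` and `p + q + m = d - 1`, and then
`C_{m;p,q} = (-1)^p c_{d-1}/2 ∑_{k=0}^m (-1)^k (p-d/2+1/2)^{[k]} (q-d/2+1/2)^{[m-k]}`. -/
def extraCoeff (m p q : ℤ) : ℂ :=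
  if (∃ N : ℤ, D.d = N ∧ N < 0 ∧ Odd N ∧ p + q + m = N - 1) ∧ 0 ≤ m then
    (-1) ^ p * D.c (p + q + m) / 2 *
      ∑ k ∈ Finset.range (m.toNat + 1), (-1) ^ k
        * (ascPochhammer ℂ k).eval (p - D.d / 2 + 1 / 2)
        * (ascPochhammer ℂ (m.toNat - k)).eval (q - D.d / 2 + 1 / 2)
  else 0

end SpectralData

/-! ## The Virasoro operators -/

/-- The index set `ℐ = ({1,…,n} × ℤ_{≥0}) ∪ ({0} × ℤ)` of the times: `inl (α, p)` stands for
`t^{α,p}` and `inr p` for `t^{0,p}`. -/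
abbrev TimeIdx (n : ℕ) := (Fin n × ℕ) ⊕ ℤ

/-- Formal power series in the times, on which the operators act. -/
abbrev TimeSeries (n : ℕ) := MvPowerSeries (TimeIdx n) ℂ

/-- Multiplication by a time variable. -/
def mulTime {n : ℕ} (x : TimeIdx n) : Module.End ℂ (TimeSeries n) :=
  LinearMap.mulLeft ℂ (MvPowerSeries.X x)

/-- The derivative with respect to a time variable. -/
def derTime {n : ℕ} (x : TimeIdx n) : Module.End ℂ (TimeSeries n) :=
  (MvPowerSeries.pderiv ℂ x).toLinearMap

namespace SpectralData

variable {n : ℕ} (D : SpectralData n)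

/-- The realization of the generators `a^i_p` of the Heisenberg algebra. -/
def heis : ExtIdx n → ℤ → Module.End ℂ (TimeSeries n)
  | Sum.inl _, p => ((-1 : ℂ) ^ (p + 1)) • mulTime (Sum.inr (-p - 1))
  | Sum.inr (Sum.inl α), p =>
      if 0 ≤ p then ∑ β, D.η⁻¹ α β • derTime (Sum.inl (β, p.toNat))
      else ((-1 : ℂ) ^ (p + 1)) • mulTime (Sum.inl (α, (-p - 1).toNat))
  | Sum.inr (Sum.inr _), p => derTime (Sum.inr p)

/-- Whether `a^i_p` is realized by a differentiation. -/
def isDer : ExtIdx n → ℤ → Prop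
  | Sum.inl _, _ => False
  | Sum.inr (Sum.inl _), p => 0 ≤ p
  | Sum.inr (Sum.inr _), _ => True

open Classical in
/-- The normally ordered product `: a^i_p a^j_q :`, with differentiations on the right. -/
def normalOrd (p q : ℤ) (i j : ExtIdx n) : Module.End ℂ (TimeSeries n) :=
  if isDer i p ∧ ¬ isDer j q then D.heis j q * D.heis i p else D.heis i p * D.heis j q

/-- The terms, in the coefficient of the monomial `e` of `L_m f`, of the normally ordered quadratic
part; they are indexed by `(p, q, i, j)`. -/
def quadTerm (m : ℤ) (f : TimeSeries n) (e : TimeIdx n →₀ ℕ)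
    (x : ℤ × ℤ × ExtIdx n × ExtIdx n) : ℂ :=
  D.limCoeff m x.1 x.2.1 x.2.2.1 x.2.2.2 *
    MvPowerSeries.coeff e (D.normalOrd x.1 x.2.1 x.2.2.1 x.2.2.2 f)

/-- The terms, in the coefficient of the monomial `e` of `L_m f`, of
`∑_{p,q ∈ ℤ} C_{m;p,q} t^{0,p} t^{0,q}`. -/
def extraTerm (m : ℤ) (f : TimeSeries n) (e : TimeIdx n →₀ ℕ) (x : ℤ × ℤ) : ℂ :=
  D.extraCoeff m x.1 x.2 *
    MvPowerSeries.coeff e (mulTime (Sum.inr x.1) (mulTime (Sum.inr x.2) f))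

/-- The action of the Virasoro operator `L_m` (`m ≥ -1`), the coefficient of `λ^{-(m+2)}` in
`-(1/2) lim_{ν → 0} : [∂_λ φ̃_i^{(ν)} G̃^{ij}(ν) ∂_λ φ̃_j^{(-ν)}]_- :
  + ∑_{p,q} C_{p,q}(λ) t^{0,p} t^{0,q} + (1/(4λ²)) tr(1/4 - μ²)`,
on a formal power series in the times. Here `μ` is the `n × n` matrix. -/
def virasoro (m : ℤ) (f : TimeSeries n) : TimeSeries n := fun e =>
  (∑ᶠ x, D.quadTerm m f e x) + (∑ᶠ x, D.extraTerm m f e x)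
    + (if m = 0 then 1 / 4 * ∑ α, (1 / 4 - D.μ α ^ 2) else 0) * MvPowerSeries.coeff e f

end SpectralData

end GFM

end

noncomputable section

/-! ### Algebraic relations among the constants of a calibrated manifold. -/

namespace GFM

/-! The geometry enters only through seven algebraic facts about the constants
(`Calibration.isMonodromy`); the rest is algebra.

Existence of the limits. An entry of R̃^k joins two eigenvalues of μ̃ whose difference is the degree
of that entry. Hence row i of the Laplace integral is λ^{-x} Γ(x + R̃) λ^{-R̃} with x = p + μ_i + ν
+ 1/2 (`laplace_apply`), and ∂/∂λ only shifts p, up to sign (`deriv_phi`). Since e^{±πi} = -1, the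
symmetry of R̃ gives R̃ G̃ = -G̃ R̃ᵀ (`RT_mul_gram`). This cancels all logarithms and lets every
function of R̃ᵀ be moved to the left of G̃. Column l of G̃ is that of -(1/π) cos π(ν - μ_l + R̃)
η̃⁻¹ (`gram_apply`), so the reflection formula turns the product gamma · cosine · gamma into a
rising factorial (`gammaMat_mul_gram_mul`). The coefficients are therefore polynomial in ν near 0,
away from 0 itself. Their limits are (1/2)(-1)^{q+1} (η̃ (μ_j - q - 1/2 + R̃)^{[m+1]})_{ij},
supported on p + q + 1 - μ_i - μ_j = m.

The terms C_{m;p,q} restore the corner entry c_{d-1} that R̃ cannot contain when d is negative.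
Their sum is the derivative of a rising factorial, so the full kernel has the same form with R̃
replaced by `RX` (`ker_eq`).

Finiteness. The grading makes rows and columns of the kernel finite, and no pair of differentiations
involves ∂/∂t^{0,p} (`ker_last`), so only finitely many pairs of differentiations occur.

Commutators. The generators satisfy Heisenberg relations (`gen_lie`), and [L_m, a_v] = -a_{W_m v}
with W_m = Y^{m+1} V (`sum_ker_mul_omega`, `quadOp_lie`). Here V is the shift by -1 and Y is the
Euler operator composed with the shift by 1. As VY - YV = 1, the W_m satisfy Witt relations
(`wittOp_lie`). Thus [L_m, L_k] - (m-k) L_{m+k} commutes with all multiplications and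
differentiations; being continuous, it is a scalar (`eq_smul_one_of_commute`). The scalar is the
constant coefficient of the image of 1. It vanishes by degree if m + k ≠ 0 and by antisymmetry if m
= k = 0; for {m, k} = {1, -1} the trace in L_0 cancels it (`coeff_quadOp_one_neg_one`). -/

/-- The embedding of `𝕜` into the complex numbers. -/
def toComplexHom (𝕜 : Type*) [RCLike 𝕜] : 𝕜 →+* ℂ where
  toFun := RCLike.map 𝕜 ℂ
  map_one' := by simp
  map_zero' := by simp
  map_add' := fun x y => map_add _ x y
  map_mul' := fun x y => by
    apply Complex.ext <;> simp [RCLike.mul_re, RCLike.mul_im]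

/-- The algebraic properties of the constants of a calibrated generalized Frobenius manifold. -/
structure SpectralData.IsMonodromy {n : ℕ} (D : SpectralData n) : Prop where
  eta_symm : ∀ α β, D.η α β = D.η β α
  eta_det : IsUnit D.η.det
  eta_mu : ∀ α β, D.η α β ≠ 0 → D.μ α + D.μ β = 0
  R_grading : ∀ s : ℕ, 1 ≤ s → ∀ α β, D.μ α - D.μ β ≠ s → D.R s α β = 0
  R_symm : ∀ s : ℕ, 1 ≤ s → (D.R s).transpose * D.η = (-1 : ℂ) ^ (s + 1) • (D.η * D.R s)
  r_grading : ∀ s : ℕ, 1 ≤ s → ∀ α, D.μ α + D.d / 2 ≠ s → D.r s α = 0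
  c_grading : ∀ p : ℤ, D.c p ≠ 0 → (p : ℂ) = D.d - 1 ∧ Even p

section

variable {𝕜 : Type*} [RCLike 𝕜] {n : ℕ} {M : Type*} [TopologicalSpace M]
    [ChartedSpace (Fin n → 𝕜) M]

theorem PreFrobenius.IsFlatChart.mdifferentiable {F : PreFrobenius 𝕜 n M}
    {φ : OpenPartialHomeomorph M (Fin n → 𝕜)} (h : F.IsFlatChart φ) :
    φ.MDifferentiable 𝓘(𝕜, Fin n → 𝕜) 𝓘(𝕜, Fin n → 𝕜) :=
  ⟨(contMDiffOn_of_mem_maximalAtlas h.1).mdifferentiableOn (by simp),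
    (contMDiffOn_symm_of_mem_maximalAtlas h.1).mdifferentiableOn (by simp)⟩

variable [IsManifold 𝓘(𝕜, Fin n → 𝕜) ∞ M]

/-- The metric in the frame of a flat chart is nondegenerate. -/
theorem GeneralizedFrobenius.eta_nondegenerate (F : GeneralizedFrobenius 𝕜 n M)
    {φ : OpenPartialHomeomorph M (Fin n → 𝕜)} (h : F.IsFlatChart φ) {v : Fin n → 𝕜}
    (hv : v ∈ φ.target) :
    IsUnit (Matrix.of fun α β => F.eta φ α β v).det := by
  rw [isUnit_iff_ne_zero]
  intro hdet
  obtain ⟨a, ha, ha0⟩ := Matrix.exists_mulVec_eq_zero_iff.2 hdet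
  set T := mfderiv 𝓘(𝕜, Fin n → 𝕜) 𝓘(𝕜, Fin n → 𝕜) φ.symm v with hT
  have hbij : Function.Bijective T := h.mdifferentiable.symm.mfderiv_bijective (x := v) hv
  have hlin : ∀ b : Fin n → 𝕜, T b = ∑ α, b α • frame φ α v := by
    intro b
    have hb : b = ∑ α, b α • (Pi.single α 1 : Fin n → 𝕜) := by
      ext i; simp [Finset.sum_apply, Pi.single_apply]
    conv_lhs => rw [hb]
    exact (map_sum T _ _).trans (Finset.sum_congr rfl fun α _ => T.map_smul _ _)
  apply ha
  -- A kernel vector `a` of the Gram matrix gives the tangent vector `T a`, orthogonal to everything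
  -- because `T` is onto; injectivity of `T` then kills `a`.
  have : T a = 0 := by
    apply F.metric_nondeg (φ.symm v)
    intro w
    obtain ⟨b, rfl⟩ := hbij.2 w
    rw [hlin b, hlin a]
    simp only [map_sum, LinearMap.sum_apply, map_smul, LinearMap.smul_apply]
    refine Finset.sum_eq_zero fun β _ => ?_
    have := congrFun ha0 β
    simp only [Matrix.mulVec, dotProduct, Matrix.of_apply, Pi.zero_apply] at this
    rw [← smul_zero (b β), ← this, Finset.smul_sum, Finset.smul_sum]
    refine Finset.sum_congr rfl fun α _ => ?_
    rw [F.metric_symm]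
    simp only [smul_eq_mul, PreFrobenius.eta]
    ring
  exact hbij.1 (this.trans (map_zero T).symm)

theorem Calibration.pd_EComp {F : GeneralizedFrobenius 𝕜 n M} (K : Calibration F)
    {v : Fin n → 𝕜} (hv : v ∈ K.φ.target) (α ε : Fin n) :
    pd α (F.EComp K.φ ε) v = if α = ε then 1 - F.d / 2 - K.μ α else 0 := by
  have h1 : F.EComp K.φ ε =ᶠ[𝓝 v] fun v => (1 - F.d / 2 - K.μ ε) * v ε + K.r 1 ε := by
    filter_upwards [K.φ.open_target.mem_nhds hv] with w hw using K.euler w hw ε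
  rw [pd, h1.fderiv_eq]
  have h2 : HasFDerivAt (fun v : Fin n → 𝕜 => (1 - F.d / 2 - K.μ ε) * v ε + K.r 1 ε)
      ((1 - F.d / 2 - K.μ ε) •
        ContinuousLinearMap.proj (R := 𝕜) (φ := fun _ : Fin n => 𝕜) ε) v := by
    refine HasFDerivAt.add_const _ ?_
    exact (ContinuousLinearMap.proj (R := 𝕜) (φ := fun _ : Fin n => 𝕜) ε).hasFDerivAt.const_mul _
  rw [h2.fderiv]
  by_cases h : α = ε
  · subst h; simp
  · simp [h, Ne.symm h]

/-- This is the only passage from the manifold to the constants; everything about the operators is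
deduced from these relations. -/
theorem Calibration.isMonodromy {F : GeneralizedFrobenius 𝕜 n M} (K : Calibration F) :
    K.data.IsMonodromy := by
  have hv : K.φ K.v₀ ∈ K.φ.target := K.φ.map_source K.mem_source
  refine ⟨?_, ?_, ?_, ?_, ?_, ?_, ?_⟩
  · intro α β
    simp only [data, Matrix.of_apply]
    congr 1
    exact F.metric_symm _ _ _
  · have h := F.eta_nondegenerate K.flat hv
    have : K.data.η = (toComplexHom 𝕜).mapMatrix
        (Matrix.of fun α β => F.eta K.φ α β (K.φ K.v₀)) := rfl
    rw [this, ← RingHom.map_det]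
    exact h.map _
  · intro α β h
    have h0 : F.eta K.φ α β (K.φ K.v₀) ≠ 0 := by
      intro h0
      apply h
      simp [data, h0]
    -- As ∇E is diagonal with entries 1 - d/2 - μ_α, the Lie derivative of the metric reads (2 - d -
    -- μ_α - μ_β) η_{αβ} = (2 - d) η_{αβ}.
    have h1 := F.lie_metric K.φ K.flat _ hv α β
    simp only [K.pd_EComp hv, ite_mul, zero_mul, Finset.sum_ite_eq, Finset.mem_univ,
      if_true] at h1
    have h2 : (K.μ α + K.μ β) * F.eta K.φ α β (K.φ K.v₀) = 0 := by linear_combination -h1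
    have h3 := (mul_eq_zero.1 h2).resolve_right h0
    simp only [data]
    rw [← map_add, h3, map_zero]
  · intro s hs α β h
    have : K.R s α β = 0 := by
      apply K.R_grading s hs
      intro h1
      apply h
      have := congrArg (toComplexHom 𝕜) h1
      rwa [map_sub, map_natCast] at this
    simp [data, this]
  · intro s hs
    have h := congrArg (toComplexHom 𝕜).mapMatrix (K.R_symm s hs _ hv)
    rw [map_mul] at h
    have h1 : (toComplexHom 𝕜).mapMatrix ((-1 : 𝕜) ^ (s + 1) •
        ((Matrix.of fun α β => F.eta K.φ α β (K.φ K.v₀)) * K.R s))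
        = (-1 : ℂ) ^ (s + 1) • (toComplexHom 𝕜).mapMatrix
        ((Matrix.of fun α β => F.eta K.φ α β (K.φ K.v₀)) * K.R s) := by
      ext i j
      simp only [RingHom.mapMatrix_apply, Matrix.map_apply, Matrix.smul_apply, smul_eq_mul,
        map_mul, map_pow, map_neg, map_one]
      rw [← Matrix.map_mul]
      rfl
    rw [h1, map_mul] at h
    exact h
  · intro s hs α h
    have : K.r s α = 0 := by
      apply K.r_grading s hs
      intro h1
      apply h
      have := congrArg (toComplexHom 𝕜) h1
      rwa [map_add, map_natCast, map_div₀, map_ofNat] at this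
    simp [data, this]
  · intro p h
    have h0 : K.c p ≠ 0 := by
      intro h0
      apply h
      simp [data, h0]
    obtain ⟨h1, h2⟩ := K.c_grading p h0
    refine ⟨?_, h2⟩
    have := congrArg (toComplexHom 𝕜) h1
    rwa [map_sub, map_intCast, map_one] at this

end

/-! ### Grading, symmetry and nilpotency of the extended matrices η̃, μ̃, R̃. -/

namespace SpectralData

variable {n : ℕ} (D : SpectralData n)

/-- The block matrix that is inverse to `η̃`. -/
def etaInv : Matrix (ExtIdx n) (ExtIdx n) ℂ := Matrix.of fun i j => match i, j with
  | Sum.inl _, Sum.inr (Sum.inr _) => 1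
  | Sum.inr (Sum.inr _), Sum.inl _ => 1
  | Sum.inr (Sum.inl α), Sum.inr (Sum.inl β) => D.η⁻¹ α β
  | _, _ => 0

namespace IsMonodromy

variable {D} (h : D.IsMonodromy)
include h

theorem etaT_transpose : D.etaT.transpose = D.etaT := by
  ext i j
  rcases i with _ | _ | _ <;> rcases j with _ | _ | _ <;> simp [etaT, h.eta_symm]

theorem etaT_mul_etaInv : D.etaT * D.etaInv = 1 := by
  have h1 := Matrix.mul_nonsing_inv D.η h.eta_det
  ext i j
  rcases i with _ | α | _ <;> rcases j with _ | β | _ <;>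
    simp [etaT, etaInv, Matrix.mul_apply, Fintype.sum_sum_type, Matrix.one_apply]
  have := congrFun (congrFun h1 α) β
  simpa [Matrix.mul_apply, Matrix.one_apply] using this

theorem etaT_inv : D.etaT⁻¹ = D.etaInv := Matrix.inv_eq_right_inv h.etaT_mul_etaInv

theorem etaT_mul_inv : D.etaT * D.etaT⁻¹ = 1 := by rw [h.etaT_inv, h.etaT_mul_etaInv]

theorem inv_mul_etaT : D.etaT⁻¹ * D.etaT = 1 := mul_eq_one_comm.1 h.etaT_mul_inv

theorem etaT_inv_transpose : D.etaT⁻¹.transpose = D.etaT⁻¹ := by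
  rw [Matrix.transpose_nonsing_inv, h.etaT_transpose]

theorem etaT_mu {i j : ExtIdx n} (hij : D.etaT i j ≠ 0) : D.muT i = -D.muT j := by
  rcases i with _ | α | _ <;> rcases j with _ | β | _ <;> simp [etaT] at hij <;> simp [muT]
  · ring
  · exact eq_neg_of_add_eq_zero_left (h.eta_mu α β hij)
  · ring

/-- Pairing opposite eigenvalues means anticommuting with the diagonal matrix μ̃, a property that
passes from η̃ to its inverse. -/
theorem etaT_inv_mu {i j : ExtIdx n} (hij : D.etaT⁻¹ i j ≠ 0) : D.muT i = -D.muT j := by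
  have h1 : D.etaT * Matrix.diagonal D.muT = -(Matrix.diagonal D.muT * D.etaT) := by
    ext i j
    by_cases h0 : D.etaT i j = 0
    · simp [h0]
    · simp [h.etaT_mu h0]; ring
  have h2 : Matrix.diagonal D.muT * D.etaT⁻¹ = -(D.etaT⁻¹ * Matrix.diagonal D.muT) := by
    calc Matrix.diagonal D.muT * D.etaT⁻¹
        = D.etaT⁻¹ * (D.etaT * Matrix.diagonal D.muT) * D.etaT⁻¹ := by
          rw [← Matrix.mul_assoc, h.inv_mul_etaT, Matrix.one_mul]
      _ = _ := by
          rw [h1, Matrix.mul_neg, Matrix.neg_mul, Matrix.mul_assoc, Matrix.mul_assoc,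
            h.etaT_mul_inv, Matrix.mul_one]
  have h3 := congrFun (congrFun h2 i) j
  simp only [Matrix.diagonal_mul, Matrix.neg_apply, Matrix.mul_diagonal] at h3
  apply mul_right_cancel₀ hij
  rw [h3]; ring

/-- The corner has degree d, and c_{s-1} ≠ 0 forces s = d; in the row of 𝐫_s† the degree condition
on r_s is transported by η, which pairs μ with -μ. -/
theorem RTs_grading {s : ℕ} (hs : 1 ≤ s) {i j : ExtIdx n} (hij : D.RTs s i j ≠ 0) :
    D.muT i = D.muT j + s := by
  rcases i with _ | α | _ <;> rcases j with _ | β | _ <;> simp [RTs] at hij <;> simp [muT]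
  · have := not_imp_comm.1 (h.r_grading s hs α) hij
    linear_combination this
  · have := not_imp_comm.1 (h.R_grading s hs α β) hij
    linear_combination this
  · have := (h.c_grading _ hij).1
    push_cast at this
    linear_combination -this
  · obtain ⟨γ, -, hγ⟩ := Finset.exists_ne_zero_of_sum_ne_zero hij
    have h1 := not_imp_comm.1 (h.r_grading s hs γ) (left_ne_zero_of_mul hγ)
    have h2 := h.eta_mu _ _ (right_ne_zero_of_mul hγ)
    linear_combination h1 - h2

/-- The parity of c is needed here: the corner is compatible only with the sign +1, and c_{s-1} ≠ 0
makes s odd. -/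
theorem RTs_symm {s : ℕ} (hs : 1 ≤ s) :
    (D.RTs s).transpose * D.etaT = (-1 : ℂ) ^ (s + 1) • (D.etaT * D.RTs s) := by
  have h1 : ((-1 : ℂ) ^ (s + 1)) * (-1 : ℂ) ^ (s + 1) = 1 := by
    rw [← mul_pow]; simp
  ext i j
  rcases i with _ | α | _ <;> rcases j with _ | β | _ <;>
    simp [RTs, etaT, Matrix.mul_apply, Fintype.sum_sum_type]
  · by_cases hc : D.c (s - 1) = 0
    · simp [hc]
    · have := (h.c_grading _ hc).2
      have h2 : Even (s + 1) := by
        rw [Int.even_sub_one, Int.not_even_iff_odd, Int.odd_coe_nat] at this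
        exact this.add_one
      simp [h2.neg_one_pow]
  · rw [← mul_assoc, h1, one_mul]
    exact Finset.sum_congr rfl fun γ _ => by rw [h.eta_symm]
  · congr 1
    funext γ
    rw [mul_comm]
  · have := congrFun (congrFun (h.R_symm s hs) α) β
    simpa [Matrix.mul_apply] using this

theorem RT_of_grade {s : ℕ} (hs : 1 ≤ s) {i j : ExtIdx n} (hij : D.muT i = D.muT j + s) :
    D.RT i j = D.RTs s i j := by
  rw [RT, Matrix.of_apply, finsum_eq_single _ (s - 1), Nat.sub_add_cancel hs]
  intro t ht
  by_contra h0
  have := h.RTs_grading (Nat.succ_le_succ (Nat.zero_le t)) h0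
  rw [hij, add_right_inj, Nat.cast_inj] at this
  omega

theorem RT_grading {i j : ExtIdx n} (hij : D.RT i j ≠ 0) :
    ∃ s : ℕ, 1 ≤ s ∧ D.muT i = D.muT j + s := by
  rw [RT, Matrix.of_apply] at hij
  obtain ⟨t, ht⟩ : ∃ t, D.RTs (t + 1) i j ≠ 0 := by
    by_contra! hc
    simp [hc] at hij
  exact ⟨t + 1, by omega, h.RTs_grading (by omega) ht⟩

theorem RT_pow_grading (k : ℕ) {i j : ExtIdx n} (hij : (D.RT ^ k) i j ≠ 0) :
    ∃ s : ℕ, k ≤ s ∧ D.muT i = D.muT j + s := by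
  induction k generalizing i j with
  | zero =>
    refine ⟨0, le_rfl, ?_⟩
    rw [pow_zero, Matrix.one_apply] at hij
    have : i = j := by by_contra hne; simp [hne] at hij
    simp [this]
  | succ k ih =>
    rw [pow_succ, Matrix.mul_apply] at hij
    obtain ⟨l, -, hl⟩ := Finset.exists_ne_zero_of_sum_ne_zero hij
    obtain ⟨s, hs, h1⟩ := ih (left_ne_zero_of_mul hl)
    obtain ⟨t, ht, h2⟩ := h.RT_grading (right_ne_zero_of_mul hl)
    exact ⟨s + t, by omega, by rw [h1, h2]; push_cast; ring⟩

/-- The k-th power raises eigenvalues of μ̃ by at least k, whereas the natural numbers that occur as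
differences of the finitely many eigenvalues are bounded. -/
theorem isNilpotent_RT : IsNilpotent D.RT := by
  classical
  have : ∀ x : ExtIdx n × ExtIdx n, ∃ B : ℕ, ∀ s : ℕ, D.muT x.1 = D.muT x.2 + s → s < B := by
    intro x
    by_cases h0 : ∃ s : ℕ, D.muT x.1 = D.muT x.2 + s
    · obtain ⟨s, hs⟩ := h0
      refine ⟨s + 1, fun t ht => ?_⟩
      rw [hs, add_right_inj, Nat.cast_inj] at ht
      omega
    · exact ⟨0, fun s hs => (h0 ⟨s, hs⟩).elim⟩
  choose B hB using this
  refine ⟨Finset.univ.sup B, ?_⟩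
  ext i j
  by_contra h0
  obtain ⟨s, hs, h1⟩ := h.RT_pow_grading _ h0
  have h2 := hB (i, j) s h1
  have h3 := Finset.le_sup (f := B) (Finset.mem_univ (i, j))
  omega

/-- If the degree `s` of an entry of `η̃⁻¹ R̃ᵀ` is positive, the entry only involves `R̃_s`. -/
theorem inv_mul_RT_transpose_apply {s : ℕ} (hs : 1 ≤ s) {i j : ExtIdx n}
    (hij : D.muT i + D.muT j = s) :
    (D.etaT⁻¹ * D.RT.transpose) i j = (-1) ^ (s + 1) * (D.RT * D.etaT⁻¹) i j := by
  have h1 : (D.etaT⁻¹ * D.RT.transpose) i j = (D.etaT⁻¹ * (D.RTs s).transpose) i j := by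
    rw [Matrix.mul_apply, Matrix.mul_apply]
    refine Finset.sum_congr rfl fun k _ => ?_
    by_cases h0 : D.etaT⁻¹ i k = 0
    · simp [h0]
    · rw [Matrix.transpose_apply, Matrix.transpose_apply, h.RT_of_grade hs]
      linear_combination hij - h.etaT_inv_mu h0
  have h2 : (D.RT * D.etaT⁻¹) i j = (D.RTs s * D.etaT⁻¹) i j := by
    rw [Matrix.mul_apply, Matrix.mul_apply]
    refine Finset.sum_congr rfl fun k _ => ?_
    by_cases h0 : D.etaT⁻¹ k j = 0
    · simp [h0]
    · rw [h.RT_of_grade hs]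
      linear_combination hij - h.etaT_inv_mu h0
  have h3 : D.etaT⁻¹ * (D.RTs s).transpose = (-1 : ℂ) ^ (s + 1) • (D.RTs s * D.etaT⁻¹) := by
    calc D.etaT⁻¹ * (D.RTs s).transpose
        = D.etaT⁻¹ * ((D.RTs s).transpose * D.etaT) * D.etaT⁻¹ := by
          rw [Matrix.mul_assoc, Matrix.mul_assoc, h.etaT_mul_inv, Matrix.mul_one]
      _ = _ := by
          rw [h.RTs_symm hs, Matrix.mul_smul, Matrix.smul_mul, ← Matrix.mul_assoc,
            h.inv_mul_etaT, Matrix.one_mul]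
  rw [h1, h2, h3, Matrix.smul_apply, smul_eq_mul]

theorem inv_mul_RT_transpose_grading {i j : ExtIdx n}
    (hij : (D.etaT⁻¹ * D.RT.transpose) i j ≠ 0) :
    ∃ s : ℕ, 1 ≤ s ∧ D.muT i + D.muT j = s := by
  rw [Matrix.mul_apply] at hij
  obtain ⟨k, -, hk⟩ := Finset.exists_ne_zero_of_sum_ne_zero hij
  obtain ⟨s, hs, h1⟩ := h.RT_grading (right_ne_zero_of_mul hk)
  exact ⟨s, hs, by linear_combination h1 + h.etaT_inv_mu (left_ne_zero_of_mul hk)⟩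

theorem RT_mul_inv_grading {i j : ExtIdx n} (hij : (D.RT * D.etaT⁻¹) i j ≠ 0) :
    ∃ s : ℕ, 1 ≤ s ∧ D.muT i + D.muT j = s := by
  rw [Matrix.mul_apply] at hij
  obtain ⟨k, -, hk⟩ := Finset.exists_ne_zero_of_sum_ne_zero hij
  obtain ⟨s, hs, h1⟩ := h.RT_grading (left_ne_zero_of_mul hk)
  exact ⟨s, hs, by linear_combination h1 + h.etaT_inv_mu (right_ne_zero_of_mul hk)⟩

/-- `R̃` and `η̃⁻¹ R̃ᵀ η̃` are conjugate, up to a sign, by `exp(u μ̃)` if `exp u = -1`. -/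
theorem inv_mul_RT_transpose {u : ℂ} (hu : Complex.exp u = -1) (i j : ExtIdx n) :
    (D.etaT⁻¹ * D.RT.transpose) i j
      = -Complex.exp (-(u * (D.muT i + D.muT j))) * (D.RT * D.etaT⁻¹) i j := by
  -- In degree s the factor -exp(-us) equals (-1)^{s+1}, the sign in the symmetry of R̃_s; in all
  -- other degrees both sides vanish.
  by_cases hs : ∃ s : ℕ, 1 ≤ s ∧ D.muT i + D.muT j = s
  · obtain ⟨s, hs, h1⟩ := hs
    rw [h.inv_mul_RT_transpose_apply hs h1, h1, Complex.exp_neg, mul_comm u, Complex.exp_nat_mul,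
      hu, pow_succ, ← inv_pow]
    norm_num
  · rw [not_imp_comm.1 h.inv_mul_RT_transpose_grading hs,
      not_imp_comm.1 h.RT_mul_inv_grading hs, mul_zero]

end IsMonodromy
end SpectralData

/-! ### Power series at nilpotent elements -/

section NilEval

variable {A : Type*} [Ring A] [Algebra ℂ A]

/-- The value of a formal power series at a nilpotent element. -/
def nilEval (a : A) (Φ : PowerSeries ℂ) : A :=
  ∑ k ∈ Finset.range (nilpotencyClass a), PowerSeries.coeff k Φ • a ^ k

theorem nilEval_eq_sum {a : A} {N : ℕ} (h : a ^ N = 0) (Φ : PowerSeries ℂ) :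
    nilEval a Φ = ∑ k ∈ Finset.range N, PowerSeries.coeff k Φ • a ^ k := by
  have hn : nilpotencyClass a ≤ N := Nat.sInf_le h
  refine Finset.sum_subset (Finset.range_subset_range.2 hn) fun k _ hk => ?_
  rw [pow_eq_zero_of_le (Finset.mem_range.not.1 hk |> not_lt.1) (pow_nilpotencyClass ⟨N, h⟩),
    smul_zero]

/-- Only the class of the series modulo X^N matters, so the calculus reduces to polynomial
evaluation, which is a homomorphism. -/
theorem nilEval_eq_aeval {a : A} {N : ℕ} (h : a ^ N = 0) (Φ : PowerSeries ℂ)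
    (P : Polynomial ℂ) (hP : ∀ k < N, P.coeff k = PowerSeries.coeff k Φ) :
    nilEval a Φ = Polynomial.aeval a P := by
  rw [nilEval_eq_sum h]
  set T : Polynomial ℂ :=
    ∑ k ∈ Finset.range N, Polynomial.monomial k (PowerSeries.coeff k Φ) with hT
  have h1 : (Polynomial.X ^ N : Polynomial ℂ) ∣ P - T := by
    rw [Polynomial.X_pow_dvd_iff]
    intro k hk
    simp [hT, Polynomial.coeff_monomial, hk, hP k hk]
  obtain ⟨Q, hQ⟩ := h1
  have h2 : Polynomial.aeval a P = Polynomial.aeval a T := by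
    rw [← sub_eq_zero, ← map_sub, hQ, map_mul, map_pow, Polynomial.aeval_X, h, zero_mul]
  rw [h2, hT, map_sum]
  refine Finset.sum_congr rfl fun k _ => ?_
  rw [Polynomial.aeval_monomial, Algebra.smul_def]

theorem nilEval_mul {a : A} (ha : IsNilpotent a) (Φ Ψ : PowerSeries ℂ) :
    nilEval a (Φ * Ψ) = nilEval a Φ * nilEval a Ψ := by
  obtain ⟨N, h⟩ := ha
  have hc : ∀ (Φ : PowerSeries ℂ) (k : ℕ), k < N →
      (PowerSeries.trunc N Φ).coeff k = PowerSeries.coeff k Φ := by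
    intro Φ k hk
    rw [PowerSeries.coeff_trunc, if_pos hk]
  rw [nilEval_eq_aeval h Φ (PowerSeries.trunc N Φ) (hc Φ),
    nilEval_eq_aeval h Ψ (PowerSeries.trunc N Ψ) (hc Ψ),
    nilEval_eq_aeval h (Φ * Ψ) (PowerSeries.trunc N Φ * PowerSeries.trunc N Ψ), map_mul]
  intro k hk
  rw [Polynomial.coeff_mul, PowerSeries.coeff_mul]
  refine Finset.sum_congr rfl fun x hx => ?_
  have := Finset.HasAntidiagonal.mem_antidiagonal.1 hx
  rw [hc Φ _ (by omega), hc Ψ _ (by omega)]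

theorem nilEval_add (a : A) (Φ Ψ : PowerSeries ℂ) :
    nilEval a (Φ + Ψ) = nilEval a Φ + nilEval a Ψ := by
  simp [nilEval, add_smul, Finset.sum_add_distrib]

theorem nilEval_smul (a : A) (c : ℂ) (Φ : PowerSeries ℂ) :
    nilEval a (c • Φ) = c • nilEval a Φ := by
  simp [nilEval, mul_smul, Finset.smul_sum]

theorem nilEval_neg {a : A} (ha : IsNilpotent a) (Φ : PowerSeries ℂ) :
    nilEval (-a) Φ = nilEval a (PowerSeries.rescale (-1) Φ) := by
  obtain ⟨N, h⟩ := ha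
  have h' : (-a) ^ N = 0 := by rw [neg_pow, h, mul_zero]
  rw [nilEval_eq_sum h, nilEval_eq_sum h']
  refine Finset.sum_congr rfl fun k _ => ?_
  rw [PowerSeries.coeff_rescale, neg_pow, mul_comm, mul_smul]
  rcases Nat.even_or_odd k with hk | hk <;> simp [hk.neg_one_pow]

/-- An intertwiner of `a` and `b` intertwines all their powers. This carries functions of R̃ᵀ across
the Gram matrix. -/
theorem nilEval_mul_eq {a b g : A} (ha : IsNilpotent a) (hb : IsNilpotent b)
    (h : a * g = g * b) (Φ : PowerSeries ℂ) : nilEval a Φ * g = g * nilEval b Φ := by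
  obtain ⟨N, hN⟩ := ha
  obtain ⟨N', hN'⟩ := hb
  rw [nilEval_eq_sum (pow_eq_zero_of_le (le_max_left N N') hN),
    nilEval_eq_sum (pow_eq_zero_of_le (le_max_right N N') hN'), Finset.sum_mul, Finset.mul_sum]
  refine Finset.sum_congr rfl fun k _ => ?_
  have hk : a ^ k * g = g * b ^ k := (SemiconjBy.pow_right (show SemiconjBy g b a from h.symm) k).symm
  rw [smul_mul_assoc, mul_smul_comm, hk]

theorem exp_smul_eq_nilEval [Module ℚ A] {a : A} (ha : IsNilpotent a) (c : ℂ) :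
    IsNilpotent.exp (c • a) = nilEval a (PowerSeries.rescale c (PowerSeries.exp ℂ)) := by
  obtain ⟨N, h⟩ := ha
  have h' : (c • a) ^ N = 0 := by rw [smul_pow, h, smul_zero]
  rw [nilEval_eq_sum h, IsNilpotent.exp_eq_sum h']
  refine Finset.sum_congr rfl fun k _ => ?_
  rw [PowerSeries.coeff_rescale, PowerSeries.coeff_exp, smul_pow, mul_comm, mul_smul]
  rw [← algebraMap_smul ℂ ((k.factorial : ℚ)⁻¹)]
  simp

theorem exp_mul_eq [Module ℚ A] {a b g : A} (ha : IsNilpotent a) (hb : IsNilpotent b)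
    (h : a * g = g * b) : IsNilpotent.exp a * g = g * IsNilpotent.exp b := by
  have h1 := exp_smul_eq_nilEval ha 1
  have h2 := exp_smul_eq_nilEval hb 1
  rw [one_smul] at h1 h2
  rw [h1, h2, nilEval_mul_eq ha hb h]

end NilEval

/-! ### Taylor series -/

/-- The Taylor series at `y`. -/
def taylorSeries (f : ℂ → ℂ) (y : ℂ) : PowerSeries ℂ :=
  PowerSeries.mk fun k => (k.factorial : ℂ)⁻¹ * iteratedDeriv k f y

theorem taylorSeries_congr {f g : ℂ → ℂ} {y : ℂ} (h : f =ᶠ[𝓝 y] g) :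
    taylorSeries f y = taylorSeries g y := by
  ext k
  simp [taylorSeries, h.iteratedDeriv_eq k]

theorem taylorSeries_mul {f g : ℂ → ℂ} {y : ℂ} (hf : AnalyticAt ℂ f y) (hg : AnalyticAt ℂ g y) :
    taylorSeries (fun x => f x * g x) y = taylorSeries f y * taylorSeries g y := by
  ext k
  rw [PowerSeries.coeff_mul, Finset.Nat.sum_antidiagonal_eq_sum_range_succ_mk]
  simp only [taylorSeries, PowerSeries.coeff_mk]
  rw [iteratedDeriv_fun_mul hf.contDiffAt hg.contDiffAt, Finset.mul_sum]
  refine Finset.sum_congr rfl fun i hi => ?_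
  have hi' : i ≤ k := Nat.lt_succ_iff.1 (Finset.mem_range.1 hi)
  have h1 := Nat.choose_mul_factorial_mul_factorial hi'
  have h2 : (k.choose i : ℂ) * (i.factorial : ℂ) * ((k - i).factorial : ℂ) = k.factorial := by
    exact_mod_cast h1
  have h3 : (i.factorial : ℂ) ≠ 0 := by exact_mod_cast i.factorial_ne_zero
  have h4 : ((k - i).factorial : ℂ) ≠ 0 := by exact_mod_cast (k - i).factorial_ne_zero
  have h5 : (k.factorial : ℂ) ≠ 0 := by exact_mod_cast k.factorial_ne_zero
  field_simp
  rw [← h2]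
  ring

theorem taylorSeries_const_mul (c : ℂ) (f : ℂ → ℂ) (y : ℂ) :
    taylorSeries (fun x => c * f x) y = c • taylorSeries f y := by
  ext k
  simp only [taylorSeries, PowerSeries.coeff_mk, PowerSeries.coeff_smul, smul_eq_mul]
  rw [iteratedDeriv_const_mul_field]
  ring

theorem taylorSeries_add {f g : ℂ → ℂ} {y : ℂ} (hf : AnalyticAt ℂ f y) (hg : AnalyticAt ℂ g y) :
    taylorSeries (fun x => f x + g x) y = taylorSeries f y + taylorSeries g y := by
  ext k
  simp only [taylorSeries, PowerSeries.coeff_mk, map_add]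
  rw [iteratedDeriv_fun_add hf.contDiffAt hg.contDiffAt]
  ring

theorem taylorSeries_comp_add_const (f : ℂ → ℂ) (a y : ℂ) :
    taylorSeries (fun x => f (x + a)) y = taylorSeries f (y + a) := by
  ext k
  simp [taylorSeries, iteratedDeriv_comp_add_const]

theorem taylorSeries_comp_const_sub (f : ℂ → ℂ) (a y : ℂ) :
    taylorSeries (fun x => f (a - x)) y
      = PowerSeries.rescale (-1) (taylorSeries f (a - y)) := by
  ext k
  simp only [taylorSeries, PowerSeries.coeff_mk, PowerSeries.coeff_rescale]
  rw [iteratedDeriv_comp_const_sub]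
  simp only [smul_eq_mul]
  ring

theorem taylorSeries_exp (u y : ℂ) :
    taylorSeries (fun x => Complex.exp (u * x)) y
      = Complex.exp (u * y) • PowerSeries.rescale u (PowerSeries.exp ℂ) := by
  ext k
  simp only [taylorSeries, PowerSeries.coeff_mk, PowerSeries.coeff_smul, PowerSeries.coeff_rescale,
    iteratedDeriv_cexp_const_mul, PowerSeries.coeff_exp, smul_eq_mul]
  simp
  ring

theorem iteratedDeriv_polynomial_eval (k : ℕ) (P : Polynomial ℂ) :
    iteratedDeriv k (fun x => P.eval x) = fun x => (Polynomial.derivative^[k] P).eval x := by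
  induction k generalizing P with
  | zero => simp
  | succ k ih =>
    rw [iteratedDeriv_succ', Function.iterate_succ_apply, ← ih]
    congr 1
    ext x
    simp

theorem taylorSeries_eval (P : Polynomial ℂ) (a y : ℂ) :
    taylorSeries (fun x => P.eval (x + a)) y = (Polynomial.taylor (y + a) P : PowerSeries ℂ) := by
  rw [taylorSeries_comp_add_const (fun x => P.eval x)]
  ext k
  rw [Polynomial.coeff_coe, Polynomial.taylor_coeff, taylorSeries, PowerSeries.coeff_mk,
    iteratedDeriv_polynomial_eval, ← Polynomial.factorial_smul_hasseDeriv]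
  have h5 : (k.factorial : ℂ) ≠ 0 := by exact_mod_cast k.factorial_ne_zero
  simp [h5]

/-! ### The Gamma function -/

theorem analyticAt_Gamma {s : ℂ} (hs : ∀ m : ℕ, s ≠ -m) : AnalyticAt ℂ Complex.Gamma s := by
  have h1 : AnalyticAt ℂ (fun s : ℂ => (Complex.Gamma s)⁻¹) s :=
    Complex.differentiable_one_div_Gamma.analyticAt s
  have h2 := h1.inv (inv_ne_zero (Complex.Gamma_ne_zero hs))
  have h3 : (fun s : ℂ => (Complex.Gamma s)⁻¹)⁻¹ = Complex.Gamma := by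
    ext x; simp
  rwa [h3] at h2

/-- The poles of the gamma factors that occur are at half-integral `y`, exactly the zeros of the
cosine. -/
theorem ne_neg_nat_of_cos_ne_zero {y : ℂ} (hy : Complex.cos (Real.pi * y) ≠ 0) (a : ℤ) (m : ℕ) :
    y + a + 1 / 2 ≠ -m := by
  intro h
  apply hy
  rw [Complex.cos_eq_zero_iff]
  refine ⟨-m - a - 1, ?_⟩
  have : y = -m - a - 1 / 2 := by linear_combination h
  rw [this]
  push_cast
  ring

theorem ne_neg_nat_of_cos_ne_zero' {y : ℂ} (hy : Complex.cos (Real.pi * y) ≠ 0) (a : ℤ) (m : ℕ) :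
    a + 1 / 2 - y ≠ -m := by
  have h1 : Complex.cos (Real.pi * -y) ≠ 0 := by rwa [mul_neg, Complex.cos_neg]
  have := ne_neg_nat_of_cos_ne_zero h1 a m
  intro h
  apply this
  rw [← h]
  ring

theorem Gamma_add_nat {z : ℂ} (hz : ∀ m : ℕ, z ≠ -m) (N : ℕ) :
    Complex.Gamma (z + N) = (ascPochhammer ℂ N).eval z * Complex.Gamma z := by
  induction N with
  | zero => simp
  | succ N ih =>
    have h1 : z + N ≠ 0 := fun h0 => hz N (eq_neg_of_add_eq_zero_left h0)
    rw [Nat.cast_succ, ← add_assoc, Complex.Gamma_add_one _ h1, ih, ascPochhammer_succ_eval]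
    ring

/-- With z = y - q - 1/2, the functional equation extracts z^{[N]} from Γ(z + N), and the reflection
formula removes Γ(z) Γ(1 - z) because sin πz = (-1)^{q+1} cos πy. -/
theorem Gamma_mul_Gamma_mul_cos {y : ℂ} (hy : Complex.cos (Real.pi * y) ≠ 0) (q : ℤ) (N : ℕ) :
    Complex.Gamma (y + (-q - 1 / 2 + N)) * Complex.Gamma (q + 3 / 2 - y)
        * Complex.cos (Real.pi * y)
      = Real.pi * (-1) ^ (q + 1) * (ascPochhammer ℂ N).eval (y + (-q - 1 / 2)) := by
  have hz : ∀ m : ℕ, y + (-q - 1 / 2) ≠ -(m : ℂ) := by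
    intro m h
    apply ne_neg_nat_of_cos_ne_zero hy (-q - 1) m
    rw [← h]; push_cast; ring
  rw [← add_assoc, Gamma_add_nat hz]
  have h1 := Complex.Gamma_mul_Gamma_one_sub (y + (-q - 1 / 2))
  have h2 : 1 - (y + (-q - 1 / 2)) = q + 3 / 2 - y := by ring
  have h3 : Complex.sin (Real.pi * (y + (-q - 1 / 2)))
      = (-1) ^ (q + 1) * Complex.cos (Real.pi * y) := by
    have : Real.pi * (y + (-q - 1 / 2)) = (Real.pi * y - Real.pi / 2) - q * Real.pi := by ring
    rw [this, Complex.sin_antiperiodic.sub_int_mul_eq, Int.cast_negOnePow, Complex.sin_sub_pi_div_two, zpow_add_one₀ (by norm_num)]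
    ring
  rw [h2, h3] at h1
  have h4 : ((-1 : ℂ) ^ (q + 1)) * (-1) ^ (q + 1) = 1 := by
    rw [← mul_zpow]; simp
  have h5 : ((-1 : ℂ) ^ (q + 1)) ≠ 0 := left_ne_zero_of_mul (h4.trans_ne one_ne_zero)
  rw [eq_div_iff (mul_ne_zero h5 hy)] at h1
  linear_combination ((ascPochhammer ℂ N).eval (y + (-q - 1 / 2))) * ((-1 : ℂ) ^ (q + 1)) * h1
    - ((ascPochhammer ℂ N).eval (y + (-q - 1 / 2))) * Complex.Gamma (y + (-q - 1 / 2))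
      * Complex.Gamma (q + 3 / 2 - y) * Complex.cos (Real.pi * y) * h4

/-- The Taylor series form of the reflection formula. -/
theorem taylorSeries_Gamma_mul {y : ℂ} (hy : Complex.cos (Real.pi * y) ≠ 0) (q : ℤ) (N : ℕ) :
    taylorSeries Complex.Gamma (y + (-q - 1 / 2 + N))
        * PowerSeries.rescale (-1) (taylorSeries Complex.Gamma (q + 3 / 2 - y))
        * taylorSeries (fun x => Complex.cos (Real.pi * x)) y
      = (Real.pi * (-1) ^ (q + 1) : ℂ) •
        (Polynomial.taylor (y + (-q - 1 / 2)) (ascPochhammer ℂ N) : PowerSeries ℂ) := by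
  have h1 : AnalyticAt ℂ Complex.Gamma (y + (-q - 1 / 2 + N)) := by
    apply analyticAt_Gamma
    intro m h
    apply ne_neg_nat_of_cos_ne_zero hy (-q - 1 + N) m
    rw [← h]; push_cast; ring
  have h2 : AnalyticAt ℂ Complex.Gamma (q + 3 / 2 - y) := by
    apply analyticAt_Gamma
    intro m h
    apply ne_neg_nat_of_cos_ne_zero' hy (q + 1) m
    rw [← h]; push_cast; ring
  have h1' : AnalyticAt ℂ (fun x => Complex.Gamma (x + (-q - 1 / 2 + N))) y :=
    AnalyticAt.fun_comp (f := fun x : ℂ => x + (-q - 1 / 2 + N)) h1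
      (analyticAt_id.add analyticAt_const)
  have h2' : AnalyticAt ℂ (fun x => Complex.Gamma (q + 3 / 2 - x)) y :=
    AnalyticAt.fun_comp (f := fun x : ℂ => q + 3 / 2 - x) h2
      (analyticAt_const.sub analyticAt_id)
  have h3' : AnalyticAt ℂ (fun x => Complex.cos (Real.pi * x)) y := by
    have : Differentiable ℂ (fun x : ℂ => Complex.cos (Real.pi * x)) := by fun_prop
    exact this.analyticAt y
  rw [← taylorSeries_comp_add_const, ← taylorSeries_comp_const_sub, ← taylorSeries_mul h1' h2',
    ← taylorSeries_mul (h1'.fun_mul h2') h3', ← taylorSeries_eval, ← taylorSeries_const_mul]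
  -- The cosine stays nonzero near `y`, so the scalar identity holds on a neighbourhood and
  -- determines the Taylor series.
  apply taylorSeries_congr
  filter_upwards [h3'.continuousAt.eventually_ne hy] with x hx
  exact Gamma_mul_Gamma_mul_cos hx q N

/-- The functional equation of the Gamma function, in terms of Taylor series. -/
theorem taylorSeries_Gamma_add_one {s : ℂ} (hs : ∀ m : ℕ, s ≠ -m) :
    taylorSeries Complex.Gamma (s + 1)
      = (PowerSeries.C s + PowerSeries.X) * taylorSeries Complex.Gamma s := by
  have h0 : taylorSeries (fun x => x) s = PowerSeries.C s + PowerSeries.X := by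
    ext k
    rw [taylorSeries, PowerSeries.coeff_mk, iteratedDeriv_fun_id, map_add, PowerSeries.coeff_C,
      PowerSeries.coeff_X]
    rcases k with _ | _ | k <;> simp
  rw [← taylorSeries_comp_add_const, ← h0, ← taylorSeries_mul (f := fun x => x) analyticAt_id (analyticAt_Gamma hs)]
  apply taylorSeries_congr
  filter_upwards [continuousAt_id.eventually_ne (show id s ≠ 0 by simpa using hs 0)] with x hx
  exact Complex.Gamma_add_one x hx

/-! ### Calculus of formal sums of λ^x (log λ)^k. -/

namespace LogPow

theorem deriv_single (x : ℂ) (P : Polynomial ℂ) :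
    deriv (AddMonoidAlgebra.single x P) =
      AddMonoidAlgebra.single (x - 1) (Polynomial.C x * P + Polynomial.derivative P) := by
  rw [deriv, AddMonoidAlgebra.coeff_single, Finsupp.sum_single_index]
  simp

theorem deriv_add (f g : LogPow) : deriv (f + g) = deriv f + deriv g := by
  rw [deriv, AddMonoidAlgebra.coeff_add, Finsupp.sum_add_index']
  · rfl
  · simp
  · intro x P Q
    rw [← AddMonoidAlgebra.single_add, map_add]
    congr 1
    ring

/-- `∂/∂λ` as an additive map. -/
def derivHom : LogPow →+ LogPow where
  toFun := deriv
  map_zero' := by simp [deriv]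
  map_add' := deriv_add

theorem deriv_sum {ι : Type*} (s : Finset ι) (f : ι → LogPow) :
    deriv (∑ i ∈ s, f i) = ∑ i ∈ s, deriv (f i) := map_sum derivHom f s

theorem algebraMap_eq (c : ℂ) :
    algebraMap ℂ LogPow c = AddMonoidAlgebra.single 0 (Polynomial.C c) := rfl

theorem deriv_algebraMap_mul (c : ℂ) (f : LogPow) :
    deriv (algebraMap ℂ LogPow c * f) = algebraMap ℂ LogPow c * deriv f := by
  have h : f = ∑ x ∈ f.coeff.support, AddMonoidAlgebra.single x (f.coeff x) :=
    (AddMonoidAlgebra.sum_coeff_single f).symm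
  rw [h, Finset.mul_sum, deriv_sum, deriv_sum, Finset.mul_sum]
  refine Finset.sum_congr rfl fun x _ => ?_
  rw [algebraMap_eq, AddMonoidAlgebra.single_mul_single, deriv_single, deriv_single,
    AddMonoidAlgebra.single_mul_single, zero_add, zero_add, ← Polynomial.smul_eq_C_mul,
    ← Polynomial.smul_eq_C_mul, Polynomial.derivative_smul]
  simp only [Polynomial.smul_eq_C_mul]
  congr 1
  ring

/-- The coefficient of `λ^x` without logarithms, as an additive map. -/
def coeffAtHom (x : ℂ) : LogPow →+ ℂ where
  toFun f := coeffAt f x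
  map_zero' := by simp [coeffAt]
  map_add' := by simp [coeffAt]

theorem coeffAt_sum {ι : Type*} (s : Finset ι) (f : ι → LogPow) (x : ℂ) :
    coeffAt (∑ i ∈ s, f i) x = ∑ i ∈ s, coeffAt (f i) x := map_sum (coeffAtHom x) f s

open Classical in
theorem coeffAt_single (x y : ℂ) (P : Polynomial ℂ) :
    coeffAt (AddMonoidAlgebra.single x P) y = if x = y then P.coeff 0 else 0 := by
  rw [coeffAt, AddMonoidAlgebra.coeff_single, Finsupp.single_apply]
  split_ifs <;> simp

end LogPow

/-! ### The matrix λ^{-R}, with log λ as a polynomial variable. -/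

section ExpLog

variable {ι : Type*} [Fintype ι] [DecidableEq ι]

/-- `exp(-X R)` for a nilpotent matrix `R`. -/
def expNegX (R : Matrix ι ι ℂ) : Matrix ι ι (Polynomial ℂ) :=
  IsNilpotent.exp (-((Polynomial.X : Polynomial ℂ) • R.map Polynomial.C))

theorem expNegX_eq_sum {R : Matrix ι ι ℂ} {N : ℕ} (h : R ^ N = 0) :
    expNegX R = ∑ k ∈ Finset.range N, ((k.factorial : ℚ)⁻¹ : ℚ) •
      ((-Polynomial.X : Polynomial ℂ) ^ k • (R.map Polynomial.C) ^ k) := by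
  have hR : (R.map Polynomial.C) ^ N = 0 := by
    have : R.map Polynomial.C = (Polynomial.C : ℂ →+* Polynomial ℂ).mapMatrix R := rfl
    rw [this, ← map_pow, h, map_zero]
  have hk : ∀ k, (-((Polynomial.X : Polynomial ℂ) • R.map Polynomial.C)) ^ k
      = (-Polynomial.X : Polynomial ℂ) ^ k • (R.map Polynomial.C) ^ k := by
    intro k
    rw [← neg_smul, smul_pow]
  rw [expNegX, IsNilpotent.exp_eq_sum (k := N)]
  · exact Finset.sum_congr rfl fun k _ => by rw [hk]
  · rw [hk, hR, smul_zero]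

theorem derivative_expNegX {R : Matrix ι ι ℂ} (h : IsNilpotent R) :
    (expNegX R).map Polynomial.derivative = -(R.map Polynomial.C * expNegX R) := by
  obtain ⟨N, hN⟩ := h
  -- Differentiation shifts the exponential sum by one, so N + 1 terms on the left match N terms on
  -- the right.
  have hN' : R ^ (N + 1) = 0 := by rw [pow_succ, hN, zero_mul]
  have hpow : ∀ k, (R.map Polynomial.C) ^ k = (R ^ k).map Polynomial.C := fun k =>
    (map_pow (Polynomial.C : ℂ →+* Polynomial ℂ).mapMatrix R k).symm
  conv_lhs => rw [expNegX_eq_sum hN']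
  rw [expNegX_eq_sum hN, Finset.mul_sum, ← Finset.sum_neg_distrib]
  ext1 i j
  rw [Matrix.map_apply, Matrix.sum_apply, map_sum, Matrix.sum_apply, Finset.sum_range_succ']
  have h0 : Polynomial.derivative (((((0 : ℕ).factorial : ℚ)⁻¹ : ℚ) •
      ((-Polynomial.X : Polynomial ℂ) ^ 0 • (R.map Polynomial.C) ^ 0)) i j) = 0 := by
    simp [Matrix.one_apply]
    split_ifs <;> simp
  rw [h0, add_zero]
  refine Finset.sum_congr rfl fun k _ => ?_
  rw [mul_smul_comm, mul_smul_comm, ← pow_succ', hpow]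
  simp only [Matrix.smul_apply, Matrix.neg_apply, Matrix.map_apply, smul_eq_mul]
  rw [Polynomial.derivative_smul, Polynomial.derivative_mul, Polynomial.derivative_C, mul_zero,
    add_zero, Polynomial.derivative_pow_succ, Polynomial.derivative_neg, Polynomial.derivative_X,
    ← smul_neg]
  have hf : ((k + 1).factorial : ℚ)⁻¹ * ((k : ℚ) + 1) = (k.factorial : ℚ)⁻¹ := by
    rw [Nat.factorial_succ]
    have : (k.factorial : ℚ) ≠ 0 := by exact_mod_cast k.factorial_ne_zero
    have : (k : ℚ) + 1 ≠ 0 := by positivity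
    push_cast
    field_simp
  rw [← hf, mul_smul]
  congr 1
  rw [← algebraMap_smul ℂ ((k : ℚ) + 1), Polynomial.smul_eq_C_mul]
  simp
  ring

/-- The hypothesis moves exp(XR) through `G` as exp(-XRᵀ), so the two outer factors cancel. With X =
log λ this removes the logarithms. -/
theorem expNegX_mul_mul_transpose {R G : Matrix ι ι ℂ} (h : IsNilpotent R)
    (hG : R * G = -(G * R.transpose)) :
    expNegX R * G.map Polynomial.C * (expNegX R).transpose = G.map Polynomial.C := by
  obtain ⟨N, hN⟩ := h
  set M := (Polynomial.X : Polynomial ℂ) • R.map Polynomial.C with hM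
  have hMN : M ^ N = 0 := by
    have : R.map Polynomial.C = (Polynomial.C : ℂ →+* Polynomial ℂ).mapMatrix R := rfl
    rw [hM, smul_pow, this, ← map_pow, hN, map_zero, smul_zero]
  have hT : (expNegX R).transpose = IsNilpotent.exp (-M.transpose) := by
    rw [expNegX, ← hM, IsNilpotent.exp_eq_sum (k := N), IsNilpotent.exp_eq_sum (k := N),
      Matrix.transpose_sum]
    · refine Finset.sum_congr rfl fun k _ => ?_
      rw [Matrix.transpose_smul, Matrix.transpose_pow, Matrix.transpose_neg]
    · rw [neg_pow, ← Matrix.transpose_pow, hMN]; simp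
    · rw [neg_pow, hMN]; simp
  have hMnil : IsNilpotent M := ⟨N, hMN⟩
  have hMT : IsNilpotent (-M.transpose) := by
    refine ⟨N, ?_⟩
    rw [neg_pow, ← Matrix.transpose_pow, hMN]; simp
  have hc : M * G.map Polynomial.C = G.map Polynomial.C * (-M.transpose) := by
    have h1 := congrArg (Polynomial.C : ℂ →+* Polynomial ℂ).mapMatrix hG
    rw [map_mul, map_neg, map_mul] at h1
    simp only [RingHom.mapMatrix_apply, Matrix.transpose_map] at h1
    rw [hM, Matrix.transpose_smul, smul_mul_assoc, h1, mul_neg,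
      mul_smul_comm, smul_neg]
  rw [hT, mul_assoc, ← exp_mul_eq hMnil hMT hc, ← mul_assoc, expNegX, ← hM,
    IsNilpotent.exp_neg_mul_exp_self hMnil, one_mul]

end ExpLog

/-! ### Closed form of the formal Laplace integral and of its λ-derivative. -/

namespace SpectralData

variable {n : ℕ} (D : SpectralData n)

theorem powNegR_eq (h : IsNilpotent D.RT) :
    D.powNegR = (expNegX D.RT).map (AddMonoidAlgebra.singleZeroRingHom (R := Polynomial ℂ)
      (M := ℂ)) := by
  obtain ⟨N, hN⟩ := h
  have hnil : IsNilpotent (-((Polynomial.X : Polynomial ℂ) • D.RT.map Polynomial.C)) := by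
    refine ⟨N, ?_⟩
    have : D.RT.map Polynomial.C = (Polynomial.C : ℂ →+* Polynomial ℂ).mapMatrix D.RT := rfl
    rw [← neg_smul, smul_pow, this, ← map_pow, hN, map_zero, smul_zero]
  have h1 := IsNilpotent.map_exp hnil
    (AddMonoidAlgebra.singleZeroRingHom (R := Polynomial ℂ) (M := ℂ)).mapMatrix
  rw [expNegX]
  refine Eq.trans ?_ h1.symm
  rw [powNegR, map_neg]
  congr 2
  ext1 i j
  simp [LogPow.log, AddMonoidAlgebra.single_mul_single]

/-- The matrix with the rows `Γ(p + μ_i + ν + 1/2 + R̃)`. -/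
def gammaMat (ν : ℂ) (p : ℤ) : Matrix (ExtIdx n) (ExtIdx n) ℂ := Matrix.of fun i j =>
  nilEval D.RT (taylorSeries Complex.Gamma (p + D.muT i + ν + 1 / 2)) i j

namespace IsMonodromy

variable {D} (h : D.IsMonodromy)
include h

/-- In entry (i, j) of a power of R̃ the component of degree s survives only if μ_i = μ_j + s. The
gamma argument is then p + μ_i + ν + 1/2 throughout row i, and the sum over k is a Taylor expansion
at R̃. -/
theorem laplace_apply (ν : ℂ) (p : ℤ) (i j : ExtIdx n) :
    D.laplace ν p i j = AddMonoidAlgebra.single (-(p + D.muT i + ν + 1 / 2))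
      (((D.gammaMat ν p).map Polynomial.C * expNegX D.RT) i j) := by
  have key : ∀ i j : ExtIdx n, (∑ᶠ s : ℕ, ∑ k ∈ Finset.range (nilpotencyClass D.RT),
      ((k.factorial : ℂ)⁻¹ * D.gr s (D.RT ^ k) i j
        * iteratedDeriv k Complex.Gamma (p + D.muT j + ν + s + 1 / 2))
      • LogPow.pow (-(p + D.muT j + ν + s + 1 / 2)))
      = AddMonoidAlgebra.single (-(p + D.muT i + ν + 1 / 2)) (Polynomial.C (D.gammaMat ν p i j)) := by
    intro i j
    by_cases hs : ∃ s : ℕ, D.muT i = D.muT j + s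
    · obtain ⟨s, hs⟩ := hs
      have hx : (p : ℂ) + D.muT j + ν + s + 1 / 2 = p + D.muT i + ν + 1 / 2 := by rw [hs]; ring
      rw [finsum_eq_single _ s, ← Finset.sum_smul, hx, LogPow.pow, AddMonoidAlgebra.smul_single]
      · congr 1
        rw [Polynomial.smul_eq_C_mul, mul_one]
        congr 1
        rw [gammaMat, Matrix.of_apply, nilEval, Matrix.sum_apply]
        refine Finset.sum_congr rfl fun k _ => ?_
        simp only [gr, taylorSeries, PowerSeries.coeff_mk, Matrix.smul_apply, smul_eq_mul,
          Matrix.of_apply, if_pos hs]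
        ring
      · intro t ht
        refine Finset.sum_eq_zero fun k _ => ?_
        have : ¬ (D.muT i = D.muT j + t) := by
          rw [hs, add_right_inj, Nat.cast_inj]; exact fun h => ht h.symm
        simp [gr, this]
    · have h0 : ∀ k, (D.RT ^ k) i j = 0 := fun k => by
        by_contra hk
        obtain ⟨s, -, h1⟩ := h.RT_pow_grading k hk
        exact hs ⟨s, h1⟩
      have h1 : D.gammaMat ν p i j = 0 := by
        rw [gammaMat, Matrix.of_apply, nilEval, Matrix.sum_apply]
        exact Finset.sum_eq_zero fun k _ => by simp [h0]
      rw [h1, map_zero, AddMonoidAlgebra.single_zero]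
      have : ∀ s : ℕ, ∑ k ∈ Finset.range (nilpotencyClass D.RT),
          ((k.factorial : ℂ)⁻¹ * D.gr s (D.RT ^ k) i j
          * iteratedDeriv k Complex.Gamma (p + D.muT j + ν + s + 1 / 2))
          • LogPow.pow (-(p + D.muT j + ν + s + 1 / 2)) = 0 := fun s =>
        Finset.sum_eq_zero fun k _ => by simp [gr, h0]
      simp only [this, finsum_zero]
  rw [laplace, Matrix.mul_apply, D.powNegR_eq h.isNilpotent_RT]
  simp only [Matrix.of_apply, key, Matrix.map_apply]
  rw [Matrix.mul_apply, ← AddMonoidAlgebra.singleAddHom_apply, map_sum]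
  refine Finset.sum_congr rfl fun k _ => ?_
  simp [AddMonoidAlgebra.single_mul_single]

theorem gammaMat_succ {ν : ℂ} {p : ℤ} {i : ExtIdx n}
    (hs : ∀ m : ℕ, p + D.muT i + ν + 1 / 2 ≠ -(m : ℂ)) (j : ExtIdx n) :
    D.gammaMat ν (p + 1) i j
      = (p + D.muT i + ν + 1 / 2) * D.gammaMat ν p i j + (D.gammaMat ν p * D.RT) i j := by
  obtain ⟨N, hN⟩ := h.isNilpotent_RT
  have hN' : D.RT ^ (N + 2) = 0 := by rw [pow_add, hN, zero_mul]
  have hX : nilEval D.RT (PowerSeries.C (p + D.muT i + ν + 1 / 2) + PowerSeries.X)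
      = (p + D.muT i + ν + 1 / 2 : ℂ) • 1 + D.RT := by
    generalize (p + D.muT i + ν + 1 / 2 : ℂ) = x
    rw [nilEval_eq_aeval hN' _ (Polynomial.C x + Polynomial.X)]
    · simp [Algebra.algebraMap_eq_smul_one]
    · intro k _
      simp [PowerSeries.coeff_C, PowerSeries.coeff_X, Polynomial.coeff_C, Polynomial.coeff_X,
        eq_comm]
  have h1 : ((p + 1 : ℤ) : ℂ) + D.muT i + ν + 1 / 2 = (p + D.muT i + ν + 1 / 2) + 1 := by
    push_cast; ring
  rw [gammaMat, Matrix.of_apply, h1, taylorSeries_Gamma_add_one hs, mul_comm,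
    nilEval_mul h.isNilpotent_RT, hX, mul_add, mul_smul_comm, mul_one, Matrix.add_apply,
    Matrix.smul_apply, Matrix.mul_apply, Matrix.mul_apply]
  rfl

/-- With x = p + μ_i + ν + 1/2, the power λ^{-x} contributes -x and λ^{-R̃} contributes -R̃; their
sum is absorbed by (x + R̃) Γ(x + R̃) = Γ(x + 1 + R̃). -/
theorem deriv_laplace {ν : ℂ} {p : ℤ} {i : ExtIdx n}
    (hs : ∀ m : ℕ, p + D.muT i + ν + 1 / 2 ≠ -(m : ℂ)) (j : ExtIdx n) :
    LogPow.deriv (D.laplace ν p i j) = -D.laplace ν (p + 1) i j := by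
  rw [h.laplace_apply, h.laplace_apply, LogPow.deriv_single, ← AddMonoidAlgebra.single_neg]
  have h1 : -(p + D.muT i + ν + 1 / 2) - 1 = -(((p + 1 : ℤ) : ℂ) + D.muT i + ν + 1 / 2) := by
    push_cast; ring
  rw [h1]
  congr 1
  have h2 : Polynomial.derivative (((D.gammaMat ν p).map Polynomial.C * expNegX D.RT) i j)
      = -((D.gammaMat ν p * D.RT).map Polynomial.C * expNegX D.RT) i j := by
    rw [Matrix.map_mul, mul_assoc, ← Matrix.neg_apply, ← mul_neg,
      ← derivative_expNegX h.isNilpotent_RT, Matrix.mul_apply, Matrix.mul_apply, map_sum]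
    refine Finset.sum_congr rfl fun k _ => ?_
    simp
  rw [h2, Matrix.mul_apply, Matrix.mul_apply, Matrix.mul_apply, Finset.mul_sum,
    ← Finset.sum_neg_distrib, ← Finset.sum_neg_distrib, ← Finset.sum_add_distrib]
  refine Finset.sum_congr rfl fun k _ => ?_
  rw [Matrix.map_apply, Matrix.map_apply, Matrix.map_apply, h.gammaMat_succ hs]
  simp only [map_add, map_mul, map_neg]
  ring

theorem deriv_phi {ν : ℂ} {p : ℤ}
    (hs : ∀ i, ∀ m : ℕ, p + D.muT i + ν + 1 / 2 ≠ -(m : ℂ)) :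
    (D.phi ν p).map LogPow.deriv = -D.phi ν (p + 1) := by
  ext1 i j
  rw [Matrix.map_apply, phi, phi, Matrix.neg_apply, Matrix.mul_apply, Matrix.mul_apply,
    LogPow.deriv_sum]
  simp only [Matrix.map_apply, LogPow.deriv_algebraMap_mul]
  rw [← Finset.sum_neg_distrib]
  refine Finset.sum_congr rfl fun k _ => ?_
  rw [h.deriv_laplace (hs k)]
  exact mul_neg (algebraMap ℂ LogPow (D.etaT i k)) (D.laplace ν (p + 1) k j)

end IsMonodromy
end SpectralData

theorem nilEval_transpose {ι : Type*} [Fintype ι] [DecidableEq ι] {R : Matrix ι ι ℂ}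
    (h : IsNilpotent R) (Φ : PowerSeries ℂ) :
    (nilEval R Φ).transpose = nilEval R.transpose Φ := by
  obtain ⟨N, hN⟩ := h
  have hN' : R.transpose ^ N = 0 := by rw [← Matrix.transpose_pow, hN, Matrix.transpose_zero]
  rw [nilEval_eq_sum hN, nilEval_eq_sum hN', Matrix.transpose_sum]
  refine Finset.sum_congr rfl fun k _ => ?_
  rw [Matrix.transpose_smul, Matrix.transpose_pow]

theorem isNilpotent_transpose {ι : Type*} [Fintype ι] [DecidableEq ι] {R : Matrix ι ι ℂ}
    (h : IsNilpotent R) : IsNilpotent R.transpose := by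
  obtain ⟨N, hN⟩ := h
  exact ⟨N, by rw [← Matrix.transpose_pow, hN, Matrix.transpose_zero]⟩

/-! ### The Gram matrix, the reflection formula and the regularized coefficients. -/

namespace SpectralData

variable {n : ℕ} (D : SpectralData n)

/-- The matrix `e^{u(μ̃+ν)} η̃⁻¹`. -/
def expMuInv (u ν : ℂ) : Matrix (ExtIdx n) (ExtIdx n) ℂ :=
  Matrix.diagonal (fun i => Complex.exp (u * (D.muT i + ν))) * D.etaT⁻¹

theorem gram_eq (ν : ℂ) : D.gram ν = (-(1 / (2 * Real.pi)) : ℂ) •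
    (IsNilpotent.exp ((Real.pi * Complex.I : ℂ) • D.RT) * D.expMuInv (Real.pi * Complex.I) ν
      + IsNilpotent.exp ((-(Real.pi * Complex.I) : ℂ) • D.RT)
        * D.expMuInv (-(Real.pi * Complex.I)) ν) := by
  simp only [gram, expMuInv, add_mul, mul_assoc, neg_mul]

theorem exp_neg_pi_mul_I : Complex.exp (-(Real.pi * Complex.I)) = -1 := by
  rw [Complex.exp_neg, Complex.exp_pi_mul_I]; norm_num

namespace IsMonodromy

variable {D} (h : D.IsMonodromy)
include h

/-- Since η̃⁻¹ pairs opposite eigenvalues, the diagonal factor on its left becomes one scalar for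
each column. -/
theorem mul_diagonal_mul_inv (A : Matrix (ExtIdx n) (ExtIdx n) ℂ) (u ν : ℂ) (i j : ExtIdx n) :
    (A * D.expMuInv u ν) i j = Complex.exp (u * (ν - D.muT j)) * (A * D.etaT⁻¹) i j := by
  rw [expMuInv, ← mul_assoc, Matrix.mul_apply, Matrix.mul_apply, Finset.mul_sum]
  refine Finset.sum_congr rfl fun k _ => ?_
  by_cases h0 : D.etaT⁻¹ k j = 0
  · simp [h0]
  · rw [Matrix.mul_diagonal, h.etaT_inv_mu h0, show -D.muT j + ν = ν - D.muT j by ring]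
    ring

theorem RT_mul_expMuInv {u : ℂ} (hu : Complex.exp u = -1) (ν : ℂ) :
    D.RT * D.expMuInv u ν = -(D.expMuInv u ν * D.RT.transpose) := by
  ext i j
  rw [h.mul_diagonal_mul_inv, Matrix.neg_apply, expMuInv, mul_assoc, Matrix.diagonal_mul,
    h.inv_mul_RT_transpose hu, neg_mul, mul_neg, neg_neg, ← mul_assoc, ← Complex.exp_add]
  congr 2
  ring

theorem expMuInv_transpose (u ν : ℂ) :
    (D.expMuInv u (-ν)).transpose = D.expMuInv (-u) ν := by
  ext i j
  have h1 := h.mul_diagonal_mul_inv 1 u (-ν) j i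
  rw [one_mul, one_mul] at h1
  have h2 : D.etaT⁻¹ j i = D.etaT⁻¹ i j := congrFun (congrFun h.etaT_inv_transpose i) j
  rw [Matrix.transpose_apply, h1, expMuInv, Matrix.diagonal_mul, h2]
  congr 2
  ring

/-- Both exponents ±πi satisfy exp u = -1, so the relation holds for each exponential term: exp(uR̃)
commutes with R̃, and `RT_mul_expMuInv` handles the other factor. -/
theorem RT_mul_gram (ν : ℂ) : D.RT * D.gram ν = -(D.gram ν * D.RT.transpose) := by
  have key : ∀ u : ℂ, Complex.exp u = -1 →
      D.RT * (IsNilpotent.exp (u • D.RT) * D.expMuInv u ν)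
        = -(IsNilpotent.exp (u • D.RT) * D.expMuInv u ν * D.RT.transpose) := by
    intro u hu
    have hn : IsNilpotent (u • D.RT) := h.isNilpotent_RT.smul u
    have hc : IsNilpotent.exp (u • D.RT) * D.RT = D.RT * IsNilpotent.exp (u • D.RT) :=
      exp_mul_eq hn hn (by rw [smul_mul_assoc, mul_smul_comm])
    rw [← mul_assoc, ← hc, mul_assoc, h.RT_mul_expMuInv hu, mul_neg, mul_assoc]
  rw [D.gram_eq, mul_smul_comm, mul_add, key _ Complex.exp_pi_mul_I, key _ exp_neg_pi_mul_I,
    smul_mul_assoc, add_mul, ← smul_neg]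
  congr 1
  abel

/-- Transposition together with ν ↦ -ν interchanges the two exponential terms. -/
theorem gram_transpose (ν : ℂ) : (D.gram (-ν)).transpose = D.gram ν := by
  have key : ∀ u : ℂ, Complex.exp (-u) = -1 →
      (IsNilpotent.exp (u • D.RT) * D.expMuInv u (-ν)).transpose
        = IsNilpotent.exp ((-u) • D.RT) * D.expMuInv (-u) ν := by
    intro u hu
    have hT := isNilpotent_transpose h.isNilpotent_RT
    have h1 : (IsNilpotent.exp (u • D.RT)).transpose = IsNilpotent.exp (u • D.RT.transpose) := by
      rw [exp_smul_eq_nilEval h.isNilpotent_RT, exp_smul_eq_nilEval hT,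
        nilEval_transpose h.isNilpotent_RT]
    rw [Matrix.transpose_mul, h.expMuInv_transpose, h1]
    refine (exp_mul_eq (h.isNilpotent_RT.smul (-u)) (hT.smul u) ?_).symm
    rw [smul_mul_assoc, h.RT_mul_expMuInv hu, mul_smul_comm, neg_smul, smul_neg, neg_neg]
  have h2 := key _ exp_neg_pi_mul_I
  have h1 := key (-(Real.pi * Complex.I)) (by rw [neg_neg]; exact Complex.exp_pi_mul_I)
  rw [D.gram_eq, D.gram_eq, Matrix.transpose_smul, Matrix.transpose_add, h1, h2, neg_neg, add_comm]

/-- In column l the scalars e^{±πi(ν - μ_l)} combine with e^{±πiR̃} to a cosine at ν - μ_l + R̃, the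
factor required by the reflection formula. -/
theorem gram_apply (ν : ℂ) (k l : ExtIdx n) :
    D.gram ν k l = (nilEval D.RT ((-(1 / Real.pi) : ℂ) •
      taylorSeries (fun x => Complex.cos (Real.pi * x)) (ν - D.muT l)) * D.etaT⁻¹) k l := by
  set y := ν - D.muT l with hy
  have hcos : taylorSeries (fun x => Complex.cos (Real.pi * x)) y
      = (1 / 2 : ℂ) • (Complex.exp ((Real.pi * Complex.I) * y) •
          PowerSeries.rescale (Real.pi * Complex.I : ℂ) (PowerSeries.exp ℂ)
        + Complex.exp (-(Real.pi * Complex.I) * y) •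
          PowerSeries.rescale (-(Real.pi * Complex.I) : ℂ) (PowerSeries.exp ℂ)) := by
    have ha : ∀ u : ℂ, AnalyticAt ℂ (fun x => Complex.exp (u * x)) y := fun u => by
      have : Differentiable ℂ (fun x : ℂ => Complex.exp (u * x)) := by fun_prop
      exact this.analyticAt y
    rw [← taylorSeries_exp, ← taylorSeries_exp, ← taylorSeries_add (ha _) (ha _),
      ← taylorSeries_const_mul]
    congr 1
    ext x
    rw [Complex.cos]
    ring_nf
  have hpi : (Real.pi : ℂ) ≠ 0 := by exact_mod_cast Real.pi_ne_zero
  rw [D.gram_eq, Matrix.smul_apply, Matrix.add_apply, h.mul_diagonal_mul_inv,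
    h.mul_diagonal_mul_inv, ← hy, hcos, nilEval_smul, nilEval_smul, nilEval_add, nilEval_smul,
    nilEval_smul, exp_smul_eq_nilEval h.isNilpotent_RT, exp_smul_eq_nilEval h.isNilpotent_RT]
  simp only [smul_mul_assoc, add_mul, Matrix.smul_apply, Matrix.add_apply, smul_eq_mul]
  field_simp

/-- The product of the Gamma matrices with the Gram matrix is polynomial in `ν`, by the reflection
formula. -/
theorem gammaMat_mul_gram_mul {ν : ℂ} {k l : ExtIdx n}
    (hν : Complex.cos (Real.pi * (ν - D.muT l)) ≠ 0) {p q : ℤ} {N : ℕ}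
    (hN : (p : ℂ) + q + 2 + D.muT k + D.muT l = N) :
    (D.gammaMat ν (p + 1) * D.gram ν * (D.gammaMat (-ν) (q + 1)).transpose) k l
      = -((-1) ^ (q + 1) * (nilEval D.RT (Polynomial.taylor (ν - D.muT l + (-q - 1 / 2))
          (ascPochhammer ℂ N) : PowerSeries ℂ) * D.etaT⁻¹) k l) := by
  have hR := h.isNilpotent_RT
  have hpi : (Real.pi : ℂ) ≠ 0 := by exact_mod_cast Real.pi_ne_zero
  set Φ := taylorSeries Complex.Gamma (ν - D.muT l + (-q - 1 / 2 + N)) with hΦ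
  set Ψ := taylorSeries Complex.Gamma (q + 3 / 2 - (ν - D.muT l)) with hΨ
  -- By the degree condition `hN`, the first gamma argument is the reflection of the second one,
  -- shifted by N.
  have e1 : ∀ a, D.gammaMat ν (p + 1) k a = nilEval D.RT Φ k a := by
    intro a
    have hx : ((p + 1 : ℤ) : ℂ) + D.muT k + ν + 1 / 2 = ν - D.muT l + (-q - 1 / 2 + N) := by
      push_cast
      linear_combination hN
    rw [gammaMat, Matrix.of_apply, hΦ, hx]
  have e2 : ∀ a, (D.gammaMat (-ν) (q + 1)).transpose a l = nilEval D.RT.transpose Ψ a l := by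
    intro a
    have hx : ((q + 1 : ℤ) : ℂ) + D.muT l + -ν + 1 / 2 = q + 3 / 2 - (ν - D.muT l) := by
      push_cast
      ring
    rw [Matrix.transpose_apply, gammaMat, Matrix.of_apply, ← nilEval_transpose hR,
      Matrix.transpose_apply, hΨ, hx]
  -- A function of R̃ᵀ on the right of G̃ becomes a function of -R̃ on the left, so all factors are
  -- functions of the one matrix R̃ and commute.
  have e3 : D.gram ν * nilEval D.RT.transpose Ψ
      = nilEval D.RT (PowerSeries.rescale (-1) Ψ) * D.gram ν := by
    rw [← nilEval_neg hR]
    refine (nilEval_mul_eq hR.neg (isNilpotent_transpose hR) ?_ Ψ).symm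
    rw [neg_mul, h.RT_mul_gram, neg_neg]
  have e4 : (D.gammaMat ν (p + 1) * D.gram ν * (D.gammaMat (-ν) (q + 1)).transpose) k l
      = (nilEval D.RT Φ * D.gram ν * nilEval D.RT.transpose Ψ) k l := by
    simp only [Matrix.mul_apply, e1, e2]
  have e5 : ∀ A : Matrix (ExtIdx n) (ExtIdx n) ℂ, (A * D.gram ν) k l
      = (A * (nilEval D.RT ((-(1 / Real.pi) : ℂ) •
      taylorSeries (fun x => Complex.cos (Real.pi * x)) (ν - D.muT l)) * D.etaT⁻¹)) k l := by
    intro A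
    rw [Matrix.mul_apply, Matrix.mul_apply]
    exact Finset.sum_congr rfl fun b _ => by rw [h.gram_apply]
  rw [e4, mul_assoc, e3, ← mul_assoc, ← nilEval_mul hR, e5, ← mul_assoc, ← nilEval_mul hR,
    mul_smul_comm, taylorSeries_Gamma_mul hν, smul_smul, nilEval_smul, smul_mul_assoc,
    Matrix.smul_apply, smul_eq_mul]
  field_simp

/-- The two derivatives shift p and q by one and their signs cancel; the factors λ^{-R̃} cancel
around G̃, leaving a pure power of λ for each pair (k, l). -/
theorem bilin_apply {ν : ℂ} (hν : ∀ i, Complex.cos (Real.pi * (D.muT i + ν)) ≠ 0)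
    (hν' : ∀ i, Complex.cos (Real.pi * (D.muT i + -ν)) ≠ 0) (p q : ℤ) (i j : ExtIdx n) :
    D.bilin ν p q i j = ∑ k, ∑ l, AddMonoidAlgebra.single
      (-((p : ℂ) + q + 3 + D.muT k + D.muT l))
      (Polynomial.C (-(1 / 2) * (D.etaT i k * D.etaT j l *
        (D.gammaMat ν (p + 1) * D.gram ν * (D.gammaMat (-ν) (q + 1)).transpose) k l))) := by
  have h1 : (D.phi ν p).map LogPow.deriv = -D.phi ν (p + 1) := h.deriv_phi fun i m => by
    rw [show (p : ℂ) + D.muT i + ν + 1 / 2 = D.muT i + ν + p + 1 / 2 by ring]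
    exact ne_neg_nat_of_cos_ne_zero (hν i) p m
  have h2 : (D.phi (-ν) q).map LogPow.deriv = -D.phi (-ν) (q + 1) := h.deriv_phi fun i m => by
    rw [show (q : ℂ) + D.muT i + -ν + 1 / 2 = D.muT i + -ν + q + 1 / 2 by ring]
    exact ne_neg_nat_of_cos_ne_zero (hν' i) q m
  have h3 : ∀ k l, (D.laplace ν (p + 1) * (D.gram ν).map (algebraMap ℂ LogPow)
      * (D.laplace (-ν) (q + 1)).transpose) k l = AddMonoidAlgebra.single
      (-((p : ℂ) + q + 3 + D.muT k + D.muT l)) (Polynomial.C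
        ((D.gammaMat ν (p + 1) * D.gram ν * (D.gammaMat (-ν) (q + 1)).transpose) k l)) := by
    intro k l
    have e1 : (D.gammaMat ν (p + 1) * D.gram ν *
        (D.gammaMat (-ν) (q + 1)).transpose).map Polynomial.C
        = (D.gammaMat ν (p + 1)).map Polynomial.C * expNegX D.RT *
          (D.gram ν).map Polynomial.C *
          ((D.gammaMat (-ν) (q + 1)).map Polynomial.C * expNegX D.RT).transpose := by
      have := expNegX_mul_mul_transpose h.isNilpotent_RT (h.RT_mul_gram ν)
      rw [Matrix.map_mul, Matrix.map_mul, Matrix.transpose_mul, Matrix.transpose_map]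
      conv_lhs => rw [← this]
      simp only [mul_assoc]
    have e2 : Polynomial.C ((D.gammaMat ν (p + 1) * D.gram ν *
        (D.gammaMat (-ν) (q + 1)).transpose) k l)
        = ((D.gammaMat ν (p + 1)).map Polynomial.C * expNegX D.RT *
          (D.gram ν).map Polynomial.C *
          ((D.gammaMat (-ν) (q + 1)).map Polynomial.C * expNegX D.RT).transpose) k l := by
      rw [← e1]; rfl
    rw [e2, Matrix.mul_apply, Matrix.mul_apply, ← AddMonoidAlgebra.singleAddHom_apply, map_sum]
    refine Finset.sum_congr rfl fun b _ => ?_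
    rw [Matrix.mul_apply, Matrix.mul_apply, Finset.sum_mul, Finset.sum_mul, map_sum]
    refine Finset.sum_congr rfl fun a _ => ?_
    simp only [Matrix.transpose_apply, h.laplace_apply, Matrix.map_apply, LogPow.algebraMap_eq,
      AddMonoidAlgebra.single_mul_single, AddMonoidAlgebra.singleAddHom_apply]
    congr 1
    push_cast
    ring
  have h4 : D.bilin ν p q = algebraMap ℂ LogPow (-(1 / 2)) • (D.etaT.map (algebraMap ℂ LogPow) *
      (D.laplace ν (p + 1) * (D.gram ν).map (algebraMap ℂ LogPow)
      * (D.laplace (-ν) (q + 1)).transpose) * (D.etaT.map (algebraMap ℂ LogPow)).transpose) := by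
    rw [bilin, h1, h2, Matrix.transpose_neg, Matrix.mul_neg, Matrix.neg_mul, Matrix.neg_mul,
      neg_neg, phi, phi, Matrix.transpose_mul]
    simp only [Matrix.mul_assoc]
  rw [h4, Matrix.smul_apply, Matrix.mul_apply, Finset.sum_comm, Finset.smul_sum]
  refine Finset.sum_congr rfl fun l _ => ?_
  rw [Matrix.mul_apply, Finset.sum_mul, Finset.smul_sum]
  refine Finset.sum_congr rfl fun k _ => ?_
  rw [h3]
  simp only [Matrix.transpose_apply, Matrix.map_apply, LogPow.algebraMap_eq, smul_eq_mul,
    AddMonoidAlgebra.single_mul_single, ← map_mul]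
  congr 2
  · ring
  · ring

open Classical in
/-- The coefficients of the regularized stress tensor. -/
theorem regCoeff_eq {ν : ℂ} (hν : ∀ i, Complex.cos (Real.pi * (D.muT i + ν)) ≠ 0)
    (hν' : ∀ i, Complex.cos (Real.pi * (D.muT i + -ν)) ≠ 0) {m : ℤ} (hm : -1 ≤ m) (p q : ℤ)
    (i j : ExtIdx n) :
    D.regCoeff ν m p q i j = if (p : ℂ) + q + 1 - D.muT i - D.muT j = m then
      1 / 2 * (-1) ^ (q + 1) * (D.etaT * nilEval D.RT (Polynomial.taylor
        (ν + D.muT j + (-q - 1 / 2)) (ascPochhammer ℂ (m + 1).toNat) : PowerSeries ℂ)) i j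
      else 0 := by
  -- All summands with nonzero η̃ factors carry the same exponent of λ, so the condition on the
  -- degree comes out of the double sum.
  have h0 : ∀ k l, D.etaT i k * D.etaT j l ≠ 0 → D.muT k = -D.muT i ∧ D.muT l = -D.muT j := by
    intro k l hkl
    have h1 := h.etaT_mu (left_ne_zero_of_mul hkl)
    have h2 := h.etaT_mu (right_ne_zero_of_mul hkl)
    exact ⟨by rw [h1, neg_neg], by rw [h2, neg_neg]⟩
  rw [regCoeff, h.bilin_apply hν hν']
  simp only [LogPow.coeffAt_sum, LogPow.coeffAt_single, Polynomial.coeff_C_zero]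
  split_ifs with hc
  · set T := nilEval D.RT (Polynomial.taylor
        (ν + D.muT j + (-q - 1 / 2)) (ascPochhammer ℂ (m + 1).toNat) : PowerSeries ℂ) with hT
    have e1 : D.etaT * T = D.etaT * (T * D.etaT⁻¹) * D.etaT.transpose := by
      rw [h.etaT_transpose, mul_assoc, mul_assoc T, h.inv_mul_etaT, mul_one]
    rw [e1, Matrix.mul_apply, Finset.sum_comm, Finset.mul_sum]
    refine Finset.sum_congr rfl fun l _ => ?_
    rw [Matrix.mul_apply, Finset.sum_mul, Finset.mul_sum]
    refine Finset.sum_congr rfl fun k _ => ?_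
    by_cases hkl : D.etaT i k * D.etaT j l = 0
    · rw [hkl, Matrix.transpose_apply, mul_right_comm (D.etaT i k), hkl]
      simp
    · obtain ⟨hk, hl⟩ := h0 k l hkl
      -- The length of the rising factorial is m + 1, a natural number exactly because m ≥ -1.
      have hN : (p : ℂ) + q + 2 + D.muT k + D.muT l = (m + 1).toNat := by
        have : (((m + 1).toNat : ℤ) : ℂ) = (m + 1 : ℤ) := by
          rw [Int.toNat_of_nonneg (by omega)]
        rw [Int.cast_natCast] at this
        rw [this, hk, hl]
        push_cast
        linear_combination hc
      have hcos : Complex.cos (Real.pi * (ν - D.muT l)) ≠ 0 := by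
        rw [hl, sub_neg_eq_add, add_comm]; exact hν j
      rw [if_pos, h.gammaMat_mul_gram_mul hcos hN, hl, sub_neg_eq_add, ← hT, Matrix.transpose_apply]
      · ring
      · rw [hk, hl]; linear_combination -hc
  · refine Finset.sum_eq_zero fun k _ => Finset.sum_eq_zero fun l _ => ?_
    split_ifs with hc'
    · by_cases hkl : D.etaT i k * D.etaT j l = 0
      · rw [hkl]; simp
      · obtain ⟨hk, hl⟩ := h0 k l hkl
        exfalso
        apply hc
        rw [hk, hl] at hc'
        linear_combination -hc'
    · rfl

end IsMonodromy

/-! ### The limit ν → 0. -/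

theorem eventually_cos_ne_zero (a : ℂ) :
    ∀ᶠ ν : ℂ in 𝓝[≠] 0, Complex.cos (Real.pi * (a + ν)) ≠ 0 := by
  have hd : HasDerivAt (fun ν : ℂ => Complex.cos (Real.pi * (a + ν)))
      (-Complex.sin (Real.pi * (a + 0)) * (Real.pi * 1)) 0 :=
    (((hasDerivAt_id (0 : ℂ)).const_add a).const_mul (Real.pi : ℂ)).ccos
  by_cases h0 : Complex.cos (Real.pi * (a + 0)) = 0
  -- A zero of the cosine is simple, since sine and cosine do not vanish together; hence it is
  -- isolated.
  · apply hd.eventually_ne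
    have h1 := Complex.sin_sq_add_cos_sq (Real.pi * (a + 0))
    have hpi : (Real.pi : ℂ) ≠ 0 := by exact_mod_cast Real.pi_ne_zero
    have h2 : Complex.sin (Real.pi * (a + 0)) ≠ 0 := by
      intro h2
      rw [h0, h2] at h1
      norm_num at h1
    exact mul_ne_zero (neg_ne_zero.2 h2) (by simp)
  · exact (hd.continuousAt.eventually_ne h0).filter_mono nhdsWithin_le_nhds

theorem eventually_cos_ne_zero' (a : ℂ) :
    ∀ᶠ ν : ℂ in 𝓝[≠] 0, Complex.cos (Real.pi * (a + -ν)) ≠ 0 := by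
  filter_upwards [eventually_cos_ne_zero (-a)] with ν hν
  rwa [← Complex.cos_neg, show -(Real.pi * (a + -ν)) = Real.pi * (-a + ν) by ring]

open Classical in
/-- The limit of the regularized coefficients as `ν → 0`. -/
def limFormula (m p q : ℤ) (i j : ExtIdx n) : ℂ :=
  if (p : ℂ) + q + 1 - D.muT i - D.muT j = m then
    1 / 2 * (-1) ^ (q + 1) * (D.etaT * nilEval D.RT (Polynomial.taylor
      (D.muT j + (-q - 1 / 2)) (ascPochhammer ℂ (m + 1).toNat) : PowerSeries ℂ)) i j
  else 0

namespace IsMonodromy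

variable {D} (h : D.IsMonodromy)
include h

/-- Near 0, but not at 0, the coefficient equals an expression polynomial in ν, even if individual
gamma factors have poles at ν = 0. -/
theorem tendsto_regCoeff {m : ℤ} (hm : -1 ≤ m) (p q : ℤ) (i j : ExtIdx n) :
    Filter.Tendsto (fun ν : ℂ => D.regCoeff ν m p q i j) (𝓝[≠] 0)
      (𝓝 (D.limFormula m p q i j)) := by
  classical
  have h1 : (fun ν : ℂ => D.regCoeff ν m p q i j) =ᶠ[𝓝[≠] 0] fun ν =>
      if (p : ℂ) + q + 1 - D.muT i - D.muT j = m then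
      1 / 2 * (-1) ^ (q + 1) * (D.etaT * nilEval D.RT (Polynomial.taylor
        (ν + D.muT j + (-q - 1 / 2)) (ascPochhammer ℂ (m + 1).toNat) : PowerSeries ℂ)) i j
      else 0 := by
    filter_upwards [Filter.eventually_all.2 fun i => eventually_cos_ne_zero (D.muT i),
      Filter.eventually_all.2 fun i => eventually_cos_ne_zero' (D.muT i)] with ν hν hν'
    exact h.regCoeff_eq hν hν' hm p q i j
  refine Filter.Tendsto.congr' h1.symm (Filter.Tendsto.mono_left ?_ nhdsWithin_le_nhds)
  rw [limFormula]
  split_ifs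
  · have hcont : Continuous fun ν : ℂ => 1 / 2 * (-1) ^ (q + 1) * (D.etaT * nilEval D.RT
        (Polynomial.taylor (ν + D.muT j + (-q - 1 / 2))
          (ascPochhammer ℂ (m + 1).toNat) : PowerSeries ℂ)) i j := by
      simp only [Matrix.mul_apply, nilEval, Matrix.sum_apply, Matrix.smul_apply,
        Polynomial.coeff_coe, Polynomial.taylor_coeff, smul_eq_mul]
      fun_prop
    have := hcont.tendsto 0
    rwa [zero_add] at this
  · exact tendsto_const_nhds

theorem limCoeff_eq {m : ℤ} (hm : -1 ≤ m) (p q : ℤ) (i j : ExtIdx n) :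
    D.limCoeff m p q i j = D.limFormula m p q i j :=
  (h.tendsto_regCoeff hm p q i j).limUnder_eq

theorem bilin_transpose (ν : ℂ) (p q : ℤ) : (D.bilin (-ν) q p).transpose = D.bilin ν p q := by
  rw [bilin, bilin, neg_neg, Matrix.transpose_smul, Matrix.transpose_mul, Matrix.transpose_mul,
    Matrix.transpose_transpose, ← Matrix.transpose_map, h.gram_transpose, Matrix.mul_assoc]

/-- Interchanging the two factors replaces ν by -ν, which is invisible in the limit. The formula
itself does not display this symmetry. -/
theorem limFormula_comm {m : ℤ} (hm : -1 ≤ m) (p q : ℤ) (i j : ExtIdx n) :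
    D.limFormula m p q i j = D.limFormula m q p j i := by
  have h1 := h.tendsto_regCoeff hm q p j i
  have h2 : Filter.Tendsto (fun ν : ℂ => -ν) (𝓝[≠] 0) (𝓝[≠] 0) := by
    refine tendsto_nhdsWithin_iff.2 ⟨?_, ?_⟩
    · have := (continuous_neg (G := ℂ)).tendsto 0
      rw [neg_zero] at this
      exact this.mono_left nhdsWithin_le_nhds
    · filter_upwards [self_mem_nhdsWithin] with ν hν
      simpa using hν
  have h3 := h1.comp h2
  refine tendsto_nhds_unique (h.tendsto_regCoeff hm p q i j) (h3.congr fun ν => ?_)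
  rw [Function.comp_apply, regCoeff, regCoeff, ← h.bilin_transpose ν p q, Matrix.transpose_apply]

end IsMonodromy
end SpectralData

/-! ### The terms C_{m;p,q} as an additional corner entry of R̃. -/

theorem eval_derivative_ascPochhammer_succ (x : ℂ) (n : ℕ) :
    (Polynomial.derivative (ascPochhammer ℂ (n + 1))).eval x
      = ∑ k ∈ Finset.range (n + 1), (-1) ^ k * (ascPochhammer ℂ k).eval (-x - n)
          * (ascPochhammer ℂ (n - k)).eval x := by
  induction n with
  | zero => simp
  | succ n ih =>
    rw [ascPochhammer_succ_right, Polynomial.derivative_mul, Polynomial.eval_add,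
      Polynomial.eval_mul, Polynomial.eval_mul, ih, Finset.sum_mul, Finset.sum_range_succ' _ (n + 1)]
    congr 1
    -- In the product rule the factor x + n + 1 lengthens (-x-n)^{[k]} to -(-x-n-1)^{[k+1]}; the
    -- other summand of the product rule is the term k = 0.
    · refine Finset.sum_congr rfl fun k _ => ?_
      have h1 : (ascPochhammer ℂ (k + 1)).eval (-x - (n + 1 : ℕ))
          = (-x - (n + 1 : ℕ)) * (ascPochhammer ℂ k).eval (-x - n) := by
        rw [ascPochhammer_succ_left, Polynomial.eval_mul, Polynomial.eval_comp]
        simp only [Polynomial.eval_X, Polynomial.eval_add, Polynomial.eval_one]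
        rw [show -x - ((n + 1 : ℕ) : ℂ) + 1 = -x - n by push_cast; ring]
      rw [h1, Nat.add_sub_add_right]
      simp
      ring
    · simp

theorem neg_one_zpow_congr {a b : ℤ} (h : Even (a + b)) : (-1 : ℂ) ^ a = (-1) ^ b := by
  have h1 : (-1 : ℂ) ^ a * (-1) ^ b = 1 := by
    rw [← zpow_add₀ (by norm_num), h.neg_one_zpow]
  have h2 : (-1 : ℂ) ^ b * (-1) ^ b = 1 := by
    rw [← mul_zpow]; simp
  have h3 : (-1 : ℂ) ^ b ≠ 0 := left_ne_zero_of_mul (h2.trans_ne one_ne_zero)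
  exact mul_right_cancel₀ h3 (h1.trans h2.symm)

namespace SpectralData

variable {n : ℕ} (D : SpectralData n)

open Classical in
/-- The constant `c_{d-1}` if the charge is a negative odd integer, and zero otherwise. -/
def cNeg : ℂ := if h : ∃ N : ℤ, D.d = N ∧ N < 0 ∧ Odd N then D.c (h.choose - 1) else 0

theorem cNeg_eq {N : ℤ} (h1 : D.d = N) (h2 : N < 0) (h3 : Odd N) : D.cNeg = D.c (N - 1) := by
  have h : ∃ N : ℤ, D.d = N ∧ N < 0 ∧ Odd N := ⟨N, h1, h2, h3⟩
  have h4 : h.choose = N := by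
    exact_mod_cast h.choose_spec.1.symm.trans h1
  rw [cNeg, dif_pos h, h4]

/-- The matrix `R̃` with the additional entry `c_{d-1}` if the charge is negative. -/
def RX : Matrix (ExtIdx n) (ExtIdx n) ℂ :=
  D.RT + Matrix.single ExtIdx.last ExtIdx.zero D.cNeg

theorem RT_last (i : ExtIdx n) : D.RT i ExtIdx.last = 0 := by
  rcases i with _ | _ | _ <;> simp [RT, RTs]

theorem RT_zero (j : ExtIdx n) : D.RT ExtIdx.zero j = 0 := by
  rcases j with _ | _ | _ <;> simp [RT, RTs]

theorem RX_zero (j : ExtIdx n) : D.RX ExtIdx.zero j = 0 := by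
  simp [RX, RT_zero, Matrix.single]

/-- The corner entry is annihilated by R̃ on either side, as row 0 and the last column of R̃ vanish,
and it squares to zero. -/
theorem RX_pow (k : ℕ) : D.RX ^ (k + 2) = D.RT ^ (k + 2) := by
  have h1 : Matrix.single ExtIdx.last ExtIdx.zero D.cNeg * D.RT = 0 := by
    ext i j
    by_cases hi : i = ExtIdx.last
    · subst hi; simp [RT_zero]
    · simp [hi]
  have h2 : D.RT * Matrix.single ExtIdx.last ExtIdx.zero D.cNeg = 0 := by
    ext i j
    by_cases hj : j = ExtIdx.zero
    · subst hj; simp [RT_last]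
    · simp [hj]
  induction k with
  | zero =>
    rw [zero_add, pow_two, pow_two, RX, add_mul, mul_add, mul_add, h1, h2,
      Matrix.single_mul_single_of_ne _ _ _ _ (by simp)]
    simp
  | succ k ih =>
    rw [pow_succ', ih, RX, add_mul, ← pow_succ', pow_succ' _ (k + 1), ← mul_assoc, h1, zero_mul,
      add_zero]

theorem aeval_RX (P : Polynomial ℂ) :
    Polynomial.aeval D.RX P = Polynomial.aeval D.RT P
      + Matrix.single ExtIdx.last ExtIdx.zero (P.coeff 1 * D.cNeg) := by
  induction P using Polynomial.induction_on' with
  | add P Q hP hQ =>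
    rw [map_add, map_add, hP, hQ, Polynomial.coeff_add, add_mul, Matrix.single_add]
    abel
  | monomial k a =>
    rw [Polynomial.aeval_monomial, Polynomial.aeval_monomial, Polynomial.coeff_monomial]
    rcases k with _ | _ | k
    · simp
    · simp [RX, mul_add, ← Algebra.smul_def]
    · rw [RX_pow, if_neg (by omega)]
      simp

/-- The kernel of the quadratic part of `L_m`, without the terms `C_{m;p,q}`. -/
def limKer (m : ℤ) (x y : ExtIdx n × ℤ) : ℂ := D.limCoeff m x.2 y.2 x.1 y.1

open Classical in
/-- The kernel of the terms `C_{m;p,q} t^{0,p} t^{0,q}` of `L_m`. -/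
def extraKer (m : ℤ) (x y : ExtIdx n × ℤ) : ℂ :=
  if x.1 = ExtIdx.zero ∧ y.1 = ExtIdx.zero then
    (-1) ^ (x.2 + y.2) * D.extraCoeff m (-x.2 - 1) (-y.2 - 1) else 0

/-- The kernel of the quadratic part of `L_m`. -/
def ker (m : ℤ) (x y : ExtIdx n × ℤ) : ℂ := D.limKer m x y + D.extraKer m x y

/-- The reflection k ↦ m - k interchanges the rising factorials; the signs agree because p + q + m =
d - 1 is even for odd d. -/
theorem extraCoeff_comm (m p q : ℤ) : D.extraCoeff m p q = D.extraCoeff m q p := by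
  classical
  unfold extraCoeff
  have hc : ((∃ N : ℤ, D.d = N ∧ N < 0 ∧ Odd N ∧ p + q + m = N - 1) ∧ 0 ≤ m)
      ↔ ((∃ N : ℤ, D.d = N ∧ N < 0 ∧ Odd N ∧ q + p + m = N - 1) ∧ 0 ≤ m) := by
    rw [add_comm p q]
  by_cases h : (∃ N : ℤ, D.d = N ∧ N < 0 ∧ Odd N ∧ p + q + m = N - 1) ∧ 0 ≤ m
  · rw [if_pos h, if_pos (hc.1 h), add_comm q p]
    obtain ⟨⟨N, -, -, hN, hpq⟩, hm⟩ := h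
    rw [← Finset.sum_range_reflect, Finset.mul_sum, Finset.mul_sum]
    refine Finset.sum_congr rfl fun k hk => ?_
    have hk' : k ≤ m.toNat := by have := Finset.mem_range.1 hk; omega
    have e1 : m.toNat + 1 - 1 - k = m.toNat - k := by omega
    have e2 : m.toNat - (m.toNat - k) = k := by omega
    have e3 : (-1 : ℂ) ^ p * (-1) ^ (m.toNat - k) = (-1) ^ q * (-1) ^ k := by
      rw [← zpow_natCast, ← zpow_natCast, ← zpow_add₀ (by norm_num), ← zpow_add₀ (by norm_num)]
      apply neg_one_zpow_congr
      have e4 : p + ((m.toNat - k : ℕ) : ℤ) + (q + k) = N - 1 := by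
        rw [Nat.cast_sub hk', Int.toNat_of_nonneg hm]
        linarith
      rw [e4]
      exact hN.sub_odd odd_one
    rw [e1, e2]
    linear_combination (D.c (p + q + m) / 2
      * (ascPochhammer ℂ (m.toNat - k)).eval (p - D.d / 2 + 1 / 2)
      * (ascPochhammer ℂ k).eval (q - D.d / 2 + 1 / 2)) * e3
  · rw [if_neg h, if_neg (hc.not.1 h)]

open Classical in
-- The alternating sum in C_{m;p,q} is the derivative of a rising factorial, hence the linear
-- coefficient through which `aeval_RX` sees the corner entry. The constraint on p + q + m is the
-- grading condition for the indices (0, 0).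
theorem extraKer_eq {m : ℤ} (hm : -1 ≤ m) (i j : ExtIdx n) (p q : ℤ) :
    D.extraKer m (i, p) (j, q) = if (p : ℂ) + q + 1 - D.muT i - D.muT j = m then
      1 / 2 * (-1) ^ (q + 1) * (D.etaT * (Matrix.single ExtIdx.last ExtIdx.zero
        ((Polynomial.taylor (D.muT j + (-q - 1 / 2)) (ascPochhammer ℂ (m + 1).toNat)).coeff 1
          * D.cNeg) : Matrix (ExtIdx n) (ExtIdx n) ℂ)) i j else 0 := by
  by_cases hij : i = ExtIdx.zero ∧ j = ExtIdx.zero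
  · obtain ⟨rfl, rfl⟩ := hij
    have h1 : D.extraKer m (ExtIdx.zero, p) (ExtIdx.zero, q)
      = (-1) ^ (p + q) * D.extraCoeff m (-p - 1) (-q - 1) := by simp [extraKer]
    have hmu : D.muT (ExtIdx.zero : ExtIdx n) = -D.d / 2 := rfl
    have heta : D.etaT (ExtIdx.zero : ExtIdx n) ExtIdx.last = 1 := rfl
    rw [h1, Matrix.mul_single_apply_same, heta, one_mul, hmu]
    by_cases hN : ∃ N : ℤ, D.d = N ∧ N < 0 ∧ Odd N
    · obtain ⟨N, hd, hneg, hodd⟩ := hN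
      by_cases hc : p + q + 1 + N = m
      · have hc' : (p : ℂ) + q + 1 - -D.d / 2 - -D.d / 2 = m := by
          rw [← hc, hd]; push_cast; ring
        rw [if_pos hc', D.cNeg_eq hd hneg hodd]
        -- For m = -1 the rising factorial is the constant 1, and both sides vanish.
        rcases eq_or_lt_of_le hm with hm' | hm'
        · rw [← hm', extraCoeff, if_neg (by omega)]
          simp [Polynomial.coeff_one]
        · obtain ⟨k, rfl⟩ := Int.eq_ofNat_of_zero_le (show 0 ≤ m by omega)
          have e1 : ((k : ℤ) + 1).toNat = k + 1 := by omega
          rw [extraCoeff, if_pos ⟨⟨N, hd, hneg, hodd, by omega⟩, by omega⟩, Int.toNat_natCast, e1,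
            Polynomial.taylor_coeff_one, eval_derivative_ascPochhammer_succ]
          have e2 : -p - 1 + (-q - 1) + (k : ℤ) = N - 1 := by omega
          have e3 : (((-q - 1 : ℤ) : ℂ) - D.d / 2 + 1 / 2) = -D.d / 2 + (-q - 1 / 2) := by
            push_cast; ring
          have e4 : (((-p - 1 : ℤ) : ℂ) - D.d / 2 + 1 / 2) = -(-D.d / 2 + (-q - 1 / 2)) - k := by
            push_cast at hc' ⊢
            linear_combination -hc'
          have e5 : (-1 : ℂ) ^ (p + q) * (-1) ^ (-p - 1) = (-1) ^ (q + 1) := by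
            rw [← zpow_add₀ (by norm_num)]
            exact neg_one_zpow_congr ⟨q, by ring⟩
          rw [e2, e3, e4]
          linear_combination (D.c (N - 1) / 2 * ∑ l ∈ Finset.range (k + 1), (-1) ^ l
            * (ascPochhammer ℂ l).eval (-(-D.d / 2 + (-q - 1 / 2)) - k)
            * (ascPochhammer ℂ (k - l)).eval (-D.d / 2 + (-q - 1 / 2))) * e5
      · have hc' : ¬ ((p : ℂ) + q + 1 - -D.d / 2 - -D.d / 2 = m) := by
          intro h
          apply hc
          rw [hd] at h
          have : ((p + q + 1 + N : ℤ) : ℂ) = (m : ℤ) := by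
            push_cast
            linear_combination h
          exact_mod_cast this
        rw [if_neg hc', extraCoeff, if_neg, mul_zero]
        rintro ⟨⟨N', hd', -, -, h⟩, -⟩
        have : N' = N := by exact_mod_cast (hd'.symm.trans hd)
        omega
    · have h2 : D.extraCoeff m (-p - 1) (-q - 1) = 0 := by
        rw [extraCoeff, if_neg]
        rintro ⟨⟨N, h1, h2, h3, -⟩, -⟩
        exact hN ⟨N, h1, h2, h3⟩
      have h3 : D.cNeg = 0 := by rw [cNeg, dif_neg hN]
      rw [h2, h3]
      simp
  · have h1 : D.extraKer m (i, p) (j, q) = 0 := by simp [extraKer, hij]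
    rw [h1]
    symm
    rw [ite_eq_right_iff]
    intro _
    by_cases hj : j = ExtIdx.zero
    · subst hj
      have hi : i ≠ ExtIdx.zero := fun hi => hij ⟨hi, rfl⟩
      have : D.etaT i ExtIdx.last = 0 := by
        rcases i with _ | _ | _
        · exact (hi rfl).elim
        · rfl
        · rfl
      rw [Matrix.mul_single_apply_same, this]
      simp
    · rw [Matrix.mul_single_apply_of_ne _ _ _ _ _ hj]
      simp

theorem extraKer_comm (m : ℤ) (x y : ExtIdx n × ℤ) : D.extraKer m x y = D.extraKer m y x := by
  by_cases hx : x.1 = ExtIdx.zero <;> by_cases hy : y.1 = ExtIdx.zero <;>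
    simp [extraKer, hx, hy, add_comm, D.extraCoeff_comm (p := -x.2 - 1)]

namespace IsMonodromy

variable {D} (h : D.IsMonodromy)
include h

theorem RX_grading {i j : ExtIdx n} (hij : D.RX i j ≠ 0) :
    ∃ s : ℤ, D.muT i = D.muT j + s := by
  by_cases h0 : D.RT i j = 0
  · by_cases hl : i = ExtIdx.last ∧ j = ExtIdx.zero
    · obtain ⟨rfl, rfl⟩ := hl
      have hc : D.cNeg ≠ 0 := by simpa [RX, h0] using hij
      by_cases hN : ∃ N : ℤ, D.d = N ∧ N < 0 ∧ Odd N
      · obtain ⟨N, hd, -, -⟩ := hN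
        refine ⟨N, ?_⟩
        simp only [muT]
        rw [hd]
        ring
      · rw [cNeg, dif_neg hN] at hc
        exact (hc rfl).elim
    · exfalso
      apply hij
      rw [RX, Matrix.add_apply, h0, zero_add, Matrix.single_apply_of_ne]
      rintro ⟨h1, h2⟩
      exact hl ⟨h1.symm, h2.symm⟩
  · obtain ⟨s, -, hs⟩ := h.RT_grading h0
    exact ⟨s, by exact_mod_cast hs⟩

open Classical in
-- The limit and the terms C_{m;p,q} merge into one polynomial in `RX`, so no later argument
-- distinguishes charges.
theorem ker_eq {m : ℤ} (hm : -1 ≤ m) (i j : ExtIdx n) (p q : ℤ) :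
    D.ker m (i, p) (j, q) = if (p : ℂ) + q + 1 - D.muT i - D.muT j = m then
      1 / 2 * (-1) ^ (q + 1) * (D.etaT * Polynomial.aeval D.RX
        (Polynomial.taylor (D.muT j + (-q - 1 / 2)) (ascPochhammer ℂ (m + 1).toNat))) i j
      else 0 := by
  obtain ⟨N, hN⟩ := h.isNilpotent_RT
  rw [ker, limKer, h.limCoeff_eq hm, D.extraKer_eq hm, limFormula]
  split_ifs
  · rw [nilEval_eq_aeval hN _ (Polynomial.taylor (D.muT j + (-q - 1 / 2))
      (ascPochhammer ℂ (m + 1).toNat)) fun k _ => (Polynomial.coeff_coe _ _).symm, D.aeval_RX,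
      Matrix.mul_add, Matrix.add_apply]
    ring
  · simp

theorem limKer_comm {m : ℤ} (hm : -1 ≤ m) (x y : ExtIdx n × ℤ) :
    D.limKer m x y = D.limKer m y x := by
  rw [limKer, limKer, h.limCoeff_eq hm, h.limCoeff_eq hm, h.limFormula_comm hm]

theorem ker_comm {m : ℤ} (hm : -1 ≤ m) (x y : ExtIdx n × ℤ) :
    D.ker m x y = D.ker m y x := by
  rw [ker, ker, h.limKer_comm hm, D.extraKer_comm]

end IsMonodromy
end SpectralData

/-! ### The Witt algebra inside a Weyl algebra. -/

section Weyl

variable {A : Type*} [Ring A] {Y V : A}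

theorem weyl_mul_pow (h : V * Y = Y * V + 1) (a : ℕ) :
    V * Y ^ (a + 1) = Y ^ (a + 1) * V + ((a + 1 : ℕ) : A) * Y ^ a := by
  induction a with
  | zero => simpa using h
  | succ a ih =>
    calc V * Y ^ (a + 1 + 1) = (V * Y ^ (a + 1)) * Y := by rw [pow_succ _ (a + 1), mul_assoc]
      _ = Y ^ (a + 1) * (V * Y) + ((a + 1 : ℕ) : A) * Y ^ (a + 1) := by
        rw [ih, add_mul, mul_assoc, mul_assoc, ← pow_succ]
      _ = _ := by
        rw [h, mul_add, ← mul_assoc, ← pow_succ, mul_one, Nat.cast_succ (a + 1), add_mul, one_mul]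
        abel

/-- The polynomial vector fields `y^a ∂_y` in a Weyl algebra. -/
theorem weyl_lie (h : V * Y = Y * V + 1) {a b c : ℕ} (hc : a + b = c + 1) :
    (Y ^ a * V) * (Y ^ b * V) - (Y ^ b * V) * (Y ^ a * V) = ((b : A) - a) * (Y ^ c * V) := by
  -- The second-order part depends only on a + b, so it cancels in the commutator.
  have key : ∀ a b : ℕ, a + b = c + 1 →
      (Y ^ a * V) * (Y ^ b * V) = Y ^ (c + 1) * V * V + (b : A) * (Y ^ c * V) := by
    intro a b hab
    rcases b with _ | b
    · rw [pow_zero, one_mul, ← hab]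
      simp
    · have hc' : c = a + b := by omega
      calc (Y ^ a * V) * (Y ^ (b + 1) * V) = Y ^ a * (V * Y ^ (b + 1)) * V := by
            simp only [mul_assoc]
        _ = _ := by
          rw [weyl_mul_pow h, mul_add, add_mul, ← mul_assoc, ← pow_add, ← mul_assoc,
            ← (Nat.cast_commute (b + 1) (Y ^ a)).eq, mul_assoc _ (Y ^ a), ← pow_add, hab, hc',
            mul_assoc ((b + 1 : ℕ) : A)]
  rw [key a b hc, key b a (by omega), sub_mul]
  abel

end Weyl

/-! ### The Witt algebra acting on combinations of the generators. -/

/-- The space of the linear combinations of the generators `a^i_p`. -/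
abbrev LoopSpace (n : ℕ) := (ExtIdx n × ℤ) →₀ ℂ

/-- The translation of the index `p` by `k`. -/
def shiftOp {n : ℕ} (k : ℤ) : Module.End ℂ (LoopSpace n) :=
  Finsupp.lmapDomain ℂ ℂ fun x => (x.1, x.2 + k)

theorem shiftOp_single {n : ℕ} (k : ℤ) (x : ExtIdx n × ℤ) (c : ℂ) :
    shiftOp k (Finsupp.single x c) = Finsupp.single (x.1, x.2 + k) c := by
  simp [shiftOp, Finsupp.mapDomain_single]

theorem shiftOp_mul {n : ℕ} (k l : ℤ) :
    (shiftOp k * shiftOp l : Module.End ℂ (LoopSpace n)) = shiftOp (k + l) := by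
  refine Finsupp.lhom_ext fun x c => ?_
  rw [Module.End.mul_apply, shiftOp_single, shiftOp_single, shiftOp_single]
  congr 2
  ring

theorem shiftOp_zero {n : ℕ} : (shiftOp 0 : Module.End ℂ (LoopSpace n)) = 1 := by
  refine Finsupp.lhom_ext fun x c => ?_
  rw [shiftOp_single, add_zero]
  rfl

namespace SpectralData

variable {n : ℕ} (D : SpectralData n)

/-- The difference of two entries of `μ̃`, if it is an integer. -/
def muDiff (i l : ExtIdx n) : ℤ := ⌊(D.muT i - D.muT l).re⌋

theorem muDiff_eq {i l : ExtIdx n} {z : ℤ} (hz : D.muT i = D.muT l + z) : D.muDiff i l = z := by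
  rw [muDiff, hz, add_sub_cancel_left, Complex.intCast_re, Int.floor_intCast]

/-- The matrix dual to `RX`. -/
def RDual : Matrix (ExtIdx n) (ExtIdx n) ℂ := D.etaT * D.RX * D.etaT⁻¹

/-- The nilpotent part of the operator `eulerOp`. -/
def nilOp : Module.End ℂ (LoopSpace n) :=
  Finsupp.linearCombination ℂ fun x =>
    ∑ i, D.RDual i x.1 • Finsupp.single (i, x.2 + D.muDiff i x.1) (1 : ℂ)

/-- The diagonal part of the operator `eulerOp`. -/
def diagOp : Module.End ℂ (LoopSpace n) :=
  Finsupp.linearCombination ℂ fun x =>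
    ((x.2 : ℂ) + 1 / 2 - D.muT x.1) • Finsupp.single x (1 : ℂ)

/-- The operator `z ∂_z + 1/2 + μ̃ + R̃` in the basis dual to the generators. -/
def eulerOp : Module.End ℂ (LoopSpace n) := D.diagOp + D.nilOp

/-- The operator that describes the commutators of `L_m` with the generators. -/
def wittOp (m : ℤ) : Module.End ℂ (LoopSpace n) :=
  (D.eulerOp * shiftOp 1) ^ (m + 1).toNat * shiftOp (-1)

theorem nilOp_single (x : ExtIdx n × ℤ) : D.nilOp (Finsupp.single x 1)
    = ∑ i, D.RDual i x.1 • Finsupp.single (i, x.2 + D.muDiff i x.1) (1 : ℂ) := by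
  rw [nilOp, Finsupp.linearCombination_single, one_smul]

theorem diagOp_single (x : ExtIdx n × ℤ) : D.diagOp (Finsupp.single x 1)
    = ((x.2 : ℂ) + 1 / 2 - D.muT x.1) • Finsupp.single x (1 : ℂ) := by
  rw [diagOp, Finsupp.linearCombination_single, one_smul]

theorem loopSpace_ext {A B : Module.End ℂ (LoopSpace n)}
    (h : ∀ x, A (Finsupp.single x 1) = B (Finsupp.single x 1)) : A = B := by
  refine Finsupp.lhom_ext fun x c => ?_
  rw [← mul_one c, ← smul_eq_mul, ← Finsupp.smul_single, map_smul, map_smul, h]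

theorem eulerOp_mul_shiftOp (k : ℤ) :
    D.eulerOp * shiftOp k = shiftOp k * (D.eulerOp + algebraMap ℂ _ (k : ℂ)) := by
  refine loopSpace_ext fun x => ?_
  simp only [Module.End.mul_apply, shiftOp_single, eulerOp, LinearMap.add_apply, diagOp_single,
    nilOp_single, map_add, map_sum, map_smul, Module.algebraMap_end_apply]
  rw [add_right_comm, ← add_smul]
  congr 1
  · congr 1
    push_cast
    ring
  · refine Finset.sum_congr rfl fun i _ => ?_
    congr 2
    ring_nf

/-- Each Euler factor grows by one for every unit shift moved to its left, which produces the rising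
factorial found in the kernel of L_m. -/
theorem wittOp_eq_aeval (m : ℤ) (hm : -1 ≤ m) : D.wittOp m
    = shiftOp m * Polynomial.aeval D.eulerOp (ascPochhammer ℂ (m + 1).toNat) := by
  obtain ⟨a, ha⟩ : ∃ a : ℕ, m = a - 1 := ⟨(m + 1).toNat, by omega⟩
  have e : (m + 1).toNat = a := by omega
  rw [wittOp, e, ha]
  clear e ha hm
  induction a with
  | zero => simp
  | succ a ih =>
    have e1 : (((a + 1 : ℕ) : ℤ) - 1) = a := by push_cast; ring
    rw [pow_succ', mul_assoc, ih, e1, ascPochhammer_succ_right, map_mul, map_add,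
      Polynomial.aeval_X, map_natCast, mul_assoc, ← mul_assoc (shiftOp 1), shiftOp_mul,
      show (1 : ℤ) + (a - 1) = a by ring, ← mul_assoc, eulerOp_mul_shiftOp, mul_assoc]
    congr 1
    have h1 : Commute (D.eulerOp + algebraMap ℂ _ ((a : ℤ) : ℂ))
        (Polynomial.aeval D.eulerOp (ascPochhammer ℂ a)) := by
      refine Commute.add_left ?_ (Algebra.commutes _ _)
      have := Polynomial.aeval_X (R := ℂ) D.eulerOp
      conv_lhs => rw [← this]
      exact (Commute.all Polynomial.X (ascPochhammer ℂ a)).map (Polynomial.aeval D.eulerOp)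
    rw [h1.eq]
    simp

/-- The operators `wittOp m` represent (up to a sign) the Witt algebra. -/
theorem wittOp_lie {m k : ℤ} (hm : -1 ≤ m) (hk : -1 ≤ k) (hmk : -1 ≤ m + k) :
    D.wittOp m * D.wittOp k - D.wittOp k * D.wittOp m
      = ((k - m : ℤ) : ℂ) • D.wittOp (m + k) := by
  -- The Weyl relation VY = YV + 1, a consequence of the fact that moving a unit shift to the left
  -- across the Euler operator adds 1 to the latter.
  have hW : (shiftOp (-1) : Module.End ℂ (LoopSpace n)) * (D.eulerOp * shiftOp 1)
      = (D.eulerOp * shiftOp 1) * shiftOp (-1) + 1 := by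
    rw [mul_assoc, shiftOp_mul, D.eulerOp_mul_shiftOp 1, ← mul_assoc, shiftOp_mul]
    simp [shiftOp_zero]
  have h1 := weyl_lie (A := Module.End ℂ (LoopSpace n)) hW (a := (m + 1).toNat) (b := (k + 1).toNat) (c := (m + k + 1).toNat)
    (by omega)
  rw [wittOp, wittOp, wittOp, h1]
  have h2 : (((k + 1).toNat : Module.End ℂ (LoopSpace n)) - ((m + 1).toNat : ℕ))
      = algebraMap ℂ _ ((k - m : ℤ) : ℂ) := by
    have h3 : (((k + 1).toNat : ℤ) - ((m + 1).toNat : ℤ)) = k - m := by omega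
    rw [map_intCast, ← h3]
    push_cast
    rfl
  rw [h2, ← Algebra.smul_def]

namespace IsMonodromy

variable {D} (h : D.IsMonodromy)
include h

theorem RDual_grading {i l : ExtIdx n} (hil : D.RDual i l ≠ 0) :
    ∃ s : ℤ, D.muT i = D.muT l + s := by
  rw [RDual, Matrix.mul_apply] at hil
  obtain ⟨j, -, hj⟩ := Finset.exists_ne_zero_of_sum_ne_zero hil
  have h1 := left_ne_zero_of_mul hj
  rw [Matrix.mul_apply] at h1
  obtain ⟨k, -, hk⟩ := Finset.exists_ne_zero_of_sum_ne_zero h1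
  obtain ⟨s, hs⟩ := h.RX_grading (right_ne_zero_of_mul hk)
  refine ⟨-s, ?_⟩
  rw [h.etaT_mu (left_ne_zero_of_mul hk), hs, h.etaT_inv_mu (right_ne_zero_of_mul hj)]
  push_cast
  ring

theorem RDual_pow_grading (k : ℕ) {i l : ExtIdx n} (hil : (D.RDual ^ k) i l ≠ 0) :
    ∃ s : ℤ, D.muT i = D.muT l + s := by
  induction k generalizing i l with
  | zero =>
    refine ⟨0, ?_⟩
    rw [pow_zero, Matrix.one_apply] at hil
    have : i = l := by by_contra hne; simp [hne] at hil
    simp [this]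
  | succ k ih =>
    rw [pow_succ, Matrix.mul_apply] at hil
    obtain ⟨j, -, hj⟩ := Finset.exists_ne_zero_of_sum_ne_zero hil
    obtain ⟨s, hs⟩ := ih (left_ne_zero_of_mul hj)
    obtain ⟨t, ht⟩ := h.RDual_grading (right_ne_zero_of_mul hj)
    exact ⟨s + t, by rw [hs, ht]; push_cast; ring⟩

/-- Index shifts add up along chains of nonzero matrix entries. Where the difference of eigenvalues
is not an integer the coefficient is zero, so the floor in `muDiff` does no harm. -/
theorem nilOp_pow_single (k : ℕ) (x : ExtIdx n × ℤ) : (D.nilOp ^ k) (Finsupp.single x 1)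
    = ∑ i, (D.RDual ^ k) i x.1 • Finsupp.single (i, x.2 + D.muDiff i x.1) (1 : ℂ) := by
  induction k with
  | zero =>
    rw [pow_zero, pow_zero, Finset.sum_eq_single x.1]
    · rw [D.muDiff_eq (z := 0) (by simp)]
      simp
    · intro i _ hi
      rw [Matrix.one_apply_ne hi, zero_smul]
    · simp
  | succ k ih =>
    rw [pow_succ', Module.End.mul_apply, ih, map_sum]
    simp only [map_smul, D.nilOp_single, Finset.smul_sum, smul_smul]
    rw [Finset.sum_comm]
    refine Finset.sum_congr rfl fun i _ => ?_
    rw [pow_succ', Matrix.mul_apply, Finset.sum_smul]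
    refine Finset.sum_congr rfl fun j _ => ?_
    by_cases h0 : D.RDual i j * (D.RDual ^ k) j x.1 = 0
    · rw [h0, mul_comm, h0]
      simp
    · obtain ⟨s, hs⟩ := h.RDual_grading (left_ne_zero_of_mul h0)
      obtain ⟨t, ht⟩ := h.RDual_pow_grading k (right_ne_zero_of_mul h0)
      have hst : D.muT i = D.muT x.1 + (s + t : ℤ) := by rw [hs, ht]; push_cast; ring
      rw [D.muDiff_eq hs, D.muDiff_eq ht, D.muDiff_eq hst, mul_comm]
      congr 3
      ring

theorem aeval_nilOp_single (P : Polynomial ℂ) (x : ExtIdx n × ℤ) :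
    Polynomial.aeval D.nilOp P (Finsupp.single x 1)
      = ∑ i, (Polynomial.aeval D.RDual P) i x.1 •
          Finsupp.single (i, x.2 + D.muDiff i x.1) (1 : ℂ) := by
  rw [Polynomial.aeval_eq_sum_range, Polynomial.aeval_eq_sum_range, LinearMap.sum_apply]
  simp only [LinearMap.smul_apply, h.nilOp_pow_single, Finset.smul_sum, Matrix.sum_apply,
    Finset.sum_smul, Matrix.smul_apply, smul_smul, smul_eq_mul]
  rw [Finset.sum_comm]

theorem diagOp_mul_nilOp : D.diagOp * D.nilOp = D.nilOp * D.diagOp := by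
  refine loopSpace_ext fun x => ?_
  simp only [Module.End.mul_apply, D.nilOp_single, D.diagOp_single, map_sum, map_smul,
    Finset.smul_sum, smul_smul]
  refine Finset.sum_congr rfl fun i _ => ?_
  by_cases h0 : D.RDual i x.1 = 0
  · simp [h0]
  · obtain ⟨s, hs⟩ := h.RDual_grading h0
    rw [D.muDiff_eq hs, hs]
    congr 1
    push_cast
    ring

/-- The diagonal part commutes with the nilpotent part, so along the orbit of a basis vector it acts
by the eigenvalue of that vector. -/
theorem aeval_eulerOp_single (P : Polynomial ℂ) (x : ExtIdx n × ℤ) :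
    Polynomial.aeval D.eulerOp P (Finsupp.single x 1) = Polynomial.aeval D.nilOp
      (Polynomial.taylor ((x.2 : ℂ) + 1 / 2 - D.muT x.1) P) (Finsupp.single x 1) := by
  set c := (x.2 : ℂ) + 1 / 2 - D.muT x.1 with hc
  rw [Polynomial.taylor_apply, Polynomial.aeval_comp]
  simp only [map_add, Polynomial.aeval_X, Polynomial.aeval_C]
  have hcomm : Commute D.eulerOp (D.nilOp + algebraMap ℂ _ c) := by
    refine Commute.add_right ?_ (Algebra.commutes _ _).symm
    exact Commute.add_left h.diagOp_mul_nilOp (Commute.refl _)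
  have h1 : D.eulerOp (Finsupp.single x 1)
      = (D.nilOp + algebraMap ℂ _ c) (Finsupp.single x 1) := by
    rw [eulerOp, LinearMap.add_apply, LinearMap.add_apply, D.diagOp_single, ← hc, add_comm]
    rfl
  have h2 : ∀ k : ℕ, (D.eulerOp ^ k) (Finsupp.single x 1)
      = ((D.nilOp + algebraMap ℂ _ c) ^ k) (Finsupp.single x 1) := by
    intro k
    induction k with
    | zero => simp
    | succ k ih =>
      rw [pow_succ', Module.End.mul_apply, ih, ← Module.End.mul_apply,
        (hcomm.pow_right k).eq, Module.End.mul_apply, h1, ← Module.End.mul_apply, ← pow_succ]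
  rw [Polynomial.aeval_eq_sum_range, Polynomial.aeval_eq_sum_range, LinearMap.sum_apply,
    LinearMap.sum_apply]
  exact Finset.sum_congr rfl fun k _ => by rw [LinearMap.smul_apply, LinearMap.smul_apply, h2]

theorem wittOp_single {m : ℤ} (hm : -1 ≤ m) (x : ExtIdx n × ℤ) :
    D.wittOp m (Finsupp.single x 1) = ∑ i, (Polynomial.aeval D.RDual (Polynomial.taylor
      ((x.2 : ℂ) + 1 / 2 - D.muT x.1) (ascPochhammer ℂ (m + 1).toNat))) i x.1 •
        Finsupp.single (i, x.2 + m + D.muDiff i x.1) (1 : ℂ) := by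
  rw [D.wittOp_eq_aeval m hm, Module.End.mul_apply, h.aeval_eulerOp_single, h.aeval_nilOp_single,
    map_sum]
  refine Finset.sum_congr rfl fun i _ => ?_
  rw [map_smul, shiftOp_single]
  congr 2
  ring_nf

theorem aeval_RDual_grading (P : Polynomial ℂ) {i l : ExtIdx n}
    (hil : (Polynomial.aeval D.RDual P) i l ≠ 0) : ∃ s : ℤ, D.muT i = D.muT l + s := by
  rw [Polynomial.aeval_eq_sum_range, Matrix.sum_apply] at hil
  obtain ⟨k, -, hk⟩ := Finset.exists_ne_zero_of_sum_ne_zero hil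
  rw [Matrix.smul_apply, smul_eq_mul] at hk
  exact h.RDual_pow_grading k (right_ne_zero_of_mul hk)

theorem aeval_RDual (P : Polynomial ℂ) :
    Polynomial.aeval D.RDual P = D.etaT * Polynomial.aeval D.RX P * D.etaT⁻¹ := by
  have hpow : ∀ k : ℕ, D.RDual ^ k = D.etaT * D.RX ^ k * D.etaT⁻¹ := by
    intro k
    induction k with
    | zero => simp [h.etaT_mul_inv]
    | succ k ih =>
      rw [pow_succ, ih, RDual, pow_succ]
      calc D.etaT * D.RX ^ k * D.etaT⁻¹ * (D.etaT * D.RX * D.etaT⁻¹)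
          = D.etaT * D.RX ^ k * (D.etaT⁻¹ * D.etaT) * D.RX * D.etaT⁻¹ := by
            simp only [mul_assoc]
        _ = _ := by rw [h.inv_mul_etaT, mul_one]; simp only [mul_assoc]
  rw [Polynomial.aeval_eq_sum_range, Polynomial.aeval_eq_sum_range, Finset.mul_sum,
    Finset.sum_mul]
  refine Finset.sum_congr rfl fun k _ => ?_
  rw [hpow, mul_smul_comm, smul_mul_assoc]

end IsMonodromy

/-! ### The kernel of L_m contracted with the Heisenberg form. -/

/-- The commutators of the generators: `[a_x, a_y] = omega x y`. -/
def omega (x y : ExtIdx n × ℤ) : ℂ :=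
  if x.2 + y.2 + 1 = 0 then (-1) ^ x.2 * D.etaT⁻¹ x.1 y.1 else 0

namespace IsMonodromy

variable {D} (h : D.IsMonodromy)
include h

/-- The relation between the kernel of `L_m` and the operator `wittOp m`. -/
theorem sum_ker_mul_omega {m : ℤ} (hm : -1 ≤ m) (x w : ExtIdx n × ℤ) :
    ∑ j, 2 * D.ker m x (j, -w.2 - 1) * D.omega (j, -w.2 - 1) w
      = -(D.wittOp m (Finsupp.single w 1)) x := by
  classical
  obtain ⟨i, p⟩ := x
  obtain ⟨l, r⟩ := w
  set T := Polynomial.taylor ((r : ℂ) + 1 / 2 - D.muT l) (ascPochhammer ℂ (m + 1).toNat) with hT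
  have hrhs : (D.wittOp m (Finsupp.single (l, r) 1)) (i, p)
      = if p = r + m + D.muDiff i l then (Polynomial.aeval D.RDual T) i l else 0 := by
    rw [h.wittOp_single hm, Finsupp.finsetSum_apply, Finset.sum_eq_single i]
    · simp only [Finsupp.smul_apply, Finsupp.single_apply, Prod.mk.injEq, true_and, smul_eq_mul,
        mul_ite, mul_one, mul_zero, eq_comm, ← hT]
    · intro i' _ hi'
      simp [hi']
    · simp
  have hsign : (-1 : ℂ) ^ (-r - 1 + 1) * (-1) ^ (-r - 1) = -1 := by
    rw [← zpow_add₀ (by norm_num)]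
    exact Odd.neg_one_zpow ⟨-r - 1, by ring⟩
  have hterm : ∀ j, 2 * D.ker m (i, p) (j, -r - 1) * D.omega (j, -r - 1) (l, r)
      = -(if (p : ℂ) - r - D.muT i + D.muT l = m then
        (D.etaT * Polynomial.aeval D.RX T) i j * D.etaT⁻¹ j l else 0) := by
    intro j
    have e0 : D.omega (j, -r - 1) (l, r) = (-1) ^ (-r - 1) * D.etaT⁻¹ j l :=
      if_pos (show -r - 1 + r + 1 = 0 by ring)
    rw [h.ker_eq hm, e0]
    by_cases h0 : D.etaT⁻¹ j l = 0
    · simp [h0]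
    · have hj := h.etaT_inv_mu h0
      -- Contraction forces q = -r - 1 and μ_j = -μ_l, which turns the expansion point of the kernel
      -- into the eigenvalue of the Euler operator at (l, r).
      have e1 : D.muT j + (-((-r - 1 : ℤ) : ℂ) - 1 / 2) = (r : ℂ) + 1 / 2 - D.muT l := by
        rw [hj]; push_cast; ring
      have e2 : ((p : ℂ) + ((-r - 1 : ℤ) : ℂ) + 1 - D.muT i - D.muT j = m)
          ↔ ((p : ℂ) - r - D.muT i + D.muT l = m) := by
        rw [hj]; push_cast
        constructor <;> intro h <;> linear_combination h
      by_cases hc : (p : ℂ) - r - D.muT i + D.muT l = m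
      · rw [if_pos (e2.2 hc), if_pos hc, e1, ← hT]
        linear_combination ((D.etaT * Polynomial.aeval D.RX T) i j * D.etaT⁻¹ j l) * hsign
      · rw [if_neg (e2.not.2 hc), if_neg hc]
        simp
  rw [hrhs]
  simp only [hterm]
  rw [Finset.sum_neg_distrib]
  congr 1
  have e3 : (∑ j, if (p : ℂ) - r - D.muT i + D.muT l = m then
        (D.etaT * Polynomial.aeval D.RX T) i j * D.etaT⁻¹ j l else 0)
      = if (p : ℂ) - r - D.muT i + D.muT l = m then (Polynomial.aeval D.RDual T) i l else 0 := by
    split_ifs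
    · rw [h.aeval_RDual, Matrix.mul_apply]
    · simp
  rw [e3]
  by_cases h0 : (Polynomial.aeval D.RDual T) i l = 0
  · simp [h0]
  · obtain ⟨s, hs⟩ := h.aeval_RDual_grading T h0
    rw [D.muDiff_eq hs]
    have e4 : ((p : ℂ) - r - D.muT i + D.muT l = m) ↔ p = r + m + s := by
      rw [hs]
      constructor
      · intro h
        have : ((p : ℤ) : ℂ) = ((r + m + s : ℤ) : ℂ) := by push_cast; linear_combination h
        exact_mod_cast this
      · intro h
        rw [h]; push_cast; ring
    simp only [e4]

end IsMonodromy
end SpectralData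

/-! ### Multiplications and differentiations on power series, with the coefficientwise topology. -/

open scoped MvPowerSeries.WithPiTopology

section Times

variable {n : ℕ}

theorem continuous_mulTime (s : TimeIdx n) : Continuous (mulTime s) :=
  continuous_const.mul continuous_id

theorem continuous_derTime (s : TimeIdx n) : Continuous (derTime s) := by
  refine continuous_pi fun e => ?_
  change Continuous fun f : TimeSeries n => MvPowerSeries.coeff e (MvPowerSeries.pderiv ℂ s f)
  simp only [MvPowerSeries.coeff_pderiv]
  exact (MvPowerSeries.WithPiTopology.continuous_coeff (R := ℂ) _).mul_const _

theorem mulTime_comm (s t : TimeIdx n) : mulTime s * mulTime t = mulTime t * mulTime s := by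
  ext1 f
  exact mul_left_comm (MvPowerSeries.X s) (MvPowerSeries.X t) f

theorem derTime_comm (s t : TimeIdx n) : derTime s * derTime t = derTime t * derTime s := by
  ext1 f
  change MvPowerSeries.pderiv ℂ s (MvPowerSeries.pderiv ℂ t f)
    = MvPowerSeries.pderiv ℂ t (MvPowerSeries.pderiv ℂ s f)
  by_cases hst : s = t
  · rw [hst]
  · ext e
    simp only [MvPowerSeries.coeff_pderiv, Finsupp.add_apply, Finsupp.single_eq_of_ne hst,
      Finsupp.single_eq_of_ne (Ne.symm hst), add_zero]
    rw [add_right_comm]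
    ring

open Classical in
theorem derTime_mul_mulTime (s t : TimeIdx n) :
    derTime s * mulTime t = mulTime t * derTime s + if s = t then 1 else 0 := by
  ext1 f
  have h1 : (derTime s * mulTime t) f = MvPowerSeries.X t * MvPowerSeries.pderiv ℂ s f
      + f * MvPowerSeries.pderiv ℂ s (MvPowerSeries.X t) :=
    (MvPowerSeries.pderiv ℂ s).leibniz (MvPowerSeries.X t) f
  rw [h1, LinearMap.add_apply]
  congr 1
  by_cases hst : s = t
  · rw [if_pos hst, hst, MvPowerSeries.pderiv_X_self]
    simp
  · rw [if_neg hst, MvPowerSeries.pderiv_X_of_ne (Ne.symm hst)]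
    simp

theorem coeff_mulTime_eq_zero {s : TimeIdx n} {e : TimeIdx n →₀ ℕ} (hs : e s = 0)
    (f : TimeSeries n) : MvPowerSeries.coeff e (mulTime s f) = 0 :=
  MvPowerSeries.X_dvd_iff.1 ⟨f, rfl⟩ e hs

/-- A continuous endomorphism that commutes with all multiplications and all differentiations is
a scalar. -/
theorem eq_smul_one_of_commute {A : Module.End ℂ (TimeSeries n)} (hA : Continuous A)
    (hm : ∀ s, A * mulTime s = mulTime s * A) (hd : ∀ s, A * derTime s = derTime s * A) :
    A = MvPowerSeries.coeff 0 (A 1) • (1 : Module.End ℂ (TimeSeries n)) := by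
  set c := MvPowerSeries.coeff 0 (A 1) with hc
  -- All derivatives of `A 1` vanish, so it is constant. Commutation with multiplications determines
  -- `A` on polynomials, and density with continuity does the rest.
  have h1 : A 1 = MvPowerSeries.C c := by
    apply MvPowerSeries.pderiv.ext
    · intro s
      have := LinearMap.congr_fun (hd s) 1
      rw [Module.End.mul_apply, Module.End.mul_apply] at this
      change MvPowerSeries.pderiv ℂ s (A 1) = MvPowerSeries.pderiv ℂ s (MvPowerSeries.C c)
      rw [MvPowerSeries.pderiv_C]
      refine Eq.trans this.symm ?_
      change A (MvPowerSeries.pderiv ℂ s 1) = 0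
      rw [MvPowerSeries.pderiv_one, map_zero]
    · simp [hc]
  have h2 : ∀ P : MvPolynomial (TimeIdx n) ℂ, A (P : TimeSeries n) = c • (P : TimeSeries n) := by
    intro P
    induction P using MvPolynomial.induction_on with
    | C a =>
      have e1 : ((MvPolynomial.C a : MvPolynomial (TimeIdx n) ℂ) : TimeSeries n)
          = a • (1 : TimeSeries n) := by
        rw [MvPolynomial.coe_C, MvPowerSeries.smul_eq_C_mul, mul_one]
      have e2 : MvPowerSeries.C c = c • (1 : TimeSeries n) := by
        rw [MvPowerSeries.smul_eq_C_mul, mul_one]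
      rw [e1, map_smul, h1, e2, smul_comm]
    | add P Q hP hQ => rw [MvPolynomial.coe_add, map_add, hP, hQ, smul_add]
    | mul_X P s hP =>
      have := LinearMap.congr_fun (hm s) (P : TimeSeries n)
      rw [Module.End.mul_apply, Module.End.mul_apply, hP, map_smul] at this
      rw [MvPolynomial.coe_mul, MvPolynomial.coe_X, mul_comm]
      exact this
  have h3 : (A : TimeSeries n → TimeSeries n) = fun f => c • f := by
    refine MvPowerSeries.WithPiTopology.denseRange_toMvPowerSeries.equalizer hA
      (continuous_const_smul c) ?_
    funext P
    exact h2 P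
  ext1 f
  exact congrFun h3 f

end Times

/-! ### Heisenberg generators and infinite normally ordered quadratic operators. -/

namespace SpectralData

variable {n : ℕ} (D : SpectralData n)

/-- The realization of a generator. -/
def gen (x : ExtIdx n × ℤ) : Module.End ℂ (TimeSeries n) := D.heis x.1 x.2

/-- Whether a generator is a differentiation. -/
def IsDerIdx (x : ExtIdx n × ℤ) : Prop := isDer x.1 x.2

/-- The normally ordered product of two generators. -/
def nord (x y : ExtIdx n × ℤ) : Module.End ℂ (TimeSeries n) := D.normalOrd x.2 y.2 x.1 y.1

/-- The time variable of a generator that is a multiplication. -/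
def timeOf : ExtIdx n × ℤ → TimeIdx n
  | (Sum.inl _, p) => Sum.inr (-p - 1)
  | (Sum.inr (Sum.inl α), p) => Sum.inl (α, (-p - 1).toNat)
  | (Sum.inr (Sum.inr _), p) => Sum.inr p

theorem gen_of_not_der {x : ExtIdx n × ℤ} (hx : ¬ IsDerIdx x) :
    D.gen x = ((-1 : ℂ) ^ (x.2 + 1)) • mulTime (timeOf x) := by
  obtain ⟨_ | α | _, p⟩ := x
  · rfl
  · have : ¬ 0 ≤ p := hx
    simp [gen, heis, timeOf, this]
  · exact (hx trivial).elim

theorem timeOf_injOn : Set.InjOn timeOf {x : ExtIdx n × ℤ | ¬ IsDerIdx x} := by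
  rintro ⟨_ | α | _, p⟩ hx ⟨_ | β | _, q⟩ hy hxy
  · simp only [timeOf, Sum.inr.injEq] at hxy
    rw [show p = q by omega]
  · simp [timeOf] at hxy
  · exact (hy trivial).elim
  · simp [timeOf] at hxy
  · have hp : ¬ 0 ≤ p := hx
    have hq : ¬ 0 ≤ q := hy
    simp only [timeOf, Sum.inl.injEq, Prod.mk.injEq] at hxy
    rw [hxy.1, show p = q by omega]
  · exact (hy trivial).elim
  · exact (hx trivial).elim
  · exact (hx trivial).elim
  · exact (hx trivial).elim

theorem gen_comm_of_der {x y : ExtIdx n × ℤ} (hx : IsDerIdx x) (hy : IsDerIdx y) :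
    D.gen x * D.gen y = D.gen y * D.gen x := by
  have h : ∀ x : ExtIdx n × ℤ, IsDerIdx x → ∃ c : TimeIdx n →₀ ℂ,
      D.gen x = ∑ s ∈ c.support, c s • derTime s := by
    rintro ⟨_ | α | _, p⟩ hx
    · exact hx.elim
    · have hp : 0 ≤ p := hx
      refine ⟨∑ β, Finsupp.single (Sum.inl (β, p.toNat)) (D.η⁻¹ α β), ?_⟩
      have : D.gen (Sum.inr (Sum.inl α), p)
          = ∑ β, D.η⁻¹ α β • derTime (Sum.inl (β, p.toNat)) := by simp [gen, heis, hp]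
      rw [this]
      have h2 := map_sum (Finsupp.linearCombination ℂ (derTime (n := n)))
        (fun β => Finsupp.single (Sum.inl (β, p.toNat)) (D.η⁻¹ α β)) Finset.univ
      rw [Finsupp.linearCombination_apply, Finsupp.sum] at h2
      rw [h2]
      simp
    · refine ⟨Finsupp.single (Sum.inr p) 1, ?_⟩
      have h2 := Finsupp.linearCombination_single ℂ (v := derTime (n := n)) 1 (Sum.inr p)
      rw [Finsupp.linearCombination_apply, Finsupp.sum] at h2
      rw [h2, one_smul]
      rfl
  obtain ⟨c, hc⟩ := h x hx
  obtain ⟨c', hc'⟩ := h y hy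
  rw [hc, hc', Finset.sum_mul_sum, Finset.sum_mul_sum, Finset.sum_comm]
  refine Finset.sum_congr rfl fun t _ => Finset.sum_congr rfl fun s _ => ?_
  rw [smul_mul_smul_comm, smul_mul_smul_comm, derTime_comm, mul_comm (c s)]

theorem gen_comm_of_not_der {x y : ExtIdx n × ℤ} (hx : ¬ IsDerIdx x) (hy : ¬ IsDerIdx y) :
    D.gen x * D.gen y = D.gen y * D.gen x := by
  rw [D.gen_of_not_der hx, D.gen_of_not_der hy, smul_mul_smul_comm, smul_mul_smul_comm,
    mulTime_comm, mul_comm ((-1 : ℂ) ^ (x.2 + 1))]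

theorem continuous_gen (x : ExtIdx n × ℤ) : Continuous (D.gen x) := by
  obtain ⟨_ | α | _, p⟩ := x
  · exact continuous_const.smul (continuous_mulTime _)
  · by_cases hp : 0 ≤ p
    · have : (D.gen (Sum.inr (Sum.inl α), p) : TimeSeries n → TimeSeries n)
          = fun f => ∑ β, D.η⁻¹ α β • derTime (Sum.inl (β, p.toNat)) f := by
        funext f
        simp [gen, heis, hp]
      rw [this]
      exact continuous_finsetSum _ fun β _ =>
        (continuous_const_smul (D.η⁻¹ α β)).comp (continuous_derTime _)
    · rw [D.gen_of_not_der (show ¬ IsDerIdx (Sum.inr (Sum.inl α), p) from hp)]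
      exact continuous_const.smul (continuous_mulTime _)
  · exact continuous_derTime _

open Classical in
theorem nord_eq (x y : ExtIdx n × ℤ) : D.nord x y =
    if IsDerIdx x ∧ ¬ IsDerIdx y then D.gen y * D.gen x else D.gen x * D.gen y := rfl

theorem continuous_nord (x y : ExtIdx n × ℤ) : Continuous (D.nord x y) := by
  rw [nord_eq]
  split_ifs
  · exact (D.continuous_gen y).comp (D.continuous_gen x)
  · exact (D.continuous_gen x).comp (D.continuous_gen y)

/-- Normal order leaves the multiplication outermost, so the image is divisible by its variable.
This makes the coefficients finite sums. -/
theorem coeff_nord_left {x y : ExtIdx n × ℤ} (hx : ¬ IsDerIdx x) {e : TimeIdx n →₀ ℕ}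
    (he : e (timeOf x) = 0) (f : TimeSeries n) : MvPowerSeries.coeff e (D.nord x y f) = 0 := by
  rw [nord_eq, if_neg (fun h => hx h.1), D.gen_of_not_der hx, smul_mul_assoc,
    LinearMap.smul_apply, map_smul, Module.End.mul_apply, coeff_mulTime_eq_zero he, smul_zero]

theorem coeff_nord_right {x y : ExtIdx n × ℤ} (hy : ¬ IsDerIdx y) {e : TimeIdx n →₀ ℕ}
    (he : e (timeOf y) = 0) (f : TimeSeries n) : MvPowerSeries.coeff e (D.nord x y f) = 0 := by
  have : D.nord x y = D.gen y * D.gen x := by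
    rw [nord_eq]
    split_ifs with h
    · rfl
    · exact D.gen_comm_of_not_der (fun hx => h ⟨hx, hy⟩) hy
  rw [this, D.gen_of_not_der hy, smul_mul_assoc, LinearMap.smul_apply, map_smul,
    Module.End.mul_apply, coeff_mulTime_eq_zero he, smul_zero]

/-- The finiteness conditions under which a kernel defines a normally ordered quadratic
operator. -/
structure IsLocal (b : ExtIdx n × ℤ → ExtIdx n × ℤ → ℂ) : Prop where
  row : ∀ x, {y | b x y ≠ 0}.Finite
  col : ∀ y, {x | b x y ≠ 0}.Finite
  der : {z : (ExtIdx n × ℤ) × (ExtIdx n × ℤ) |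
    b z.1 z.2 ≠ 0 ∧ IsDerIdx z.1 ∧ IsDerIdx z.2}.Finite

/-- The pairs of generators that contribute to the coefficient of the monomial `e`. -/
def activePairs (b : ExtIdx n × ℤ → ExtIdx n × ℤ → ℂ) (e : TimeIdx n →₀ ℕ) :
    Set ((ExtIdx n × ℤ) × (ExtIdx n × ℤ)) :=
  {z | b z.1 z.2 ≠ 0 ∧ ∃ f, MvPowerSeries.coeff e (D.nord z.1 z.2 f) ≠ 0}

variable {b : ExtIdx n × ℤ → ExtIdx n × ℤ → ℂ}

/-- A pair containing a multiplication needs its variable to occur in `e`, after which rows and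
columns are finite; pairs of differentiations are finite by assumption. -/
theorem finite_activePairs (hb : IsLocal b) (e : TimeIdx n →₀ ℕ) :
    (D.activePairs b e).Finite := by
  set K : Set (ExtIdx n × ℤ) := {x | ¬ IsDerIdx x ∧ timeOf x ∈ e.support} with hK
  have hKfin : K.Finite := Set.Finite.of_finite_image (f := timeOf)
    (e.support.finite_toSet.subset (by rintro _ ⟨x, hx, rfl⟩; exact hx.2))
    (timeOf_injOn.mono fun x hx => hx.1)
  have h1 : (⋃ x ∈ K, Prod.mk x '' {y | b x y ≠ 0}).Finite :=
    hKfin.biUnion fun x _ => (hb.row x).image _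
  have h2 : (⋃ y ∈ K, (fun x => (x, y)) '' {x | b x y ≠ 0}).Finite :=
    hKfin.biUnion fun y _ => (hb.col y).image _
  refine ((h1.union h2).union hb.der).subset ?_
  rintro ⟨x, y⟩ ⟨hxy, f, hf⟩
  by_cases hx : IsDerIdx x
  · by_cases hy : IsDerIdx y
    · exact Or.inr ⟨hxy, hx, hy⟩
    · refine Or.inl (Or.inr (Set.mem_biUnion (x := y) ⟨hy, ?_⟩ ⟨x, hxy, rfl⟩))
      rw [Finsupp.mem_support_iff]
      exact fun h => hf (D.coeff_nord_right hy h f)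
  · refine Or.inl (Or.inl (Set.mem_biUnion (x := x) ⟨hx, ?_⟩ ⟨y, hxy, rfl⟩))
    rw [Finsupp.mem_support_iff]
    exact fun h => hf (D.coeff_nord_left hx h f)

theorem support_subset_activePairs (e : TimeIdx n →₀ ℕ) (f : TimeSeries n) :
    Function.support (fun z : (ExtIdx n × ℤ) × (ExtIdx n × ℤ) =>
      b z.1 z.2 * MvPowerSeries.coeff e (D.nord z.1 z.2 f)) ⊆ D.activePairs b e := fun _ hz =>
  ⟨left_ne_zero_of_mul hz, f, right_ne_zero_of_mul hz⟩

theorem finsum_eq_sum_activePairs (hb : IsLocal b) (e : TimeIdx n →₀ ℕ) (f : TimeSeries n) :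
    ∑ᶠ z : (ExtIdx n × ℤ) × (ExtIdx n × ℤ),
      b z.1 z.2 * MvPowerSeries.coeff e (D.nord z.1 z.2 f)
    = ∑ z ∈ (D.finite_activePairs hb e).toFinset,
      b z.1 z.2 * MvPowerSeries.coeff e (D.nord z.1 z.2 f) := by
  apply finsum_eq_sum_of_support_subset
  rw [Set.Finite.coe_toFinset]
  exact D.support_subset_activePairs e f

/-- The operator `∑ b x y :a_x a_y:`. -/
def quadOp (hb : IsLocal b) : Module.End ℂ (TimeSeries n) where
  toFun f := fun e => ∑ᶠ z : (ExtIdx n × ℤ) × (ExtIdx n × ℤ),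
    b z.1 z.2 * MvPowerSeries.coeff e (D.nord z.1 z.2 f)
  map_add' f g := by
    funext e
    refine (D.finsum_eq_sum_activePairs hb e (f + g)).trans (Eq.trans ?_ (congrArg₂ (· + ·)
      (D.finsum_eq_sum_activePairs hb e f) (D.finsum_eq_sum_activePairs hb e g)).symm)
    rw [← Finset.sum_add_distrib]
    exact Finset.sum_congr rfl fun z _ => by rw [map_add, map_add, mul_add]
  map_smul' c f := by
    funext e
    refine (D.finsum_eq_sum_activePairs hb e (c • f)).trans (Eq.trans ?_
      (congrArg (c * ·) (D.finsum_eq_sum_activePairs hb e f)).symm)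
    rw [Finset.mul_sum]
    exact Finset.sum_congr rfl fun z _ => by rw [map_smul, map_smul, smul_eq_mul]; ring

theorem coeff_quadOp (hb : IsLocal b) (e : TimeIdx n →₀ ℕ) (f : TimeSeries n) :
    MvPowerSeries.coeff e (D.quadOp hb f) = ∑ᶠ z : (ExtIdx n × ℤ) × (ExtIdx n × ℤ),
      b z.1 z.2 * MvPowerSeries.coeff e (D.nord z.1 z.2 f) := rfl

theorem continuous_quadOp (hb : IsLocal b) : Continuous (D.quadOp hb) := by
  refine continuous_pi fun e => ?_
  change Continuous fun f => MvPowerSeries.coeff e (D.quadOp hb f)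
  simp only [D.coeff_quadOp, D.finsum_eq_sum_activePairs hb]
  exact continuous_finsetSum _ fun z _ => continuous_const.mul
    ((MvPowerSeries.WithPiTopology.continuous_coeff (R := ℂ) _).comp (D.continuous_nord _ _))

/-- Convergence allows the commutator with a generator, which is continuous, to be computed term by
term. -/
theorem hasSum_quadOp (hb : IsLocal b) (f : TimeSeries n) :
    HasSum (fun z : (ExtIdx n × ℤ) × (ExtIdx n × ℤ) => b z.1 z.2 • D.nord z.1 z.2 f)
      (D.quadOp hb f) := by
  rw [MvPowerSeries.WithPiTopology.hasSum_iff_hasSum_coeff]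
  intro e
  rw [D.coeff_quadOp, D.finsum_eq_sum_activePairs hb]
  simp only [map_smul, smul_eq_mul]
  apply hasSum_sum_of_ne_finset_zero
  intro z hz
  by_contra h0
  apply hz
  rw [Set.Finite.mem_toFinset]
  exact D.support_subset_activePairs e f h0

/-- The linear combinations of the generators. -/
def genLin : LoopSpace n →ₗ[ℂ] Module.End ℂ (TimeSeries n) := Finsupp.linearCombination ℂ D.gen

theorem genLin_single (x : ExtIdx n × ℤ) : D.genLin (Finsupp.single x 1) = D.gen x := by
  rw [genLin, Finsupp.linearCombination_single, one_smul]

namespace IsMonodromy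

variable {D} (h : D.IsMonodromy)
include h

theorem omega_antisymm (x y : ExtIdx n × ℤ) : D.omega x y = -D.omega y x := by
  have h2 : D.etaT⁻¹ x.1 y.1 = D.etaT⁻¹ y.1 x.1 :=
    congrFun (congrFun h.etaT_inv_transpose y.1) x.1
  by_cases hxy : x.2 + y.2 + 1 = 0
  · have e1 : x.2 = -y.2 - 1 := by omega
    have e2 : (-1 : ℂ) ^ x.2 = -(-1) ^ y.2 := by
      rw [neg_one_zpow_congr (a := x.2) (b := y.2 + 1) ⟨0, by omega⟩, zpow_add₀ (by norm_num)]
      simp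
    rw [omega, omega, if_pos hxy, if_pos (by omega), h2, e2]
    ring
  · rw [omega, omega, if_neg hxy, if_neg (by omega), neg_zero]

theorem gen_lie_of_der {x y : ExtIdx n × ℤ} (hx : IsDerIdx x) (hy : ¬ IsDerIdx y) :
    D.gen x * D.gen y = D.gen y * D.gen x + D.omega x y • 1 := by
  classical
  rw [D.gen_of_not_der hy, mul_smul_comm, smul_mul_assoc]
  obtain ⟨_ | α | _, p⟩ := x
  · exact hx.elim
  · have hp : 0 ≤ p := hx
    have e1 : D.gen (Sum.inr (Sum.inl α), p)
          = ∑ β, D.η⁻¹ α β • derTime (Sum.inl (β, p.toNat)) := by simp [gen, heis, hp]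
    have e2 : D.gen (Sum.inr (Sum.inl α), p) * mulTime (timeOf y)
        = mulTime (timeOf y) * D.gen (Sum.inr (Sum.inl α), p)
          + (∑ β, D.η⁻¹ α β * if Sum.inl (β, p.toNat) = timeOf y then 1 else 0) • 1 := by
      rw [e1, Finset.sum_mul, Finset.mul_sum, Finset.sum_smul, ← Finset.sum_add_distrib]
      refine Finset.sum_congr rfl fun β _ => ?_
      rw [smul_mul_assoc, derTime_mul_mulTime, mul_smul_comm, smul_add, mul_smul]
      split_ifs <;> simp
    rw [e2, smul_add, smul_smul]
    congr 2
    rw [omega, h.etaT_inv]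
    obtain ⟨_ | β | _, q⟩ := y
    · simp [timeOf, etaInv]
    · have hq : ¬ 0 ≤ q := hy
      have e3 : ∀ γ, ((Sum.inl (γ, p.toNat) : TimeIdx n) = timeOf (Sum.inr (Sum.inl β), q))
          ↔ (γ = β ∧ p + q + 1 = 0) := by
        intro γ
        simp only [timeOf, Sum.inl.injEq, Prod.mk.injEq]
        refine and_congr_right fun _ => ?_
        omega
      simp only [e3]
      by_cases hpq : p + q + 1 = 0
      · have e4 : (-1 : ℂ) ^ (q + 1) = (-1) ^ p := neg_one_zpow_congr ⟨0, by omega⟩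
        simp [hpq, etaInv, e4]
      · simp [hpq]
    · exact (hy trivial).elim
  · have e1 : D.gen (Sum.inr (Sum.inr ()), p) = derTime (Sum.inr p) := rfl
    rw [e1, derTime_mul_mulTime, smul_add, omega, h.etaT_inv]
    congr 1
    obtain ⟨_ | β | _, q⟩ := y
    · have e3 : ((Sum.inr p : TimeIdx n) = timeOf (Sum.inl (), q)) ↔ p + q + 1 = 0 := by
        simp only [timeOf, Sum.inr.injEq]
        omega
      simp only [e3]
      by_cases hpq : p + q + 1 = 0
      · have e4 : (-1 : ℂ) ^ (q + 1) = (-1) ^ p := neg_one_zpow_congr ⟨0, by omega⟩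
        simp [hpq, etaInv, e4]
      · simp [hpq]
    · simp [timeOf, etaInv]
    · exact (hy trivial).elim

theorem omega_eq_zero_of_iff {x y : ExtIdx n × ℤ} (hxy : IsDerIdx x ↔ IsDerIdx y) :
    D.omega x y = 0 := by
  rw [omega, h.etaT_inv]
  obtain ⟨_ | α | _, p⟩ := x <;> obtain ⟨_ | β | _, q⟩ := y <;>
    simp [IsDerIdx, isDer, etaInv] at hxy ⊢
  intro _
  omega

/-- The generators satisfy the relations of a Heisenberg algebra. -/
theorem gen_lie (x y : ExtIdx n × ℤ) :
    D.gen x * D.gen y = D.gen y * D.gen x + D.omega x y • 1 := by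
  by_cases hx : IsDerIdx x <;> by_cases hy : IsDerIdx y
  · rw [h.omega_eq_zero_of_iff (by simp [hx, hy]), zero_smul, add_zero, D.gen_comm_of_der hx hy]
  · exact h.gen_lie_of_der hx hy
  · rw [h.gen_lie_of_der hy hx, h.omega_antisymm x y]
    module
  · rw [h.omega_eq_zero_of_iff (by simp [hx, hy]), zero_smul, add_zero,
      D.gen_comm_of_not_der hx hy]

/-- The commutator of a product of two generators with a third is symmetric in the two, so normal
ordering does not affect it. -/
theorem nord_lie (x y w : ExtIdx n × ℤ) : D.nord x y * D.gen w - D.gen w * D.nord x y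
    = D.omega y w • D.gen x + D.omega x w • D.gen y := by
  have key : ∀ x y : ExtIdx n × ℤ, (D.gen x * D.gen y) * D.gen w - D.gen w * (D.gen x * D.gen y)
      = D.omega y w • D.gen x + D.omega x w • D.gen y := by
    intro x y
    rw [mul_assoc, h.gen_lie y w, mul_add, ← mul_assoc, h.gen_lie x w, add_mul, mul_smul_comm,
      mul_one, smul_mul_assoc, one_mul, mul_assoc]
    abel
  rw [nord_eq]
  split_ifs
  · rw [key, add_comm]
  · rw [key]

/-- The commutator of a quadratic operator with a generator. -/
theorem quadOp_lie (hb : IsLocal b) (w : ExtIdx n × ℤ) (v : LoopSpace n)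
    (hv : ∀ x, v x = ∑ j, (b x (j, -w.2 - 1) + b (j, -w.2 - 1) x) * D.omega (j, -w.2 - 1) w) :
    D.quadOp hb * D.gen w - D.gen w * D.quadOp hb = D.genLin v := by
  classical
  -- Only the generators in `Y` can fail to commute with a_w, so only finitely many pairs
  -- contribute.
  set Y : Finset (ExtIdx n × ℤ) := Finset.univ.image fun j => (j, -w.2 - 1) with hY
  have hYmem : ∀ y, D.omega y w ≠ 0 → y ∈ Y := by
    intro y hy
    rw [omega] at hy
    have h1 : y.2 + w.2 + 1 = 0 := by by_contra hne; simp [hne] at hy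
    rw [hY, Finset.mem_image]
    exact ⟨y.1, Finset.mem_univ _, Prod.ext rfl (by simp; omega)⟩
  have hSfin : (⋃ y ∈ Y, ({x | b x y ≠ 0} ∪ {x | b y x ≠ 0})).Finite :=
    Y.finite_toSet.biUnion fun y _ => (hb.col y).union (hb.row y)
  set S := hSfin.toFinset with hS
  have hSmem : ∀ x y, y ∈ Y → (b x y ≠ 0 ∨ b y x ≠ 0) → x ∈ S := by
    intro x y hy hxy
    rw [hS, Set.Finite.mem_toFinset]
    exact Set.mem_biUnion (x := y) hy hxy
  ext1 f
  have h1 := D.hasSum_quadOp hb (D.gen w f)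
  have h2 := (D.hasSum_quadOp hb f).map (D.gen w) (D.continuous_gen w)
  have h3 := h1.sub h2
  have h4 : (fun z : (ExtIdx n × ℤ) × (ExtIdx n × ℤ) => b z.1 z.2 • D.nord z.1 z.2 (D.gen w f)
      - ((D.gen w) ∘ fun z : (ExtIdx n × ℤ) × (ExtIdx n × ℤ) =>
          b z.1 z.2 • D.nord z.1 z.2 f) z)
      = fun z => (b z.1 z.2 * D.omega z.2 w) • D.gen z.1 f
        + (b z.1 z.2 * D.omega z.1 w) • D.gen z.2 f := by
    funext z
    have := LinearMap.congr_fun (h.nord_lie z.1 z.2 w) f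
    simp only [LinearMap.sub_apply, Module.End.mul_apply, LinearMap.add_apply,
      LinearMap.smul_apply] at this
    rw [Function.comp_apply, map_smul, ← smul_sub, this, smul_add, smul_smul, smul_smul]
  rw [h4] at h3
  have h5 : HasSum (fun z : (ExtIdx n × ℤ) × (ExtIdx n × ℤ) =>
      (b z.1 z.2 * D.omega z.2 w) • D.gen z.1 f)
      (∑ z ∈ S ×ˢ Y, (b z.1 z.2 * D.omega z.2 w) • D.gen z.1 f) := by
    apply hasSum_sum_of_ne_finset_zero
    intro z hz
    by_contra h0
    have h6 := left_ne_zero_of_smul h0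
    have hy := hYmem _ (right_ne_zero_of_mul h6)
    exact hz (Finset.mk_mem_product (hSmem _ _ hy (Or.inl (left_ne_zero_of_mul h6))) hy)
  have h5' : HasSum (fun z : (ExtIdx n × ℤ) × (ExtIdx n × ℤ) =>
      (b z.1 z.2 * D.omega z.1 w) • D.gen z.2 f)
      (∑ z ∈ Y ×ˢ S, (b z.1 z.2 * D.omega z.1 w) • D.gen z.2 f) := by
    apply hasSum_sum_of_ne_finset_zero
    intro z hz
    by_contra h0
    have h6 := left_ne_zero_of_smul h0
    have hy := hYmem _ (right_ne_zero_of_mul h6)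
    exact hz (Finset.mk_mem_product hy (hSmem _ _ hy (Or.inr (left_ne_zero_of_mul h6))))
  have h7 := h3.unique (h5.add h5')
  rw [LinearMap.sub_apply, Module.End.mul_apply, Module.End.mul_apply, h7, Finset.sum_product,
    Finset.sum_product_right, ← Finset.sum_add_distrib]
  have h8 : ∀ x, v x = ∑ y ∈ Y, (b x y + b y x) * D.omega y w := by
    intro x
    rw [hv, hY, Finset.sum_image]
    intro i _ j _ hij
    exact congrArg Prod.fst hij
  have h9 : v.support ⊆ S := by
    intro x hx
    rw [Finsupp.mem_support_iff, h8] at hx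
    obtain ⟨y, hy, hxy⟩ := Finset.exists_ne_zero_of_sum_ne_zero hx
    refine hSmem x y hy ?_
    by_contra! hc
    rw [hc.1, hc.2] at hxy
    simp at hxy
  rw [genLin, Finsupp.linearCombination_apply, Finsupp.sum_of_support_subset _ h9 _ (by simp),
    LinearMap.sum_apply]
  refine Finset.sum_congr rfl fun x _ => ?_
  rw [LinearMap.smul_apply, h8, Finset.sum_smul, ← Finset.sum_add_distrib]
  refine Finset.sum_congr rfl fun y _ => ?_
  rw [← add_smul, add_mul]

end IsMonodromy
end SpectralData

/-! ### Finiteness for the kernels and construction of L_m. -/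

namespace SpectralData

variable {n : ℕ} (D : SpectralData n)

variable {D} in
-- The grading determines one integer index from the other, which gives finite rows and columns. For
-- differentiations with indices 1, …, n both integers are nonnegative with a prescribed sum; the
-- index n+1 has to be excluded because there the integer is unbounded below.
theorem isLocal_of_grading {b : ExtIdx n × ℤ → ExtIdx n × ℤ → ℂ} {m : ℤ}
    (hgr : ∀ x y, b x y ≠ 0 → (x.2 : ℂ) + y.2 + 1 - D.muT x.1 - D.muT y.1 = m)
    (hlast : ∀ x y, IsDerIdx x → IsDerIdx y → b x y ≠ 0 →
      x.1 ≠ ExtIdx.last ∧ y.1 ≠ ExtIdx.last) : IsLocal b where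
  row x := by
    refine Set.Finite.of_finite_image (f := Prod.fst) (Set.toFinite _) ?_
    rintro ⟨i, p⟩ hp ⟨j, q⟩ hq (rfl : i = j)
    have h1 := hgr _ _ hp
    have h2 := hgr _ _ hq
    have h3 : (p : ℂ) = q := by linear_combination h1 - h2
    rw [Int.cast_injective h3]
  col y := by
    refine Set.Finite.of_finite_image (f := Prod.fst) (Set.toFinite _) ?_
    rintro ⟨i, p⟩ hp ⟨j, q⟩ hq (rfl : i = j)
    have h1 := hgr _ _ hp
    have h2 := hgr _ _ hq
    have h3 : (p : ℂ) = q := by linear_combination h1 - h2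
    rw [Int.cast_injective h3]
  der := by
    set N : ExtIdx n → ExtIdx n → ℤ := fun i j => ⌊(D.muT i + D.muT j + m - 1).re⌋ with hN
    have hfin : (⋃ i : ExtIdx n, ⋃ j : ExtIdx n,
        (fun z : ℤ × ℤ => ((i, z.1), (j, z.2))) ''
          (Set.Icc 0 (N i j) ×ˢ Set.Icc 0 (N i j))).Finite :=
      Set.finite_iUnion fun i => Set.finite_iUnion fun j =>
        ((Set.finite_Icc _ _).prod (Set.finite_Icc _ _)).image _
    refine hfin.subset ?_
    rintro ⟨⟨i, p⟩, ⟨j, q⟩⟩ ⟨hb, hx, hy⟩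
    obtain ⟨hx', hy'⟩ := hlast _ _ hx hy hb
    have hpos : ∀ (i : ExtIdx n) (p : ℤ), IsDerIdx (i, p) → i ≠ ExtIdx.last → 0 ≤ p := by
      rintro (_ | α | _) p hd hne
      · exact hd.elim
      · exact hd
      · exact (hne rfl).elim
    have hp := hpos i p hx hx'
    have hq := hpos j q hy hy'
    have h1 : D.muT i + D.muT j + m - 1 = ((p + q : ℤ) : ℂ) := by
      push_cast
      linear_combination -hgr _ _ hb
    have h2 : N i j = p + q := by
      simp only [hN]
      rw [h1, Complex.intCast_re, Int.floor_intCast]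
    refine Set.mem_iUnion.2 ⟨i, Set.mem_iUnion.2 ⟨j, (p, q), ⟨⟨hp, ?_⟩, hq, ?_⟩, rfl⟩⟩ <;>
      simp only [h2] <;> omega

theorem extraKer_eq_zero_of_der (m : ℤ) {x y : ExtIdx n × ℤ} (hx : IsDerIdx x) :
    D.extraKer m x y = 0 := by
  rw [extraKer, if_neg]
  rintro ⟨h1, -⟩
  obtain ⟨i, p⟩ := x
  simp only at h1
  subst h1
  exact hx

theorem aeval_RX_zero (P : Polynomial ℂ) {j : ExtIdx n} (hj : j ≠ ExtIdx.zero) :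
    Polynomial.aeval D.RX P ExtIdx.zero j = 0 := by
  induction P using Polynomial.induction_on' with
  | add P Q hP hQ => rw [map_add, Matrix.add_apply, hP, hQ, add_zero]
  | monomial k a =>
    rw [Polynomial.aeval_monomial, ← Algebra.smul_def, Matrix.smul_apply]
    cases k with
    | zero => rw [pow_zero, Matrix.one_apply_ne (Ne.symm hj), smul_zero]
    | succ k =>
      rw [pow_succ', Matrix.mul_apply]
      simp [D.RX_zero]

namespace IsMonodromy

variable {D} (h : D.IsMonodromy)
include h

theorem ker_grading {m : ℤ} (hm : -1 ≤ m) (x y : ExtIdx n × ℤ) (hxy : D.ker m x y ≠ 0) :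
    (x.2 : ℂ) + y.2 + 1 - D.muT x.1 - D.muT y.1 = m := by
  by_contra hne
  exact hxy (by rw [h.ker_eq hm, if_neg hne])

theorem limKer_grading {m : ℤ} (hm : -1 ≤ m) (x y : ExtIdx n × ℤ) (hxy : D.limKer m x y ≠ 0) :
    (x.2 : ℂ) + y.2 + 1 - D.muT x.1 - D.muT y.1 = m := by
  by_contra hne
  exact hxy (by rw [limKer, h.limCoeff_eq hm, limFormula, if_neg hne])

omit h in
theorem extraKer_grading {m : ℤ} (hm : -1 ≤ m) (x y : ExtIdx n × ℤ)
    (hxy : D.extraKer m x y ≠ 0) : (x.2 : ℂ) + y.2 + 1 - D.muT x.1 - D.muT y.1 = m := by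
  by_contra hne
  exact hxy (by rw [D.extraKer_eq hm, if_neg hne])

/-- Row n+1 of η̃A is row 0 of A. For A a polynomial in `RX` this row is concentrated in column 0,
whose generators are multiplications. -/
theorem ker_last {m : ℤ} (hm : -1 ≤ m) (x y : ExtIdx n × ℤ) (hx : IsDerIdx x) (hy : IsDerIdx y)
    (hxy : D.ker m x y ≠ 0) : x.1 ≠ ExtIdx.last ∧ y.1 ≠ ExtIdx.last := by
  have key : ∀ x y : ExtIdx n × ℤ, IsDerIdx y → x.1 = ExtIdx.last → D.ker m x y = 0 := by
    rintro ⟨i, p⟩ ⟨j, q⟩ hy rfl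
    have hj : j ≠ ExtIdx.zero := by
      rintro rfl
      exact hy
    have h1 : ∀ A : Matrix (ExtIdx n) (ExtIdx n) ℂ,
        (D.etaT * A) ExtIdx.last j = A ExtIdx.zero j := by
      intro A
      simp [Matrix.mul_apply, etaT, Fintype.sum_sum_type]
    rw [h.ker_eq hm, h1, D.aeval_RX_zero _ hj]
    simp
  exact ⟨fun h0 => hxy (key x y hy h0), fun h0 => hxy (by rw [h.ker_comm hm, key y x hx h0])⟩

theorem isLocal_ker {m : ℤ} (hm : -1 ≤ m) : IsLocal (D.ker m) :=
  isLocal_of_grading (h.ker_grading hm) (h.ker_last hm)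

theorem isLocal_limKer {m : ℤ} (hm : -1 ≤ m) : IsLocal (D.limKer m) := by
  refine isLocal_of_grading (h.limKer_grading hm) fun x y hx hy hxy => h.ker_last hm x y hx hy ?_
  rwa [ker, D.extraKer_eq_zero_of_der m hx, add_zero]

omit h in
theorem isLocal_extraKer {m : ℤ} (hm : -1 ≤ m) : IsLocal (D.extraKer m) :=
  isLocal_of_grading (extraKer_grading hm) fun _ _ hx _ hxy =>
    (hxy (D.extraKer_eq_zero_of_der m hx)).elim

end IsMonodromy

/-- The reindexing of the terms of the quadratic part of `L_m`. -/
def quadEquiv : ℤ × ℤ × ExtIdx n × ExtIdx n ≃ (ExtIdx n × ℤ) × (ExtIdx n × ℤ) where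
  toFun x := ((x.2.2.1, x.1), (x.2.2.2, x.2.1))
  invFun z := (z.1.2, z.2.2, z.1.1, z.2.1)
  left_inv _ := rfl
  right_inv _ := rfl

/-- The pair of generators that corresponds to the times `t^{0,p}`, `t^{0,q}`. -/
def zeroPair (x : ℤ × ℤ) : (ExtIdx n × ℤ) × (ExtIdx n × ℤ) :=
  ((ExtIdx.zero, -x.1 - 1), (ExtIdx.zero, -x.2 - 1))

theorem zeroPair_injective : Function.Injective (zeroPair (n := n)) := by
  rintro ⟨p, q⟩ ⟨p', q'⟩ hpq
  simp only [zeroPair, Prod.mk.injEq, true_and] at hpq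
  rw [show p = p' by omega, show q = q' by omega]

theorem quadTerm_eq (m : ℤ) (f : TimeSeries n) (e : TimeIdx n →₀ ℕ)
    (x : ℤ × ℤ × ExtIdx n × ExtIdx n) : D.quadTerm m f e x
      = D.limKer m (quadEquiv x).1 (quadEquiv x).2
        * MvPowerSeries.coeff e (D.nord (quadEquiv x).1 (quadEquiv x).2 f) := rfl

theorem extraTerm_eq (m : ℤ) (f : TimeSeries n) (e : TimeIdx n →₀ ℕ) (x : ℤ × ℤ) :
    D.extraTerm m f e x = D.extraKer m (zeroPair x).1 (zeroPair x).2
      * MvPowerSeries.coeff e (D.nord (zeroPair x).1 (zeroPair x).2 f) := by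
  obtain ⟨p, q⟩ := x
  have h1 : D.nord (zeroPair (p, q)).1 (zeroPair (p, q)).2
      = ((-1 : ℂ) ^ (p + q)) • (mulTime (Sum.inr p) * mulTime (Sum.inr q)) := by
    have hg : ∀ r : ℤ, D.gen (ExtIdx.zero, -r - 1) = ((-1 : ℂ) ^ r) • mulTime (Sum.inr r) := by
      intro r
      rw [D.gen_of_not_der (show ¬ IsDerIdx (ExtIdx.zero, -r - 1) from id)]
      congr 1
      · exact neg_one_zpow_congr ⟨0, by simp⟩
      · simp [timeOf]
    rw [nord_eq, if_neg (fun hd => hd.1), zeroPair, hg, hg, smul_mul_smul_comm,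
      zpow_add₀ (by norm_num)]
  have h2 : (-1 : ℂ) ^ (-p - 1 + (-q - 1)) * (-1) ^ (p + q) = 1 := by
    rw [← zpow_add₀ (by norm_num)]
    exact Even.neg_one_zpow ⟨-1, by ring⟩
  rw [h1, extraKer, if_pos ⟨rfl, rfl⟩, LinearMap.smul_apply, map_smul, smul_eq_mul, extraTerm,
    Module.End.mul_apply]
  simp only [zeroPair]
  rw [show - (-p - 1) - 1 = p by ring, show - (-q - 1) - 1 = q by ring]
  linear_combination (-(D.extraCoeff m p q * (MvPowerSeries.coeff e)
    (mulTime (Sum.inr p) (mulTime (Sum.inr q) f)))) * h2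

theorem finsum_extraTerm (m : ℤ) (f : TimeSeries n) (e : TimeIdx n →₀ ℕ) :
    ∑ᶠ x, D.extraTerm m f e x = ∑ᶠ z : (ExtIdx n × ℤ) × (ExtIdx n × ℤ),
      D.extraKer m z.1 z.2 * MvPowerSeries.coeff e (D.nord z.1 z.2 f) := by
  rw [finsum_congr fun x => D.extraTerm_eq m f e x,
    ← finsum_mem_range (f := fun z : (ExtIdx n × ℤ) × (ExtIdx n × ℤ) =>
      D.extraKer m z.1 z.2 * MvPowerSeries.coeff e (D.nord z.1 z.2 f)) zeroPair_injective,
    finsum_mem_def]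
  congr 1
  rw [Set.indicator_eq_self]
  rintro ⟨⟨i, p⟩, ⟨j, q⟩⟩ hz
  have hz' := left_ne_zero_of_mul hz
  rw [extraKer] at hz'
  obtain ⟨⟨rfl, rfl⟩, -⟩ := ite_ne_right_iff.1 hz'
  exact ⟨(-p - 1, -q - 1), by simp [zeroPair]⟩

/-- The constant term of `L_m`. -/
def virConst (m : ℤ) : ℂ := if m = 0 then 1 / 4 * ∑ α, (1 / 4 - D.μ α ^ 2) else 0

namespace IsMonodromy

variable {D} (h : D.IsMonodromy)
include h

theorem finite_support_quadTerm {m : ℤ} (hm : -1 ≤ m) (f : TimeSeries n) (e : TimeIdx n →₀ ℕ) :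
    (Function.support (D.quadTerm m f e)).Finite := by
  refine ((D.finite_activePairs (h.isLocal_limKer hm) e).preimage
    quadEquiv.injective.injOn).subset fun x hx => ?_
  rw [Function.mem_support, quadTerm_eq] at hx
  exact D.support_subset_activePairs e f hx

omit h in
theorem finite_support_extraTerm {m : ℤ} (hm : -1 ≤ m) (f : TimeSeries n)
    (e : TimeIdx n →₀ ℕ) : (Function.support (D.extraTerm m f e)).Finite := by
  refine ((D.finite_activePairs (isLocal_extraKer (D := D) hm) e).preimage
    zeroPair_injective.injOn).subset fun x hx => ?_
  rw [Function.mem_support, extraTerm_eq] at hx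
  exact D.support_subset_activePairs e f hx

/-- The Virasoro operator `L_m` for `m ≥ -1`. -/
def virOp {m : ℤ} (hm : -1 ≤ m) : Module.End ℂ (TimeSeries n) :=
  D.quadOp (h.isLocal_ker hm) + D.virConst m • 1

theorem virOp_apply {m : ℤ} (hm : -1 ≤ m) (f : TimeSeries n) :
    h.virOp hm f = D.virasoro m f := by
  funext e
  change (∑ᶠ z : (ExtIdx n × ℤ) × (ExtIdx n × ℤ),
      D.ker m z.1 z.2 * MvPowerSeries.coeff e (D.nord z.1 z.2 f))
        + D.virConst m * MvPowerSeries.coeff e f = _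
  rw [virasoro, virConst, D.finsum_extraTerm]
  congr 1
  rw [finsum_eq_of_bijective (g := fun z : (ExtIdx n × ℤ) × (ExtIdx n × ℤ) =>
    D.limKer m z.1 z.2 * MvPowerSeries.coeff e (D.nord z.1 z.2 f)) quadEquiv quadEquiv.bijective
    fun x => D.quadTerm_eq m f e x]
  rw [← finsum_add_distrib]
  · simp only [ker, add_mul]
  · exact (D.finite_activePairs (h.isLocal_limKer hm) e).subset
      (D.support_subset_activePairs e f)
  · exact (D.finite_activePairs (isLocal_extraKer hm) e).subset
      (D.support_subset_activePairs e f)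

end IsMonodromy
end SpectralData

/-! ### The commutation relations up to a scalar. -/

namespace SpectralData

variable {n : ℕ} (D : SpectralData n)

theorem gen_apply_one {x : ExtIdx n × ℤ} (hx : IsDerIdx x) : D.gen x 1 = 0 := by
  have h1 : ∀ s : TimeIdx n, derTime s 1 = 0 := fun s => MvPowerSeries.pderiv_one
  obtain ⟨_ | α | _, p⟩ := x
  · exact hx.elim
  · have hp : 0 ≤ p := hx
    simp [gen, heis, hp, h1]
  · exact h1 _

namespace IsMonodromy

variable {D} (h : D.IsMonodromy)
include h

theorem quadOp_ker_lie_genLin {m : ℤ} (hm : -1 ≤ m) (v : LoopSpace n) :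
    D.quadOp (h.isLocal_ker hm) * D.genLin v - D.genLin v * D.quadOp (h.isLocal_ker hm)
      = -D.genLin (D.wittOp m v) := by
  induction v using Finsupp.induction_linear with
  | zero => simp
  | add v w hv hw =>
    rw [map_add, map_add, map_add, neg_add, ← hv, ← hw, mul_add, add_mul]
    abel
  | single w c =>
    have e1 : Finsupp.single w c = c • Finsupp.single w (1 : ℂ) := by simp
    have key := h.quadOp_lie (h.isLocal_ker hm) w (-(D.wittOp m (Finsupp.single w 1)))
      fun x => by
        rw [Finsupp.neg_apply, ← h.sum_ker_mul_omega hm]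
        refine Finset.sum_congr rfl fun j _ => ?_
        rw [h.ker_comm hm (j, -w.2 - 1) x, two_mul]
    rw [map_neg] at key
    rw [e1, map_smul, map_smul, map_smul, D.genLin_single, mul_smul_comm, smul_mul_assoc]
    exact (smul_sub c _ _).symm.trans ((congrArg (c • ·) key).trans (smul_neg c _))

theorem virOp_lie_genLin {m : ℤ} (hm : -1 ≤ m) (v : LoopSpace n) :
    h.virOp hm * D.genLin v - D.genLin v * h.virOp hm = -D.genLin (D.wittOp m v) := by
  rw [← h.quadOp_ker_lie_genLin hm, virOp, add_mul, mul_add, smul_mul_assoc, mul_smul_comm,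
    one_mul, mul_one]
  abel

theorem continuous_virOp {m : ℤ} (hm : -1 ≤ m) : Continuous (h.virOp hm) :=
  (D.continuous_quadOp (h.isLocal_ker hm)).add ((continuous_const_smul (D.virConst m)).comp
    continuous_id)

omit h in
theorem mulTime_mem_range_genLin (s : TimeIdx n) : ∃ v, mulTime s = D.genLin v := by
  have key : ∀ x : ExtIdx n × ℤ, ¬ IsDerIdx x → ∃ v, mulTime (timeOf x) = D.genLin v := by
    intro x hx
    refine ⟨((-1 : ℂ) ^ (x.2 + 1)) • Finsupp.single x 1, ?_⟩
    rw [map_smul, D.genLin_single, D.gen_of_not_der hx, smul_smul, ← mul_zpow]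
    simp
  obtain ⟨α, p⟩ | p := s
  · have := key (ExtIdx.mid α, -p - 1) (by simp [IsDerIdx, isDer]; omega)
    simpa [timeOf] using this
  · have := key (ExtIdx.zero, -p - 1) id
    simpa [timeOf] using this

theorem derTime_mem_range_genLin (s : TimeIdx n) : ∃ v, derTime s = D.genLin v := by
  obtain ⟨β, p⟩ | p := s
  · refine ⟨∑ α, D.η β α • Finsupp.single (ExtIdx.mid α, (p : ℤ)) 1, ?_⟩
    have h1 := Matrix.mul_nonsing_inv D.η h.eta_det
    have h2 : ∀ α, D.gen (ExtIdx.mid α, (p : ℤ))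
        = ∑ γ, D.η⁻¹ α γ • derTime (Sum.inl (γ, p)) := by
      intro α
      simp [gen, heis]
    simp only [map_sum, map_smul, D.genLin_single, h2, Finset.smul_sum, smul_smul]
    rw [Finset.sum_comm]
    simp only [← Finset.sum_smul, ← Matrix.mul_apply, h1]
    rw [Finset.sum_eq_single β]
    · simp
    · intro γ _ hγ
      rw [Matrix.one_apply_ne (Ne.symm hγ), zero_smul]
    · simp
  · exact ⟨Finsupp.single (ExtIdx.last, p) 1, (D.genLin_single (ExtIdx.last, p)).symm⟩

/-- By the Jacobi identity [[L_m, L_k], a_v] is the generator attached to [W_m, W_k] v, and the Witt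
relation identifies it with (m-k)[L_{m+k}, a_v]. -/
theorem virOp_lie_sub_commute {m k : ℤ} (hm : -1 ≤ m) (hk : -1 ≤ k) (hmk : -1 ≤ m + k)
    (v : LoopSpace n) :
    (h.virOp hm * h.virOp hk - h.virOp hk * h.virOp hm - ((m - k : ℤ) : ℂ) • h.virOp hmk)
        * D.genLin v
      = D.genLin v * (h.virOp hm * h.virOp hk - h.virOp hk * h.virOp hm
        - ((m - k : ℤ) : ℂ) • h.virOp hmk) := by
  set A := h.virOp hm
  set B := h.virOp hk
  set C := h.virOp hmk
  set G := D.genLin v with hG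
  have hA : ∀ v, A * D.genLin v = D.genLin v * A - D.genLin (D.wittOp m v) := fun v => by
    rw [eq_sub_iff_add_eq, ← sub_eq_zero, sub_eq_iff_eq_add.1 (h.virOp_lie_genLin hm v)]
    abel
  have hB : ∀ v, B * D.genLin v = D.genLin v * B - D.genLin (D.wittOp k v) := fun v => by
    rw [eq_sub_iff_add_eq, ← sub_eq_zero, sub_eq_iff_eq_add.1 (h.virOp_lie_genLin hk v)]
    abel
  have hC : C * G = G * C - D.genLin (D.wittOp (m + k) v) := by
    rw [eq_sub_iff_add_eq, ← sub_eq_zero, sub_eq_iff_eq_add.1 (h.virOp_lie_genLin hmk v)]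
    abel
  have h1 : D.genLin (D.wittOp m (D.wittOp k v)) - D.genLin (D.wittOp k (D.wittOp m v))
      = ((k - m : ℤ) : ℂ) • D.genLin (D.wittOp (m + k) v) := by
    have := LinearMap.congr_fun (D.wittOp_lie hm hk hmk) v
    rw [LinearMap.sub_apply, Module.End.mul_apply, Module.End.mul_apply,
      LinearMap.smul_apply] at this
    rw [← map_sub, this, map_smul]
  have hAB : A * B * G = G * A * B - D.genLin (D.wittOp m v) * B - D.genLin (D.wittOp k v) * A
      + D.genLin (D.wittOp m (D.wittOp k v)) := by
    rw [mul_assoc, hB, mul_sub, ← mul_assoc, hA, hA, sub_mul]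
    abel
  have hBA : B * A * G = G * B * A - D.genLin (D.wittOp k v) * A - D.genLin (D.wittOp m v) * B
      + D.genLin (D.wittOp k (D.wittOp m v)) := by
    rw [mul_assoc, hA, mul_sub, ← mul_assoc, hB, hB, sub_mul]
    abel
  rw [sub_mul, sub_mul, hAB, hBA, smul_mul_assoc, hC, mul_sub, mul_sub, mul_smul_comm, smul_sub,
    ← mul_assoc, ← mul_assoc]
  have h2 : ((m - k : ℤ) : ℂ) • D.genLin (D.wittOp (m + k) v)
      = -(D.genLin (D.wittOp m (D.wittOp k v)) - D.genLin (D.wittOp k (D.wittOp m v))) := by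
    rw [h1]
    push_cast
    module
  rw [h2]
  abel

/-- The commutation relations of the operators `L_m` hold up to constants. -/
theorem virOp_lie_sub_eq_smul {m k : ℤ} (hm : -1 ≤ m) (hk : -1 ≤ k) (hmk : -1 ≤ m + k) :
    h.virOp hm * h.virOp hk - h.virOp hk * h.virOp hm - ((m - k : ℤ) : ℂ) • h.virOp hmk
      = MvPowerSeries.coeff 0 ((h.virOp hm * h.virOp hk - h.virOp hk * h.virOp hm
        - ((m - k : ℤ) : ℂ) • h.virOp hmk) 1) • 1 := by
  apply eq_smul_one_of_commute
  · exact (((h.continuous_virOp hm).comp (h.continuous_virOp hk)).sub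
      ((h.continuous_virOp hk).comp (h.continuous_virOp hm))).sub
      ((continuous_const_smul ((m - k : ℤ) : ℂ)).comp (h.continuous_virOp hmk))
  · intro s
    obtain ⟨v, hv⟩ := mulTime_mem_range_genLin (D := D) s
    rw [hv, h.virOp_lie_sub_commute hm hk hmk]
  · intro s
    obtain ⟨v, hv⟩ := h.derTime_mem_range_genLin s
    rw [hv, h.virOp_lie_sub_commute hm hk hmk]

end IsMonodromy

/-! ### Evaluation of the central term. -/

/-- The commutator of a generator with a linear combination of generators. -/
def omegaLin (x : ExtIdx n × ℤ) : LoopSpace n →ₗ[ℂ] ℂ := Finsupp.linearCombination ℂ (D.omega x)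

theorem omegaLin_single (x y : ExtIdx n × ℤ) :
    D.omegaLin x (Finsupp.single y 1) = D.omega x y := by
  rw [omegaLin, Finsupp.linearCombination_single, one_smul]

open Classical in
/-- Only the pairs of differentiations contribute to the constant coefficient of the image under a
quadratic operator. -/
theorem coeff_quadOp_of_der {b : ExtIdx n × ℤ → ExtIdx n × ℤ → ℂ} (hb : IsLocal b)
    (g : TimeSeries n) : MvPowerSeries.coeff 0 (D.quadOp hb g)
      = ∑ᶠ z : (ExtIdx n × ℤ) × (ExtIdx n × ℤ), if IsDerIdx z.1 ∧ IsDerIdx z.2 then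
          b z.1 z.2 * MvPowerSeries.coeff 0 (D.gen z.1 (D.gen z.2 g)) else 0 := by
  rw [D.coeff_quadOp]
  refine finsum_congr fun z => ?_
  split_ifs with hz
  · rw [nord_eq, if_neg (fun h' => h'.2 hz.2)]
    rfl
  · by_cases h1 : IsDerIdx z.1
    · rw [D.coeff_nord_right (fun h2 => hz ⟨h1, h2⟩) rfl, mul_zero]
    · rw [D.coeff_nord_left h1 rfl, mul_zero]

namespace IsMonodromy

variable {D} (h : D.IsMonodromy)
include h

theorem gen_mul_genLin (x : ExtIdx n × ℤ) (v : LoopSpace n) :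
    D.gen x * D.genLin v = D.genLin v * D.gen x + D.omegaLin x v • 1 := by
  induction v using Finsupp.induction_linear with
  | zero => simp
  | add v w hv hw =>
    rw [map_add, map_add, mul_add, hv, hw, add_mul, add_smul]
    abel
  | single w c =>
    have e1 : Finsupp.single w c = c • Finsupp.single w (1 : ℂ) := by simp
    rw [e1, map_smul, map_smul, D.genLin_single, D.omegaLin_single, mul_smul_comm,
      smul_mul_assoc, h.gen_lie, smul_add, smul_assoc]

open Classical in
-- Differentiations annihilate 1, so a_y applied to the image of 1 under the inner operator is
-- a_{W_k y} 1, and a further differentiation a_x leaves only the scalar commutator.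
theorem coeff_quadOp_quadOp {m k : ℤ} (hm : -1 ≤ m) (hk : -1 ≤ k) :
    MvPowerSeries.coeff 0 (D.quadOp (h.isLocal_ker hm) (D.quadOp (h.isLocal_ker hk) 1))
      = ∑ᶠ z : (ExtIdx n × ℤ) × (ExtIdx n × ℤ), if IsDerIdx z.1 ∧ IsDerIdx z.2 then
          D.ker m z.1 z.2 * D.omegaLin z.1 (D.wittOp k (Finsupp.single z.2 1)) else 0 := by
  rw [D.coeff_quadOp_of_der]
  refine finsum_congr fun z => if_ctx_congr Iff.rfl (fun hz => ?_) fun _ => rfl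
  have h1 := LinearMap.congr_fun (h.quadOp_ker_lie_genLin hk (Finsupp.single z.2 1)) 1
  rw [D.genLin_single, LinearMap.sub_apply, Module.End.mul_apply, Module.End.mul_apply,
    D.gen_apply_one hz.2, map_zero, zero_sub, LinearMap.neg_apply, neg_inj] at h1
  have h2 := LinearMap.congr_fun (h.gen_mul_genLin z.1 (D.wittOp k (Finsupp.single z.2 1))) 1
  rw [LinearMap.add_apply, Module.End.mul_apply, Module.End.mul_apply, D.gen_apply_one hz.1,
    map_zero, zero_add] at h2
  rw [h1, h2]
  simp

omit h in
theorem coeff_quadOp_one {b : ExtIdx n × ℤ → ExtIdx n × ℤ → ℂ} (hb : IsLocal b) :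
    MvPowerSeries.coeff 0 (D.quadOp hb 1) = 0 := by
  classical
  rw [D.coeff_quadOp_of_der, finsum_congr (g := fun _ => 0), finsum_zero]
  intro z
  split_ifs with hz
  · rw [D.gen_apply_one hz.2, map_zero, map_zero, mul_zero]
  · rfl

theorem omegaLin_wittOp_grading {k : ℤ} (hk : -1 ≤ k) {x y : ExtIdx n × ℤ}
    (hxy : D.omegaLin x (D.wittOp k (Finsupp.single y 1)) ≠ 0) :
    (x.2 : ℂ) + y.2 + 1 - D.muT x.1 - D.muT y.1 = -k := by
  rw [h.wittOp_single hk, map_sum] at hxy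
  obtain ⟨i, -, hi⟩ := Finset.exists_ne_zero_of_sum_ne_zero hxy
  rw [map_smul, D.omegaLin_single, smul_eq_mul] at hi
  obtain ⟨s, hs⟩ := h.aeval_RDual_grading _ (left_ne_zero_of_mul hi)
  have h1 := right_ne_zero_of_mul hi
  rw [D.muDiff_eq hs, omega] at h1
  obtain ⟨h2, h3⟩ := ite_ne_right_iff.1 h1
  have h4 := h.etaT_inv_mu (right_ne_zero_of_mul h3)
  simp only at h2 h4
  have h5 : ((x.2 + (y.2 + k + s) + 1 : ℤ) : ℂ) = 0 := by rw [h2, Int.cast_zero]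
  push_cast at h5
  linear_combination h5 - h4 + hs

/-- The kernel lives in degree m and the contraction with W_k in degree -k. -/
theorem coeff_quadOp_quadOp_of_ne {m k : ℤ} (hm : -1 ≤ m) (hk : -1 ≤ k) (hmk : m + k ≠ 0) :
    MvPowerSeries.coeff 0 (D.quadOp (h.isLocal_ker hm) (D.quadOp (h.isLocal_ker hk) 1)) = 0 := by
  classical
  rw [h.coeff_quadOp_quadOp hm hk, finsum_congr (g := fun _ => 0), finsum_zero]
  intro z
  split_ifs
  · by_contra h0
    have h1 := h.ker_grading hm _ _ (left_ne_zero_of_mul h0)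
    have h2 := h.omegaLin_wittOp_grading hk (right_ne_zero_of_mul h0)
    apply hmk
    have h3 : (m : ℂ) = -k := h1.symm.trans h2
    exact_mod_cast (by rw [h3]; ring : (m : ℂ) + k = 0)
  · rfl

omit h in
theorem omegaLin_wittOp_neg_one (x y : ExtIdx n × ℤ) :
    D.omegaLin x (D.wittOp (-1) (Finsupp.single y 1)) = D.omega x (y.1, y.2 - 1) := by
  have h1 : D.wittOp (-1) = shiftOp (-1) := by
    simp [wittOp]
  rw [h1, shiftOp_single, D.omegaLin_single]
  rfl

/-- For m = -1 the kernel is a multiple of η̃, so a nonzero entry has μ_α + μ_β = 0; the grading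
then demands p + q = -2, impossible for two differentiations. -/
theorem ker_neg_one_of_der {x y : ExtIdx n × ℤ} (hx : IsDerIdx x) (hy : IsDerIdx y) :
    D.ker (-1) x y = 0 := by
  by_contra h0
  obtain ⟨hx', hy'⟩ := h.ker_last le_rfl x y hx hy h0
  obtain ⟨_ | α | _, p⟩ := x
  · exact hx
  · obtain ⟨_ | β | _, q⟩ := y
    · exact hy
    · have hp : 0 ≤ p := hx
      have hq : 0 ≤ q := hy
      have h1 := h.ker_grading le_rfl _ _ h0
      have h3 : D.etaT (ExtIdx.mid α) (ExtIdx.mid β) ≠ 0 := by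
        rw [h.ker_eq le_rfl] at h0
        have h4 := (ite_ne_right_iff.1 h0).2
        simp at h4
        exact h4.2
      have h2 := h.etaT_mu h3
      have h5 : ((p + q + 2 : ℤ) : ℂ) = 0 := by
        push_cast at h1 ⊢
        linear_combination h1 + h2
      have h6 : p + q + 2 = 0 := by exact_mod_cast h5
      omega
    · exact hy' rfl
  · exact hx' rfl

theorem coeff_quadOp_neg_one {g : TimeSeries n} :
    MvPowerSeries.coeff 0 (D.quadOp (h.isLocal_ker le_rfl) g) = 0 := by
  classical
  rw [D.coeff_quadOp_of_der, finsum_congr (g := fun _ => 0), finsum_zero]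
  intro z
  split_ifs with hz
  · rw [h.ker_neg_one_of_der hz.1 hz.2, zero_mul]
  · rfl

theorem aeval_RX_mid (P : Polynomial ℂ) {α β : Fin n} (hαβ : D.μ α = D.μ β) :
    Polynomial.aeval D.RX P (ExtIdx.mid α) (ExtIdx.mid β) = if α = β then P.coeff 0 else 0 := by
  rw [D.aeval_RX, Matrix.add_apply, Matrix.single_apply_of_ne _ _ _ _ _ (by simp), add_zero]
  induction P using Polynomial.induction_on' with
  | add P Q hP hQ =>
    rw [map_add, Matrix.add_apply, hP, hQ, Polynomial.coeff_add]
    split_ifs <;> simp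
  | monomial k a =>
    rw [Polynomial.aeval_monomial, ← Algebra.smul_def, Matrix.smul_apply]
    cases k with
    | zero => simp [Matrix.one_apply]
    | succ k =>
      have h0 : (D.RT ^ (k + 1)) (ExtIdx.mid α) (ExtIdx.mid β) = 0 := by
        by_contra hne
        obtain ⟨s, hs, h1⟩ := h.RT_pow_grading _ hne
        have h2 : (s : ℂ) = 0 := by
          simp only [muT] at h1
          linear_combination -h1 + hαβ
        have h3 : s = 0 := by exact_mod_cast h2
        omega
      rw [h0]
      simp

/-- The rising factorial x(x+1) at x = μ_β - 1/2 is μ_β² - 1/4. Powers of R̃ do not contribute,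
since they raise the eigenvalue. -/
theorem ker_one_mid_zero {α β : Fin n} (hαβ : D.μ α = -D.μ β) :
    D.ker 1 (ExtIdx.mid α, 0) (ExtIdx.mid β, 0) = 1 / 2 * (1 / 4 - D.μ β ^ 2) * D.η α β := by
  have hT : (Polynomial.taylor (D.μ β + (-0 - 1 / 2)) (ascPochhammer ℂ (1 + 1 : ℤ).toNat)).coeff 0
      = D.μ β ^ 2 - 1 / 4 := by
    rw [Polynomial.taylor_coeff_zero, show (1 + 1 : ℤ).toNat = 2 from rfl,
      ascPochhammer_succ_eval, ascPochhammer_one, Polynomial.eval_X]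
    push_cast
    ring
  have hsum : ∀ A : Matrix (ExtIdx n) (ExtIdx n) ℂ, (D.etaT * A) (ExtIdx.mid α) (ExtIdx.mid β)
      = ∑ γ, D.η α γ * A (ExtIdx.mid γ) (ExtIdx.mid β) := by
    intro A
    simp [Matrix.mul_apply, etaT, Fintype.sum_sum_type]
  rw [h.ker_eq (by norm_num), if_pos, hsum, Finset.sum_eq_single β]
  · rw [h.aeval_RX_mid _ rfl, if_pos rfl]
    simp only [muT, Int.cast_zero] at hT ⊢
    rw [hT]
    norm_num
    ring
  · intro γ _ hγ
    by_cases h0 : D.η α γ = 0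
    · rw [h0, zero_mul]
    · have h1 := h.eta_mu α γ h0
      rw [h.aeval_RX_mid _ (by linear_combination h1 - hαβ), if_neg hγ, mul_zero]
  · simp
  · simp only [muT, hαβ]
    simp

/-- As W_{-1} is a pure shift, the contraction requires p + q = 0, hence p = q = 0 for
differentiations. Summing against η⁻¹ gives (1/2) tr(1/4 - μ²). -/
theorem coeff_quadOp_one_neg_one :
    MvPowerSeries.coeff 0 (D.quadOp (h.isLocal_ker (show (-1 : ℤ) ≤ 1 by norm_num))
      (D.quadOp (h.isLocal_ker le_rfl) 1)) = 2 * D.virConst 0 := by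
  classical
  rw [h.coeff_quadOp_quadOp (by norm_num) le_rfl]
  have hinj : Function.Injective fun z : Fin n × Fin n =>
      (((ExtIdx.mid z.1, 0), (ExtIdx.mid z.2, 0)) : (ExtIdx n × ℤ) × (ExtIdx n × ℤ)) := by
    rintro ⟨α, β⟩ ⟨γ, δ⟩ hz
    simpa using hz
  rw [finsum_eq_sum_of_support_subset (s := Finset.univ.image fun z : Fin n × Fin n =>
      (((ExtIdx.mid z.1, 0), (ExtIdx.mid z.2, 0)) : (ExtIdx n × ℤ) × (ExtIdx n × ℤ))),
    Finset.sum_image fun _ _ _ _ hz => hinj hz]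
  · have hterm : ∀ α β : Fin n, (if IsDerIdx ((ExtIdx.mid α, 0) : ExtIdx n × ℤ) ∧
        IsDerIdx ((ExtIdx.mid β, 0) : ExtIdx n × ℤ) then
        D.ker 1 (ExtIdx.mid α, 0) (ExtIdx.mid β, 0) * D.omegaLin (ExtIdx.mid α, 0)
          (D.wittOp (-1) (Finsupp.single (ExtIdx.mid β, 0) 1)) else 0)
        = 1 / 2 * (1 / 4 - D.μ β ^ 2) * (D.η β α * D.η⁻¹ α β) := by
      intro α β
      rw [if_pos ⟨le_rfl, le_rfl⟩, omegaLin_wittOp_neg_one, omega, if_pos (by simp), h.etaT_inv]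
      simp only [etaInv, Matrix.of_apply, zpow_zero, one_mul]
      have hs : D.η β α = D.η α β := h.eta_symm β α
      by_cases h0 : D.η⁻¹ α β = 0
      · rw [h0]
        ring
      · have h1 : D.muT (ExtIdx.mid α) = -D.muT (ExtIdx.mid β) :=
          h.etaT_inv_mu (by rw [h.etaT_inv]; exact h0)
        rw [h.ker_one_mid_zero h1, hs]
        ring
    simp only [hterm]
    rw [Fintype.sum_prod_type_right]
    simp only [← Finset.mul_sum, ← Matrix.mul_apply, Matrix.mul_nonsing_inv D.η h.eta_det,
      Matrix.one_apply_eq]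
    rw [virConst, if_pos rfl]
    simp only [mul_one]
    rw [← Finset.mul_sum]
    ring
  · rintro ⟨x, y⟩ hz
    obtain ⟨⟨hx, hy⟩, hne⟩ := ite_ne_right_iff.1 hz
    obtain ⟨hx', hy'⟩ := h.ker_last (by norm_num) x y hx hy (left_ne_zero_of_mul hne)
    have h1 := right_ne_zero_of_mul hne
    rw [omegaLin_wittOp_neg_one, omega] at h1
    have h2 := (ite_ne_right_iff.1 h1).1
    obtain ⟨_ | α | _, p⟩ := x
    · exact hx.elim
    · obtain ⟨_ | β | _, q⟩ := y
      · exact hy.elim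
      · have hp : 0 ≤ p := hx
        have hq : 0 ≤ q := hy
        simp only at h2
        have hp0 : p = 0 := by omega
        have hq0 : q = 0 := by omega
        subst hp0 hq0
        simp
      · exact (hy' rfl).elim
    · exact (hx' rfl).elim

theorem coeff_virOp_lie_sub {m k : ℤ} (hm : -1 ≤ m) (hk : -1 ≤ k) (hmk : -1 ≤ m + k) :
    MvPowerSeries.coeff 0 ((h.virOp hm * h.virOp hk - h.virOp hk * h.virOp hm
        - ((m - k : ℤ) : ℂ) • h.virOp hmk) 1)
      = MvPowerSeries.coeff 0 (D.quadOp (h.isLocal_ker hm) (D.quadOp (h.isLocal_ker hk) 1))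
        - MvPowerSeries.coeff 0 (D.quadOp (h.isLocal_ker hk) (D.quadOp (h.isLocal_ker hm) 1))
        - ((m - k : ℤ) : ℂ) * D.virConst (m + k) := by
  simp only [virOp, LinearMap.sub_apply, Module.End.mul_apply, LinearMap.add_apply,
    LinearMap.smul_apply, Module.End.one_apply, map_add, map_sub, map_smul, smul_eq_mul,
    coeff_quadOp_one, MvPowerSeries.coeff_zero_one]
  ring

/-- The Virasoro commutation relations. -/
theorem virOp_lie {m k : ℤ} (hm : -1 ≤ m) (hk : -1 ≤ k) (hmk : -1 ≤ m + k) :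
    h.virOp hm * h.virOp hk - h.virOp hk * h.virOp hm = ((m - k : ℤ) : ℂ) • h.virOp hmk := by
  rw [← sub_eq_zero, h.virOp_lie_sub_eq_smul hm hk hmk, h.coeff_virOp_lie_sub hm hk hmk]
  convert zero_smul ℂ (1 : Module.End ℂ (TimeSeries n)) using 2
  by_cases h0 : m + k = 0
  -- For (0, 0) the two terms cancel; for (1, -1) and its mirror image the trace in L_0, with factor
  -- m - k = ±2, accounts for the anomaly.
  · obtain rfl | rfl | rfl : m = 0 ∨ m = 1 ∨ m = -1 := by omega
    · obtain rfl : k = 0 := by omega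
      simp
    · obtain rfl : k = -1 := by omega
      rw [h.coeff_quadOp_one_neg_one, h.coeff_quadOp_neg_one]
      norm_num
    · obtain rfl : k = 1 := by omega
      rw [h.coeff_quadOp_one_neg_one, h.coeff_quadOp_neg_one]
      norm_num
  · rw [h.coeff_quadOp_quadOp_of_ne hm hk h0, h.coeff_quadOp_quadOp_of_ne hk hm (by omega),
      virConst, if_neg h0]
    ring

end IsMonodromy
end SpectralData

end GFM

end

theorem proposition8p2 {𝕜 : Type*} [RCLike 𝕜] {n : ℕ} {M : Type*} [TopologicalSpace M]
    [ChartedSpace (Fin n → 𝕜) M] [IsManifold 𝓘(𝕜, Fin n → 𝕜) ∞ M]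
    (F : GFM.GeneralizedFrobenius 𝕜 n M) (K : GFM.Calibration F) :
    -- the limit as `ν → 0` in the definition of the operators exists
    (∀ m : ℤ, -1 ≤ m → ∀ (p q : ℤ) (i j : GFM.ExtIdx n),
      Filter.Tendsto (fun ν : ℂ => K.data.regCoeff ν m p q i j) (𝓝[≠] 0)
        (𝓝 (K.data.limCoeff m p q i j))) ∧
    -- each coefficient of `L_m f` is given by finite sums
    (∀ m : ℤ, -1 ≤ m → ∀ (f : GFM.TimeSeries n) (e : GFM.TimeIdx n →₀ ℕ),
      (Function.support (K.data.quadTerm m f e)).Finite ∧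
      (Function.support (K.data.extraTerm m f e)).Finite) ∧
    -- the `L_m` are linear operators with the Virasoro commutation relations
    ∃ L : ℤ → Module.End ℂ (GFM.TimeSeries n),
      (∀ m : ℤ, -1 ≤ m → ∀ f, L m f = K.data.virasoro m f) ∧
      ∀ m k : ℤ, -1 ≤ m → -1 ≤ k → ⁅L m, L k⁆ = ((m - k : ℤ) : ℂ) • L (m + k) := by
  have h := K.isMonodromy
  refine ⟨fun m hm p q i j => ?_, fun m hm f e =>
    ⟨h.finite_support_quadTerm hm f e,
      GFM.SpectralData.IsMonodromy.finite_support_extraTerm hm f e⟩,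
    fun m => if hm : -1 ≤ m then h.virOp hm else 0, fun m hm f => ?_, fun m k hm hk => ?_⟩
  · rw [h.limCoeff_eq hm]
    exact h.tendsto_regCoeff hm p q i j
  · simp only [dif_pos hm]
    exact h.virOp_apply hm f
  · rw [Ring.lie_def]
    by_cases hmk : -1 ≤ m + k
    · simp only [dif_pos hm, dif_pos hk, dif_pos hmk]
      exact h.virOp_lie hm hk hmk
    -- Only m = k = -1 remains: the commutator of an operator with itself and the factor m - k are
    -- both zero.
    · obtain rfl : m = -1 := by omega
      obtain rfl : k = -1 := by omega
      simp
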